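/- **Setting.** Let $V:\mathbb{R}^d\to\mathbb{R}^d$ be monotone ($\langle V(z)-V(z'),z-z'\rangle\ge 0$ for all $z,z'$), $L$-smooth ($\|V(z)-V(z')\|\le L\|z-z'\|$ for all $z,z'$) and bounded ($\|V(x)\|\le G$ for all $x$), with Euclidean norms. Let $\widetilde V(\cdot,\xi)$, $\xi\sim\nu$, be an unbiased oracle with variance at most $\sigma^2$, $\sigma>0$: $\mathbb{E}_\xi[\widetilde V(z,\xi)]=V(z)$ and $\mathbb{E}_\xi\|V(z)-\widetilde V(z,\xi)\|^2\le\sigma^2$ for every $z$. Let $d,M,K,R,H\ge 1$ be integers, $T=KR$, and $D>0$. **Algorithm (SLIPPAX).** There are $M$ machines, and $z_0^m=0$ for $m=1,\dots,M$. For $t=1,\dots,T$, each machine $m$ sets $x_{t,0}^m=z_{t-1}^m$ and, for $\ell=1,\dots,H$, $$x^m_{t,\ell}=x^m_{t,\ell-1}-\gamma\Big(\widetilde V\big(x^m_{t,\ell-1}+\delta s^m_{t,\ell},\,\xi^m_{t,\ell}\big)+\tfrac1\eta\big(x^m_{t,\ell-1}-z^m_{t-1}\big)\Big),\qquad s^m_{t,\ell}\sim\mathcal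 N(0,I_d).$$ It sets $x_t^m=x_{t,H}^m$ and $w_t^m=z_{t-1}^m-\eta\widetilde V(x_t^m,\xi_{t,H+1}^m)$. Then $z_t^m=w_t^m$ if $K\nmid t$, and $z_t^m=\frac1M\sum_{m'=1}^M w_t^{m'}$ if $K\mid t$. All $\xi^m_{t,\ell}\sim\nu$ and all $s^m_{t,\ell}$ are independent. The output is $x_o=\frac1{MT}\sum_{m=1}^M\sum_{t=1}^T x_t^m$. **Theorem.** Let $$\eta=\min\left\{\frac{D^{1/2}}{K^{1/4}R^{1/4}L^{1/2}\sigma^{1/2}d^{1/8}},\ \frac{D^{2/5}}{\sigma^{2/5}L^{2/5}d^{1/10}K^{3/5}R^{1/5}},\ \frac{D^{2/3}}{K^{2/3}R^{1/3}\sigma^{2/3}L^{2/3}},\ \frac{D\sqrt M}{\sigma\sqrt{KR}},\ \frac1L\right\},$$ $\delta=\eta\sigma/\sqrt d$ and $\gamma=\frac{1}{\eta(L+1/\eta)^2}$. For every $L_0>0$ there is a constant $C>0$ that depends only on $L_0$ such that, whenever $L\ge L_0$, the random variable $\sup_{\|z\|\le D}\langle V(z),x_o-z\rangle$ is integrable and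 $$\mathbb{E}\Big[\sup_{\|z\|\le D}\langle V(z),x_o-z\rangle\Big]\le C\Bigg(\Big[\frac{D^2L}{KR}+\frac{D\sigma}{\sqrt{MKR}}+\frac{D^{4/3}\sigma^{2/3}L^{2/3}}{K^{1/3}R^{2/3}}\Big]+\Big[\frac{D^{3/2}L^{1/2}\sigma^{1/2}d^{1/8}}{K^{3/4}R^{3/4}}+\frac{D^{8/5}\sigma^{2/5}L^{2/5}d^{1/10}}{R^{4/5}K^{2/5}}\Big]+\Big(\frac34\Big)^{H}\Big[G^2+K^2L^2G^2+\frac{H^2L^2d^{1/2}G^4}{\sigma^2}\Big]\Bigg).$$ In particular, $C$ is an absolute constant for $L\ge 1$. No assumption on second derivatives of $V$ is made. -/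

import Mathlib

namespace Slippax

open MeasureTheory ProbabilityTheory

/-- `ℝ^d` with its Euclidean norm and inner product. -/
abbrev Vec (d : ℕ) : Type := EuclideanSpace ℝ (Fin d)

/-- Monotonicity of an operator `V : ℝ^d → ℝ^d`. -/
def MonotoneOperator {d : ℕ} (V : Vec d → Vec d) : Prop :=
  ∀ z z' : Vec d, 0 ≤ inner ℝ (V z - V z') (z - z')

/-- `L`-smoothness of an operator, that is, Lipschitz continuity with constant `L`. -/
def SmoothOperator {d : ℕ} (L : ℝ) (V : Vec d → Vec d) : Prop :=
  ∀ z z' : Vec d, ‖V z - V z'‖ ≤ L * ‖z - z'‖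

/-- `Vt` is an unbiased stochastic oracle for `V`, with samples of law `ν` and variance at most
`σ ^ 2`. -/
structure UnbiasedOracle {d : ℕ} {Ξ : Type*} [MeasurableSpace Ξ] (ν : Measure Ξ)
    (Vt : Vec d → Ξ → Vec d) (V : Vec d → Vec d) (σ : ℝ) : Prop where
  measurable : Measurable fun p : Vec d × Ξ => Vt p.1 p.2
  integrable : ∀ z, Integrable (Vt z) ν
  unbiased : ∀ z, ∫ ξ, Vt z ξ ∂ν = V z
  integrable_sq : ∀ z, Integrable (fun ξ => ‖V z - Vt z ξ‖ ^ 2) ν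
  variance_le : ∀ z, ∫ ξ, ‖V z - Vt z ξ‖ ^ 2 ∂ν ≤ σ ^ 2

/-- The randomness of the algorithm. In iteration `t`, machine `m` makes `H + 1` oracle queries,
numbered `ℓ = 1, …, H` (inner loop) and `ℓ = H + 1` (outer step); the query `ℓ` consumes the oracle
sample `ξ t m ℓ`, and the inner query `ℓ ≤ H` also consumes the Gaussian vector `s t m ℓ`.
The samples `ξ t m ℓ` are i.i.d. with law `ν`, the vectors `s t m ℓ` are i.i.d. standard Gaussian,
and the two families are independent of each other. -/
structure IndependentSamples {d M : ℕ} {Ξ Ω : Type*} [MeasurableSpace Ξ] [MeasurableSpace Ω]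
    (P : Measure Ω) (ν : Measure Ξ) (s : ℕ → Fin M → ℕ → Ω → Vec d)
    (ξ : ℕ → Fin M → ℕ → Ω → Ξ) : Prop where
  measurable_gauss : ∀ t m ℓ, Measurable (s t m ℓ)
  measurable_sample : ∀ t m ℓ, Measurable (ξ t m ℓ)
  law_gauss : ∀ t m ℓ, P.map (s t m ℓ) = stdGaussian (Vec d)
  law_sample : ∀ t m ℓ, P.map (ξ t m ℓ) = ν
  indep_gauss : iIndepFun (fun i : ℕ × Fin M × ℕ => s i.1 i.2.1 i.2.2) P
  indep_sample : iIndepFun (fun i : ℕ × Fin M × ℕ => ξ i.1 i.2.1 i.2.2) P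
  indep_gauss_sample :
    IndepFun (fun ω (i : ℕ × Fin M × ℕ) => s i.1 i.2.1 i.2.2 ω)
      (fun ω (i : ℕ × Fin M × ℕ) => ξ i.1 i.2.1 i.2.2 ω) P

section Algorithm

variable {d M : ℕ} {Ξ : Type*}

/-- The inner loop on one machine, started at `z`: the iterate after `ℓ` steps, for the realized
Gaussian vectors `s 1, s 2, …` and oracle samples `ξ 1, ξ 2, …`. -/
noncomputable def innerIter (Vt : Vec d → Ξ → Vec d) (η γ δ : ℝ) (z : Vec d)
    (s : ℕ → Vec d) (ξ : ℕ → Ξ) : ℕ → Vec d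
  | 0 => z
  | ℓ + 1 =>
    innerIter Vt η γ δ z s ξ ℓ -
      γ • (Vt (innerIter Vt η γ δ z s ξ ℓ + δ • s (ℓ + 1)) (ξ (ℓ + 1)) +
        (1 / η) • (innerIter Vt η γ δ z s ξ ℓ - z))

/-- The iterate `z_t^m`, with initialization at the origin and averaging over the machines whenever
`K` divides `t`. -/
noncomputable def outerIter (Vt : Vec d → Ξ → Vec d) (η γ δ : ℝ) (K H : ℕ)
    (s : ℕ → Fin M → ℕ → Vec d) (ξ : ℕ → Fin M → ℕ → Ξ) : ℕ → Fin M → Vec d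
  | 0 => fun _ => 0
  | t + 1 =>
    let w : Fin M → Vec d := fun m =>
      outerIter Vt η γ δ K H s ξ t m -
        η • Vt (innerIter Vt η γ δ (outerIter Vt η γ δ K H s ξ t m) (s (t + 1) m) (ξ (t + 1) m) H)
          (ξ (t + 1) m (H + 1))
    if (t + 1) % K = 0 then fun _ => (1 / (M : ℝ)) • ∑ m, w m else w

/-- The point `x_t^m`, for `1 ≤ t`: the result of the `H` inner steps of machine `m` in iteration
`t`, started at `z_{t-1}^m`. -/
noncomputable def proxIter (Vt : Vec d → Ξ → Vec d) (η γ δ : ℝ) (K H : ℕ)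
    (s : ℕ → Fin M → ℕ → Vec d) (ξ : ℕ → Fin M → ℕ → Ξ) (t : ℕ) (m : Fin M) : Vec d :=
  innerIter Vt η γ δ (outerIter Vt η γ δ K H s ξ (t - 1) m) (s t m) (ξ t m) H

/-- The output `x_o` of SLIPPAX after `T` iterations: the average of all `x_t^m`. -/
noncomputable def output (Vt : Vec d → Ξ → Vec d) (η γ δ : ℝ) (K H T : ℕ)
    (s : ℕ → Fin M → ℕ → Vec d) (ξ : ℕ → Fin M → ℕ → Ξ) : Vec d :=
  (1 / ((M : ℝ) * (T : ℝ))) • ∑ m : Fin M, ∑ t ∈ Finset.Icc 1 T, proxIter Vt η γ δ K H s ξ t m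

end Algorithm

/-- The restricted gap `sup_{‖z‖ ≤ D} ⟨V z, x - z⟩`. The ball is centred at the common starting
point `0` of the machines. -/
noncomputable def gap {d : ℕ} (V : Vec d → Vec d) (D : ℝ) (x : Vec d) : ℝ :=
  sSup ((fun z : Vec d => inner ℝ (V z) (x - z)) '' {z | ‖z‖ ≤ D})

/-- The outer step size `η`. -/
noncomputable def stepSize (d M K R : ℕ) (L σ D : ℝ) : ℝ :=
  min (D ^ (1 / 2 : ℝ) /
      ((K : ℝ) ^ (1 / 4 : ℝ) * (R : ℝ) ^ (1 / 4 : ℝ) * L ^ (1 / 2 : ℝ) * σ ^ (1 / 2 : ℝ) *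
        (d : ℝ) ^ (1 / 8 : ℝ)))
    (min (D ^ (2 / 5 : ℝ) /
        (σ ^ (2 / 5 : ℝ) * L ^ (2 / 5 : ℝ) * (d : ℝ) ^ (1 / 10 : ℝ) * (K : ℝ) ^ (3 / 5 : ℝ) *
          (R : ℝ) ^ (1 / 5 : ℝ)))
      (min (D ^ (2 / 3 : ℝ) /
          ((K : ℝ) ^ (2 / 3 : ℝ) * (R : ℝ) ^ (1 / 3 : ℝ) * σ ^ (2 / 3 : ℝ) * L ^ (2 / 3 : ℝ)))
        (min (D * √(M : ℝ) / (σ * √((K : ℝ) * (R : ℝ)))) (1 / L))))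

/-- The smoothing radius `δ = η σ / √d`. -/
noncomputable def smoothingRadius (d : ℕ) (η σ : ℝ) : ℝ := η * σ / √(d : ℝ)

/-- The inner step size `γ = 1 / (η (L + 1/η)^2)`. -/
noncomputable def innerStepSize (η L : ℝ) : ℝ := 1 / (η * (L + 1 / η) ^ 2)

end Slippax

namespace Slippax
open MeasureTheory ProbabilityTheory

/-! ### The resolvent of a monotone operator and the inner gradient step -/

/-! Each outer step is an inexact resolvent step. With `J` the resolvent of `η V` at `z`, the exact
step sends `z` to `J = z - η V J`, while a machine moves to `J` plus the error `-η (V x - V J)`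
minus `η` times the oracle noise (`Run.w_eq`). The inner loop is a stochastic iteration for a
strongly monotone equation with root `J`. As `η L ≤ 1`, each step contracts squared distances by at
least `3/4`, so the final root mean square error is of order `(3/4)^(H/2) η G + η σ`
(`rms_innerPath_sub_le`). The mean of the last iterate is closer to `J`: up to the decaying term its
error is of order `η² L σ` (`norm_mean_innerPath_sub_le`), because the noise averages out and only a
Lipschitz remainder is left. The Gaussian smoothing is treated as one more perturbation, of root
mean square size `δ √d = η σ`; no second derivative of `V` is needed.

The gap is bounded by the usual regret argument for the average `zbar` of the machines, which does
not see the synchronization (`Run.zbar_succ`). Besides `D² / (η T)` and the averaged noise, two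
errors remain. The inexactness of the proximal point is `Run.prox_residual_le`: the bias of the
residual is tested against `V J`, which depends on the past only, and the resulting multiple of `‖V
x‖²` is absorbed by the negative square that a proximal step provides. The disagreement of the
machines is `Run.integral_drift_term_le`: it is a sum of pairings `⟨V J - V J', z - z'⟩` over pairs
of machines.

The drift is controlled by a refined nonexpansiveness: the resolvent decreases `‖z - z'‖²` by at
least `η` times this same pairing. Over the `K` steps between averagings this bounds the mean square
drift by `U` and, by telescoping, the time average of the pairing by `U / (K η)` (`drift_recursion`,
`Run.drift_bounds`). The Lipschitz property gives the alternative bound `L U`, and the better of the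
two is used (`Run.min_driftBound_le`).

Finally, each candidate in the minimum defining `η` balances one error against `Q = D² / (η K R)`.
All errors are then at most constants times `Q`, the statistical term and the inner-loop remainder,
and `Q` itself equals one summand of the rate, according to which candidate is the minimum
(`stepSize_bounds`, `div_stepSize_le_rate`). -/

/-- The standing relations between the parameters of the inner loop. -/
structure StepSizes (d : ℕ) (L σ η γ δ : ℝ) : Prop where
  dim_pos : 1 ≤ d
  L_pos : 0 < L
  sigma_pos : 0 < σ
  eta_pos : 0 < η
  eta_mul_le : η * L ≤ 1
  gamma_eq : γ = innerStepSize η L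
  delta_eq : δ = smoothingRadius d η σ

/-- The boundedness, Lipschitz and monotonicity assumptions on the operator. -/
structure RegularOperator {d : ℕ} (L G : ℝ) (V : Vec d → Vec d) : Prop where
  smooth : SmoothOperator L V
  mono : MonotoneOperator V
  bound : ∀ x, ‖V x‖ ≤ G

/-- The squared contraction factor `1 - γ / η` of an inner step. -/
noncomputable def contractionFactor (η γ : ℝ) : ℝ := 1 - γ / η

section Parameters

variable {d : ℕ} {L σ η γ δ : ℝ}

lemma StepSizes.gamma_div (h : StepSizes d L σ η γ δ) : γ / η = 1 / (1 + η * L) ^ 2 := by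
  have h1 := h.eta_pos
  have h2 := h.L_pos
  rw [h.gamma_eq, innerStepSize]
  have : L + 1 / η = (1 + η * L) / η := by field_simp; ring
  rw [this]
  field_simp

lemma StepSizes.gamma_eq_mul (h : StepSizes d L σ η γ δ) :
    γ = η * (1 - contractionFactor η γ) := by
  have h1 := h.eta_pos
  rw [contractionFactor]; field_simp; ring

/-- Because `η L ≤ 1`, the ratio `γ / η = 1 / (1 + η L)²` is at least `1/4`. This is the source of
the rate `3/4` in the theorem. -/
lemma StepSizes.factor_le (h : StepSizes d L σ η γ δ) : contractionFactor η γ ≤ 3 / 4 := by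
  have h1 : 0 < η * L := mul_pos h.eta_pos h.L_pos
  have h2 := h.eta_mul_le
  rw [contractionFactor, h.gamma_div]
  have : 1 / 4 ≤ 1 / (1 + η * L) ^ 2 := by
    apply one_div_le_one_div_of_le (by positivity)
    nlinarith
  linarith

lemma StepSizes.factor_nonneg (h : StepSizes d L σ η γ δ) : 0 ≤ contractionFactor η γ := by
  have h1 : 0 < η * L := mul_pos h.eta_pos h.L_pos
  rw [contractionFactor, h.gamma_div, sub_nonneg, div_le_one (by positivity)]
  nlinarith

lemma StepSizes.gamma_pos (h : StepSizes d L σ η γ δ) : 0 < γ := by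
  have h1 := h.eta_pos
  rw [h.gamma_eq_mul]
  nlinarith [h.factor_le]

lemma StepSizes.delta_nonneg (h : StepSizes d L σ η γ δ) : 0 ≤ δ := by
  have h1 := h.eta_pos
  have h2 := h.sigma_pos
  rw [h.delta_eq, smoothingRadius]
  positivity

lemma StepSizes.delta_mul_sqrt (h : StepSizes d L σ η γ δ) : δ * √(d : ℝ) = η * σ := by
  have h0 : (0 : ℝ) < d := by exact_mod_cast h.dim_pos
  rw [h.delta_eq, smoothingRadius]
  have : √(d : ℝ) ≠ 0 := by positivity
  field_simp

end Parameters

section Operator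

variable {d : ℕ} {L G σ η γ δ : ℝ} {V : Vec d → Vec d}

lemma RegularOperator.lipschitz (hV : RegularOperator L G V) (hL : 0 ≤ L) :
    LipschitzWith L.toNNReal V := by
  apply LipschitzWith.of_dist_le_mul
  intro x y
  rw [dist_eq_norm, dist_eq_norm, Real.coe_toNNReal _ hL]
  exact hV.smooth x y

lemma RegularOperator.measurable (hV : RegularOperator L G V) (hL : 0 ≤ L) : Measurable V :=
  (hV.lipschitz hL).continuous.measurable

lemma RegularOperator.bound_nonneg (hV : RegularOperator L G V) : 0 ≤ G :=
  (norm_nonneg _).trans (hV.bound 0)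

/-- A gradient step on the regularized operator `x ↦ V x + (x - z) / η`. -/
noncomputable def proxStep (V : Vec d → Vec d) (η γ : ℝ) (z x : Vec d) : Vec d :=
  x - γ • (V x + (1 / η) • (x - z))

/-- The regularized operator is `1/η`-strongly monotone and `(L + 1/η)`-Lipschitz, and `γ` is the
step that minimizes the resulting quadratic bound `1 - 2γ/η + γ² (L + 1/η)²`. -/
lemma norm_proxStep_sub_sq_le (hV : RegularOperator L G V) (h : StepSizes d L σ η γ δ)
    (z x y : Vec d) :
    ‖proxStep V η γ z x - proxStep V η γ z y‖ ^ 2 ≤ contractionFactor η γ * ‖x - y‖ ^ 2 := by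
  have h1 := h.eta_pos
  have hL := h.L_pos
  have hγ := h.gamma_pos
  set f := V x - V y + (1 / η) • (x - y) with hf
  have e : proxStep V η γ z x - proxStep V η γ z y = (x - y) - γ • f := by
    simp only [proxStep, hf]; module
  have hfn : ‖f‖ ≤ (L + 1 / η) * ‖x - y‖ := by
    calc ‖f‖ ≤ ‖V x - V y‖ + ‖(1 / η) • (x - y)‖ := norm_add_le _ _
      _ ≤ L * ‖x - y‖ + 1 / η * ‖x - y‖ := by
        gcongr
        · exact hV.smooth x y
        · rw [norm_smul, Real.norm_of_nonneg (by positivity)]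
      _ = _ := by ring
  have hfi : 1 / η * ‖x - y‖ ^ 2 ≤ inner ℝ (x - y) f := by
    rw [hf, inner_add_right, inner_smul_right, real_inner_self_eq_norm_sq, real_inner_comm]
    linarith [hV.mono x y]
  have hfn2 : ‖f‖ ^ 2 ≤ ((L + 1 / η) * ‖x - y‖) ^ 2 := by gcongr
  rw [e, norm_sub_sq_real, inner_smul_right, norm_smul, mul_pow, Real.norm_eq_abs, sq_abs]
  -- For this `γ` the quadratic term costs exactly half of the first-order gain `2γ / η`.
  have hg : γ ^ 2 * (L + 1 / η) ^ 2 = γ / η := by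
    have : γ * (η * (L + 1 / η) ^ 2) = 1 := by
      rw [h.gamma_eq, innerStepSize]; field_simp
    field_simp at this ⊢
    linear_combination this
  rw [contractionFactor]
  have a1 : γ * (1 / η * ‖x - y‖ ^ 2) ≤ γ * inner ℝ (x - y) f := by gcongr
  have a2 : γ ^ 2 * ‖f‖ ^ 2 ≤ γ / η * ‖x - y‖ ^ 2 := by
    rw [← hg]
    calc _ ≤ γ ^ 2 * ((L + 1 / η) * ‖x - y‖) ^ 2 := by gcongr
      _ = _ := by ring
  have a3 : γ * (1 / η * ‖x - y‖ ^ 2) = γ / η * ‖x - y‖ ^ 2 := by ring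
  nlinarith

lemma norm_proxStep_sub_le (hV : RegularOperator L G V) (h : StepSizes d L σ η γ δ)
    (z x y : Vec d) :
    ‖proxStep V η γ z x - proxStep V η γ z y‖ ≤ √(contractionFactor η γ) * ‖x - y‖ := by
  have := norm_proxStep_sub_sq_le hV h z x y
  rw [← Real.sqrt_sq (norm_nonneg (x - y)), ← Real.sqrt_mul h.factor_nonneg]
  exact Real.le_sqrt_of_sq_le this

/-- A fixed point of `proxStep` solves the resolvent equation, and the Banach fixed point theorem
supplies one. No theory of maximal monotone operators is needed. -/
lemma exists_resolvent (hV : RegularOperator L G V) (h : StepSizes d L σ η γ δ) (z : Vec d) :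
    ∃ x, x + η • V x = z := by
  have hq := h.factor_le
  have hlip : ContractingWith (√(contractionFactor η γ)).toNNReal (proxStep V η γ z) := by
    refine ⟨?_, LipschitzWith.of_dist_le_mul fun x y => ?_⟩
    · rw [← NNReal.coe_lt_coe, Real.coe_toNNReal _ (Real.sqrt_nonneg _), NNReal.coe_one,
        Real.sqrt_lt' one_pos]
      linarith
    · rw [dist_eq_norm, dist_eq_norm, Real.coe_toNNReal _ (Real.sqrt_nonneg _)]
      exact norm_proxStep_sub_le hV h z x y
  refine ⟨hlip.fixedPoint, ?_⟩
  have hfix := hlip.fixedPoint_isFixedPt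
  set x := hlip.fixedPoint
  have h1 : γ • (V x + (1 / η) • (x - z)) = 0 := by
    have : x - γ • (V x + (1 / η) • (x - z)) = x := hfix
    simpa using this
  have h2 := (smul_eq_zero.mp h1).resolve_left h.gamma_pos.ne'
  have h3 : η • (V x + (1 / η) • (x - z)) = 0 := by rw [h2, smul_zero]
  rw [smul_add, smul_smul, mul_one_div_cancel h.eta_pos.ne', one_smul] at h3
  rw [← sub_eq_zero, ← h3]; abel

open Classical in
/-- The resolvent `(1 + η V)⁻¹`. -/
noncomputable def resolvent (V : Vec d → Vec d) (η : ℝ) (z : Vec d) : Vec d :=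
  if h : ∃ x, x + η • V x = z then h.choose else 0

lemma resolvent_add (hV : RegularOperator L G V) (h : StepSizes d L σ η γ δ) (z : Vec d) :
    resolvent V η z + η • V (resolvent V η z) = z := by
  have := exists_resolvent hV h z
  rw [resolvent, dif_pos this]
  exact this.choose_spec

lemma proxStep_resolvent (hV : RegularOperator L G V) (h : StepSizes d L σ η γ δ) (z : Vec d) :
    proxStep V η γ z (resolvent V η z) = resolvent V η z := by
  have h1 := resolvent_add hV h z
  set x := resolvent V η z
  have h2 := h.eta_pos.ne'
  have : x - z = -(η • V x) := by rw [← h1]; abel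
  rw [proxStep, this, smul_neg, smul_smul, one_div_mul_cancel h2, one_smul]
  simp

lemma norm_sub_resolvent_le (hV : RegularOperator L G V) (h : StepSizes d L σ η γ δ)
    (z : Vec d) : ‖z - resolvent V η z‖ ≤ η * G := by
  have h1 := resolvent_add hV h z
  have : z - resolvent V η z = η • V (resolvent V η z) := by
    nth_rewrite 1 [← h1]; abel
  rw [this, norm_smul, Real.norm_of_nonneg h.eta_pos.le]
  exact mul_le_mul_of_nonneg_left (hV.bound _) h.eta_pos.le

/-- The pairing of the difference of Yosida approximations with the difference of the base
points. -/
noncomputable def yosidaPairing (V : Vec d → Vec d) (η : ℝ) (z z' : Vec d) : ℝ :=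
  inner ℝ (V (resolvent V η z) - V (resolvent V η z')) (z - z')

/-- Cocoercivity of the Yosida approximation: in `z - z' = (x - y) + η (V x - V y)` the first
summand pairs nonnegatively with `V x - V y` by monotonicity. -/
lemma yosidaPairing_ge (hV : RegularOperator L G V) (h : StepSizes d L σ η γ δ) (z z' : Vec d) :
    η * ‖V (resolvent V η z) - V (resolvent V η z')‖ ^ 2 ≤ yosidaPairing V η z z' := by
  have h1 := resolvent_add hV h z
  have h2 := resolvent_add hV h z'
  have hm := hV.mono (resolvent V η z) (resolvent V η z')
  rw [yosidaPairing]
  set x := resolvent V η z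
  set y := resolvent V η z'
  have : z - z' = (x - y) + η • (V x - V y) := by rw [← h1, ← h2]; module
  rw [this, inner_add_right, inner_smul_right, real_inner_self_eq_norm_sq]
  linarith

lemma yosidaPairing_nonneg (hV : RegularOperator L G V) (h : StepSizes d L σ η γ δ)
    (z z' : Vec d) : 0 ≤ yosidaPairing V η z z' :=
  (mul_nonneg h.eta_pos.le (sq_nonneg _)).trans (yosidaPairing_ge hV h z z')

/-- Expanding the square gives `-2η` times the pairing plus `η² ‖V x - V y‖²`, and cocoercivity pays
for the square with half of the pairing. The other half is kept: it is the decrease from which the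
pairings are later summed. -/
lemma norm_resolvent_sub_sq_le (hV : RegularOperator L G V) (h : StepSizes d L σ η γ δ)
    (z z' : Vec d) :
    ‖resolvent V η z - resolvent V η z'‖ ^ 2 ≤ ‖z - z'‖ ^ 2 - η * yosidaPairing V η z z' := by
  have h1 := resolvent_add hV h z
  have h2 := resolvent_add hV h z'
  have hg := yosidaPairing_ge hV h z z'
  rw [yosidaPairing] at *
  set x := resolvent V η z
  set y := resolvent V η z'
  have : x - y = (z - z') - η • (V x - V y) := by rw [← h1, ← h2]; module
  rw [this, norm_sub_sq_real, inner_smul_right, norm_smul, mul_pow, Real.norm_eq_abs, sq_abs,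
    real_inner_comm]
  have := mul_le_mul_of_nonneg_left hg h.eta_pos.le
  nlinarith

lemma norm_resolvent_sub_le (hV : RegularOperator L G V) (h : StepSizes d L σ η γ δ)
    (z z' : Vec d) : ‖resolvent V η z - resolvent V η z'‖ ≤ ‖z - z'‖ := by
  apply le_of_sq_le_sq _ (norm_nonneg _)
  linarith [norm_resolvent_sub_sq_le hV h z z',
    mul_nonneg h.eta_pos.le (yosidaPairing_nonneg hV h z z')]

lemma yosidaPairing_le (hV : RegularOperator L G V) (h : StepSizes d L σ η γ δ) (z z' : Vec d) :
    yosidaPairing V η z z' ≤ L * ‖z - z'‖ ^ 2 := by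
  calc yosidaPairing V η z z'
      ≤ ‖V (resolvent V η z) - V (resolvent V η z')‖ * ‖z - z'‖ := real_inner_le_norm _ _
    _ ≤ (L * ‖z - z'‖) * ‖z - z'‖ := by
      gcongr
      exact (hV.smooth _ _).trans
        (mul_le_mul_of_nonneg_left (norm_resolvent_sub_le hV h z z') h.L_pos.le)
    _ = _ := by ring

lemma measurable_resolvent (hV : RegularOperator L G V) (h : StepSizes d L σ η γ δ) :
    Measurable (resolvent V η) := by
  have : LipschitzWith 1 (resolvent V η) := by
    apply LipschitzWith.of_dist_le_mul
    intro x y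
    rw [dist_eq_norm, dist_eq_norm, NNReal.coe_one, one_mul]
    exact norm_resolvent_sub_le hV h x y
  exact this.continuous.measurable

end Operator

/-! ### Second moments -/

section SecondMoments

variable {Ω E : Type*} [MeasurableSpace Ω] {P : Measure Ω} [NormedAddCommGroup E]

/-- The root mean square norm of a random vector. -/
noncomputable def rms (P : Measure Ω) (f : Ω → E) : ℝ := √(∫ ω, ‖f ω‖ ^ 2 ∂P)

lemma rms_nonneg (f : Ω → E) : 0 ≤ rms P f := Real.sqrt_nonneg _

lemma rms_sq (f : Ω → E) : rms P f ^ 2 = ∫ ω, ‖f ω‖ ^ 2 ∂P :=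
  Real.sq_sqrt (integral_nonneg fun _ => sq_nonneg _)

lemma rms_le_of_sq_le {f : Ω → E} {c : ℝ} (hc : 0 ≤ c) (h : ∫ ω, ‖f ω‖ ^ 2 ∂P ≤ c ^ 2) :
    rms P f ≤ c := Real.sqrt_le_iff.mpr ⟨hc, h⟩

lemma memLp_integrable_norm_sq {f : Ω → E} (hf : MemLp f 2 P) :
    Integrable (fun ω => ‖f ω‖ ^ 2) P := hf.norm.integrable_sq

lemma memLp_integrable_norm_mul {F : Type*} [NormedAddCommGroup F] {f : Ω → E} {g : Ω → F}
    (hf : MemLp f 2 P) (hg : MemLp g 2 P) : Integrable (fun ω => ‖f ω‖ * ‖g ω‖) P :=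
  hf.norm.integrable_mul hg.norm

lemma integral_norm_mul_norm_le {F : Type*} [NormedAddCommGroup F] {f : Ω → E} {g : Ω → F}
    (hf : MemLp f 2 P) (hg : MemLp g 2 P) :
    ∫ ω, ‖f ω‖ * ‖g ω‖ ∂P ≤ rms P f * rms P g := by
  have := integral_mul_le_Lp_mul_Lq_of_nonneg (μ := P) (p := 2) (q := 2)
    Real.HolderConjugate.two_two (f := fun ω => ‖f ω‖) (g := fun ω => ‖g ω‖)
    (Filter.Eventually.of_forall fun _ => norm_nonneg _)
    (Filter.Eventually.of_forall fun _ => norm_nonneg _)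
    (by simpa using hf.norm) (by simpa using hg.norm)
  simpa [rms, Real.sqrt_eq_rpow] using this

lemma integral_norm_le_rms [IsProbabilityMeasure P] {f : Ω → E} (hf : MemLp f 2 P) :
    ∫ ω, ‖f ω‖ ∂P ≤ rms P f := by
  have h := integral_norm_mul_norm_le hf (memLp_const (1 : ℝ) (p := 2) (μ := P))
  simpa [rms] using h

lemma memLp_integrable_inner [InnerProductSpace ℝ E] {f g : Ω → E}
    (hf : MemLp f 2 P) (hg : MemLp g 2 P) : Integrable (fun ω => inner ℝ (f ω) (g ω)) P := by
  refine (memLp_integrable_norm_mul hf hg).mono'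
    (hf.aestronglyMeasurable.inner hg.aestronglyMeasurable) ?_
  exact Filter.Eventually.of_forall fun ω => norm_inner_le_norm _ _

lemma integral_add_add {f g h : Ω → ℝ} (hf : Integrable f P) (hg : Integrable g P)
    (hh : Integrable h P) :
    ∫ ω, (f ω + g ω + h ω) ∂P = ∫ ω, f ω ∂P + ∫ ω, g ω ∂P + ∫ ω, h ω ∂P := by
  have : Integrable (fun ω => f ω + g ω) P := hf.add hg
  rw [integral_add this hh, integral_add hf hg]

lemma integral_norm_add_sq [InnerProductSpace ℝ E] {f g : Ω → E}
    (hf : MemLp f 2 P) (hg : MemLp g 2 P) :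
    ∫ ω, ‖f ω + g ω‖ ^ 2 ∂P =
      ∫ ω, ‖f ω‖ ^ 2 ∂P + 2 * ∫ ω, inner ℝ (f ω) (g ω) ∂P + ∫ ω, ‖g ω‖ ^ 2 ∂P := by
  simp_rw [norm_add_sq_real]
  rw [integral_add_add (memLp_integrable_norm_sq hf) ((memLp_integrable_inner hf hg).const_mul 2)
    (memLp_integrable_norm_sq hg), integral_const_mul]

/-- Minkowski's inequality in squared form; the cross term is bounded by Cauchy–Schwarz. -/
lemma integral_add_mul_norm_sq_le {F : Type*} [NormedAddCommGroup F] {f : Ω → E} {g : Ω → F}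
    (hf : MemLp f 2 P) (hg : MemLp g 2 P) {a b : ℝ} (ha : 0 ≤ a) (hb : 0 ≤ b) :
    ∫ ω, (a * ‖f ω‖ + b * ‖g ω‖) ^ 2 ∂P ≤ (a * rms P f + b * rms P g) ^ 2 := by
  have e : ∀ ω, (a * ‖f ω‖ + b * ‖g ω‖) ^ 2 =
      a ^ 2 * ‖f ω‖ ^ 2 + 2 * a * b * (‖f ω‖ * ‖g ω‖) + b ^ 2 * ‖g ω‖ ^ 2 := fun ω => by ring
  simp_rw [e]
  have i1 := (memLp_integrable_norm_sq hf).const_mul (a ^ 2)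
  have i2 := (memLp_integrable_norm_mul hf hg).const_mul (2 * a * b)
  have i3 := (memLp_integrable_norm_sq hg).const_mul (b ^ 2)
  rw [integral_add_add i1 i2 i3, integral_const_mul, integral_const_mul,
    integral_const_mul, ← rms_sq, ← rms_sq]
  have := mul_le_mul_of_nonneg_left (integral_norm_mul_norm_le hf hg)
    (by positivity : 0 ≤ 2 * a * b)
  nlinarith

lemma memLp_two_of_lintegral_sq_le {f : Ω → E} (hf : AEStronglyMeasurable f P) {c : ℝ}
    (h : ∫⁻ ω, ENNReal.ofReal (‖f ω‖ ^ 2) ∂P ≤ ENNReal.ofReal c) (hc : 0 ≤ c) :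
    MemLp f 2 P ∧ ∫ ω, ‖f ω‖ ^ 2 ∂P ≤ c := by
  have hm : AEStronglyMeasurable (fun ω => ‖f ω‖ ^ 2) P := hf.norm.pow 2
  have hi : Integrable (fun ω => ‖f ω‖ ^ 2) P := by
    refine ⟨hm, ?_⟩
    rw [hasFiniteIntegral_iff_ofReal (Filter.Eventually.of_forall fun _ => sq_nonneg _)]
    exact h.trans_lt ENNReal.ofReal_lt_top
  refine ⟨(memLp_two_iff_integrable_sq_norm hf).mpr hi, ?_⟩
  rw [integral_eq_lintegral_of_nonneg_ae (Filter.Eventually.of_forall fun _ => sq_nonneg _) hm]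
  exact ENNReal.toReal_le_of_le_ofReal hc h

lemma lintegral_sq_le_of_integral {f : Ω → E} (hf : MemLp f 2 P) {c : ℝ}
    (h : ∫ ω, ‖f ω‖ ^ 2 ∂P ≤ c) :
    ∫⁻ ω, ENNReal.ofReal (‖f ω‖ ^ 2) ∂P ≤ ENNReal.ofReal c := by
  rw [← ofReal_integral_eq_lintegral_ofReal (memLp_integrable_norm_sq hf)
    (Filter.Eventually.of_forall fun _ => sq_nonneg _)]
  exact ENNReal.ofReal_le_ofReal h

lemma memLp_of_norm_le [IsFiniteMeasure P] {f : Ω → E} (hf : AEStronglyMeasurable f P) {c : ℝ}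
    (h : ∀ ω, ‖f ω‖ ≤ c) : MemLp f 2 P :=
  MemLp.of_bound hf c (Filter.Eventually.of_forall h)

end SecondMoments

/-! ### Decoupling of independent random elements -/

section Decoupling

variable {Ω α β : Type*} [MeasurableSpace Ω] [MeasurableSpace α] [MeasurableSpace β]
  {P : Measure Ω} [IsProbabilityMeasure P] {X : Ω → α} {Y : Ω → β}

lemma lintegral_decouple (hX : Measurable X) (hY : Measurable Y) (hXY : IndepFun X Y P)
    {f : α × β → ENNReal} (hf : Measurable f) :
    ∫⁻ ω, f (X ω, Y ω) ∂P = ∫⁻ ω, ∫⁻ ω', f (X ω, Y ω') ∂P ∂P := by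
  have hmap := (indepFun_iff_map_prod_eq_prod_map_map hX.aemeasurable hY.aemeasurable).mp hXY
  have : IsProbabilityMeasure (P.map Y) := Measure.isProbabilityMeasure_map hY.aemeasurable
  rw [← lintegral_map hf (hX.prodMk hY), hmap, lintegral_prod _ hf.aemeasurable,
    lintegral_map hf.lintegral_prod_right' hX]
  congr 1; ext ω
  rw [lintegral_map (by fun_prop) hY]

variable {d : ℕ}

/-- A bound valid for every frozen value of `X` survives substitution of an independent random `X`.
Tonelli for lower integrals is used because integrability of the composite is part of the claim. -/
lemma secondMoment_decouple (hX : Measurable X) (hY : Measurable Y) (hXY : IndepFun X Y P)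
    {h : α × β → Vec d} (hh : Measurable h) {c : ℝ} (hc : 0 ≤ c)
    (hm : ∀ x, MemLp (fun ω => h (x, Y ω)) 2 P)
    (hb : ∀ x, ∫ ω, ‖h (x, Y ω)‖ ^ 2 ∂P ≤ c) :
    MemLp (fun ω => h (X ω, Y ω)) 2 P ∧ ∫ ω, ‖h (X ω, Y ω)‖ ^ 2 ∂P ≤ c := by
  have hm' : Measurable fun ω => h (X ω, Y ω) := hh.comp (hX.prodMk hY)
  refine memLp_two_of_lintegral_sq_le hm'.aestronglyMeasurable ?_ hc
  rw [lintegral_decouple hX hY hXY (f := fun p => ENNReal.ofReal (‖h p‖ ^ 2)) (by fun_prop)]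
  calc _ ≤ ∫⁻ _, ENNReal.ofReal c ∂P :=
        lintegral_mono fun ω => lintegral_sq_le_of_integral (hm _) (hb _)
    _ = _ := by simp

/-- Replaces conditional expectations: by Fubini one integrates over `Y` first, and since `φ`
depends on `X` only, this integral moves inside the inner product. Only the mean of `h (x, Y)` is
paid for, not its size. -/
lemma abs_integral_inner_decouple_le (hX : Measurable X) (hY : Measurable Y)
    (hXY : IndepFun X Y P) {φ : α → Vec d} (hφ : Measurable φ) {h : α × β → Vec d}
    (hh : Measurable h) (hφm : MemLp (fun ω => φ (X ω)) 2 P)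
    (hhm : MemLp (fun ω => h (X ω, Y ω)) 2 P)
    (hi : ∀ x, Integrable (fun ω => h (x, Y ω)) P) {b : ℝ}
    (hb : ∀ x, ‖∫ ω, h (x, Y ω) ∂P‖ ≤ b) :
    |∫ ω, inner ℝ (φ (X ω)) (h (X ω, Y ω)) ∂P| ≤ b * ∫ ω, ‖φ (X ω)‖ ∂P := by
  have hmap := (indepFun_iff_map_prod_eq_prod_map_map hX.aemeasurable hY.aemeasurable).mp hXY
  have : IsProbabilityMeasure (P.map Y) := Measure.isProbabilityMeasure_map hY.aemeasurable
  have : IsProbabilityMeasure (P.map X) := Measure.isProbabilityMeasure_map hX.aemeasurable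
  let F : α × β → ℝ := fun p => inner ℝ (φ p.1) (h p)
  have hF : Measurable F := (hφ.comp measurable_fst).inner hh
  have hint : Integrable (fun ω => F (X ω, Y ω)) P := memLp_integrable_inner hφm hhm
  have hint' : Integrable F ((P.map X).prod (P.map Y)) := by
    rw [← hmap, integrable_map_measure hF.aestronglyMeasurable (hX.prodMk hY).aemeasurable]
    exact hint
  have e : ∫ ω, F (X ω, Y ω) ∂P = ∫ ω, ∫ ω', F (X ω, Y ω') ∂P ∂P := by
    rw [← integral_map (f := F) (hX.prodMk hY).aemeasurable hF.aestronglyMeasurable, hmap,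
      integral_prod _ hint', integral_map hX.aemeasurable
        hint'.integral_prod_left.aestronglyMeasurable]
    congr 1; ext ω
    exact integral_map hY.aemeasurable (hF.comp measurable_prodMk_left).aestronglyMeasurable
  have e2 : ∀ x, ∫ ω', F (x, Y ω') ∂P = inner ℝ (φ x) (∫ ω', h (x, Y ω') ∂P) := fun x => by
    simpa [F] using integral_inner (hi x) (φ x)
  change |∫ ω, F (X ω, Y ω) ∂P| ≤ _
  rw [e, ← Real.norm_eq_abs, ← integral_const_mul]
  apply norm_integral_le_of_norm_le ((hφm.integrable one_le_two).norm.const_mul b)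
  refine Filter.Eventually.of_forall fun ω => ?_
  rw [e2]
  calc _ ≤ ‖φ (X ω)‖ * ‖∫ ω', h (X ω, Y ω') ∂P‖ := norm_inner_le_norm _ _
    _ ≤ ‖φ (X ω)‖ * b := by gcongr; exact hb _
    _ = _ := mul_comm _ _

end Decoupling

/-! ### Oracle noise -/

section Oracle

variable {Ω Ξ : Type*} [MeasurableSpace Ω] [MeasurableSpace Ξ] {P : Measure Ω}
  [IsProbabilityMeasure P] {ν : Measure Ξ} {d : ℕ} {Vt : Vec d → Ξ → Vec d} {V : Vec d → Vec d}
  {σ : ℝ} {X : Ω → Vec d} {Y : Ω → Ξ}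

lemma UnbiasedOracle.memLp_noise (ho : UnbiasedOracle ν Vt V σ) (hV : Measurable V)
    (hX : Measurable X) (hY : Measurable Y) (hlaw : P.map Y = ν) (hXY : IndepFun X Y P) :
    MemLp (fun ω => Vt (X ω) (Y ω) - V (X ω)) 2 P ∧
      ∫ ω, ‖Vt (X ω) (Y ω) - V (X ω)‖ ^ 2 ∂P ≤ σ ^ 2 := by
  have hmeas : Measurable fun p : Vec d × Ξ => Vt p.1 p.2 - V p.1 :=
    ho.measurable.sub (hV.comp measurable_fst)
  refine secondMoment_decouple hX hY hXY (h := fun p => Vt p.1 p.2 - V p.1)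
    hmeas (sq_nonneg σ) (fun x => ?_) (fun x => ?_)
  · have hx : Measurable fun ξ => Vt x ξ - V x := hmeas.comp measurable_prodMk_left
    have hxY : Measurable fun ω => Vt x (Y ω) - V x := hx.comp hY
    rw [memLp_two_iff_integrable_sq_norm (f := fun ω => Vt x (Y ω) - V x)
      hxY.aestronglyMeasurable]
    have := ho.integrable_sq x
    rw [← hlaw] at this
    rw [integrable_map_measure this.aestronglyMeasurable hY.aemeasurable] at this
    simpa [Function.comp_def, norm_sub_rev] using this
  · have h1 := ho.variance_le x
    have := (ho.integrable_sq x).aestronglyMeasurable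
    rw [← hlaw] at h1 this
    rw [integral_map hY.aemeasurable this] at h1
    simpa [norm_sub_rev] using h1

lemma UnbiasedOracle.integral_inner_noise (ho : UnbiasedOracle ν Vt V σ) (hV : Measurable V)
    {φ : Ω → Vec d} (hφ : Measurable φ) (hφm : MemLp φ 2 P)
    (hX : Measurable X) (hY : Measurable Y) (hlaw : P.map Y = ν)
    (hXY : IndepFun (fun ω => (φ ω, X ω)) Y P) :
    ∫ ω, inner ℝ (φ ω) (Vt (X ω) (Y ω) - V (X ω)) ∂P = 0 := by
  have hmeas : Measurable fun p : (Vec d × Vec d) × Ξ => Vt p.1.2 p.2 - V p.1.2 :=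
    (ho.measurable.comp (by fun_prop : Measurable fun p : (Vec d × Vec d) × Ξ => (p.1.2, p.2))).sub
      (hV.comp (by fun_prop))
  have hI : ∀ x, Integrable (fun ω => Vt x (Y ω)) P := fun x => by
    have := ho.integrable x
    rw [← hlaw] at this
    exact (integrable_map_measure this.aestronglyMeasurable hY.aemeasurable).mp this
  have h0 := abs_integral_inner_decouple_le (hφ.prodMk hX) hY hXY (φ := Prod.fst) measurable_fst
    hmeas hφm
    (ho.memLp_noise hV hX hY hlaw (hXY.comp measurable_snd measurable_id)).1
    (fun x => (hI x.2).sub (integrable_const (V x.2))) (b := 0) (fun x => by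
      have h1 := ho.unbiased x.2
      have h2 := (ho.integrable x.2).aestronglyMeasurable
      rw [← hlaw] at h1 h2
      rw [integral_map hY.aemeasurable h2] at h1
      change ‖∫ ω, (Vt x.2 (Y ω) - V x.2) ∂P‖ ≤ 0
      rw [integral_sub (hI _) (integrable_const _), h1]
      simp)
  simpa using h0

lemma UnbiasedOracle.integral_noise (ho : UnbiasedOracle ν Vt V σ) (hV : Measurable V)
    (hX : Measurable X) (hY : Measurable Y) (hlaw : P.map Y = ν) (hXY : IndepFun X Y P) :
    ∫ ω, (Vt (X ω) (Y ω) - V (X ω)) ∂P = 0 := by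
  refine integral_eq_zero_of_forall_integral_inner_eq_zero ℝ _
    ((ho.memLp_noise hV hX hY hlaw hXY).1.integrable one_le_two) fun c => ?_
  exact ho.integral_inner_noise hV (φ := fun _ => c) measurable_const (memLp_const c) hX hY hlaw
    (hXY.comp (φ := fun x => (c, x)) measurable_prodMk_left measurable_id)

end Oracle

/-! ### The standard Gaussian vector -/

lemma memLp_stdGaussian {d : ℕ} : MemLp (fun x : Vec d => x) 2 (stdGaussian (Vec d)) :=
  IsGaussian.memLp_two_id

/-- Each coordinate is a functional of norm one, hence centred with variance one. -/
lemma integral_norm_sq_stdGaussian (d : ℕ) :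
    ∫ x : Vec d, ‖x‖ ^ 2 ∂(stdGaussian (Vec d)) = d := by
  simp_rw [EuclideanSpace.real_norm_sq_eq]
  rw [integral_finsetSum]
  · have : ∀ i : Fin d, ∫ x : Vec d, x i ^ 2 ∂(stdGaussian (Vec d)) = 1 := fun i => by
      have h1 := variance_dual_stdGaussian (E := Vec d) (EuclideanSpace.proj i)
      have h0 := integral_strongDual_stdGaussian (E := Vec d) (EuclideanSpace.proj i)
      rw [variance_of_integral_eq_zero (by fun_prop) h0] at h1
      have h2 : ‖(EuclideanSpace.proj i : Vec d →L[ℝ] ℝ)‖ = 1 := by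
        apply le_antisymm
        · refine ContinuousLinearMap.opNorm_le_bound _ zero_le_one fun x => ?_
          simpa using PiLp.norm_apply_le x i
        · have := (EuclideanSpace.proj i : Vec d →L[ℝ] ℝ).le_opNorm (EuclideanSpace.single i 1)
          simpa using this
      rw [h2] at h1
      simpa using h1
    simp [this]
  · intro i _
    have := memLp_stdGaussian (d := d)
    exact ((EuclideanSpace.proj i : Vec d →L[ℝ] ℝ).comp_memLp' this).integrable_sq

/-! ### Independence of the samples -/

/-- Merges the Gaussian and oracle families into one independent family indexed by a sum type.
Independence of σ-algebras generated by disjoint sets of samples then follows from a single general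
lemma. -/
lemma iIndep_sumElim {ι κ Ω : Type*} [MeasurableSpace Ω] {P : Measure Ω}
    {m : ι → MeasurableSpace Ω} {n : κ → MeasurableSpace Ω} (hm : iIndep m P) (hn : iIndep n P)
    (hmn : Indep (⨆ i, m i) (⨆ j, n j) P) : iIndep (Sum.elim m n) P := by
  rw [iIndep_iff] at *
  intro S f hf
  have hL : ∀ i ∈ S.toLeft, MeasurableSet[m i] (f (Sum.inl i)) := fun i hi =>
    hf (Sum.inl i) (Finset.mem_toLeft.mp hi)
  have hR : ∀ j ∈ S.toRight, MeasurableSet[n j] (f (Sum.inr j)) := fun j hj =>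
    hf (Sum.inr j) (Finset.mem_toRight.mp hj)
  have e : ⋂ i ∈ S, f i =
      (⋂ i ∈ S.toLeft, f (Sum.inl i)) ∩ ⋂ j ∈ S.toRight, f (Sum.inr j) := by
    ext ω
    simp [Sum.forall]
  rw [Finset.prod_sum_eq_prod_toLeft_mul_prod_toRight, e, ← hm S.toLeft hL, ← hn S.toRight hR]
  refine (Indep_iff _ _ _).mp hmn _ _ ?_ ?_
  · exact Finset.measurableSet_biInter _ fun i hi => le_iSup m i _ (hL i hi)
  · exact Finset.measurableSet_biInter _ fun j hj => le_iSup n j _ (hR j hj)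

lemma indepFun_of_measurable {Ω α β : Type*} {m n mΩ : MeasurableSpace Ω}
    [MeasurableSpace α] [MeasurableSpace β] {P : Measure Ω} (h : Indep m n P) {X : Ω → α}
    {Y : Ω → β} (hX : Measurable[m] X) (hY : Measurable[n] Y) : IndepFun X Y P := by
  rw [IndepFun_iff_Indep]
  exact indep_of_indep_of_le_left (indep_of_indep_of_le_right h hY.comap_le) hX.comap_le

section Samples

variable {d M : ℕ} {Ξ Ω : Type*} [MeasurableSpace Ξ] {s : ℕ → Fin M → ℕ → Ω → Vec d} {ξ : ℕ → Fin M → ℕ → Ω → Ξ}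

/-- The σ-algebra generated by a single sample; the left summand indexes the Gaussian vectors,
the right summand the oracle samples. -/
@[reducible] def sampleAlgebra (s : ℕ → Fin M → ℕ → Ω → Vec d) (ξ : ℕ → Fin M → ℕ → Ω → Ξ) :
    (ℕ × Fin M × ℕ) ⊕ (ℕ × Fin M × ℕ) → MeasurableSpace Ω :=
  Sum.elim (fun i => MeasurableSpace.comap (s i.1 i.2.1 i.2.2) inferInstance)
    (fun i => MeasurableSpace.comap (ξ i.1 i.2.1 i.2.2) inferInstance)

/-- The σ-algebra generated by a set of samples. -/
@[reducible] def history (s : ℕ → Fin M → ℕ → Ω → Vec d) (ξ : ℕ → Fin M → ℕ → Ω → Ξ)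
    (A : Set ((ℕ × Fin M × ℕ) ⊕ (ℕ × Fin M × ℕ))) : MeasurableSpace Ω :=
  ⨆ i ∈ A, sampleAlgebra s ξ i

lemma measurable_gauss_history {A : Set ((ℕ × Fin M × ℕ) ⊕ (ℕ × Fin M × ℕ))} {t : ℕ} {m : Fin M}
    {ℓ : ℕ} (hi : Sum.inl (t, m, ℓ) ∈ A) : Measurable[history s ξ A] (s t m ℓ) := by
  have h1 : Measurable[sampleAlgebra s ξ (Sum.inl (t, m, ℓ))] (s t m ℓ) := comap_measurable _
  exact h1.mono (le_iSup₂_of_le (f := fun i (_ : i ∈ A) => sampleAlgebra s ξ i) _ hi le_rfl) le_rfl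

lemma measurable_sample_history {A : Set ((ℕ × Fin M × ℕ) ⊕ (ℕ × Fin M × ℕ))} {t : ℕ} {m : Fin M}
    {ℓ : ℕ} (hi : Sum.inr (t, m, ℓ) ∈ A) : Measurable[history s ξ A] (ξ t m ℓ) := by
  have h1 : Measurable[sampleAlgebra s ξ (Sum.inr (t, m, ℓ))] (ξ t m ℓ) := comap_measurable _
  exact h1.mono (le_iSup₂_of_le (f := fun i (_ : i ∈ A) => sampleAlgebra s ξ i) _ hi le_rfl) le_rfl

variable [mΩ : MeasurableSpace Ω] {P : Measure Ω} {ν : Measure Ξ}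

lemma IndependentSamples.sampleAlgebra_le (h : IndependentSamples P ν s ξ)
    (i : (ℕ × Fin M × ℕ) ⊕ (ℕ × Fin M × ℕ)) : sampleAlgebra s ξ i ≤ mΩ := by
  rcases i with i | i
  · exact (h.measurable_gauss _ _ _).comap_le
  · exact (h.measurable_sample _ _ _).comap_le

lemma IndependentSamples.history_le (h : IndependentSamples P ν s ξ)
    (A : Set ((ℕ × Fin M × ℕ) ⊕ (ℕ × Fin M × ℕ))) : history s ξ A ≤ mΩ :=
  iSup₂_le fun i _ => h.sampleAlgebra_le i

lemma IndependentSamples.indep_history (h : IndependentSamples P ν s ξ)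
    {A B : Set ((ℕ × Fin M × ℕ) ⊕ (ℕ × Fin M × ℕ))} (hAB : Disjoint A B) :
    Indep (history s ξ A) (history s ξ B) P := by
  refine indep_iSup_of_disjoint h.sampleAlgebra_le ?_ hAB
  refine iIndep_sumElim ((iIndepFun_iff_iIndep _ _ _).mp h.indep_gauss)
    ((iIndepFun_iff_iIndep _ _ _).mp h.indep_sample) ?_
  have := (IndepFun_iff_Indep _ _ _).mp h.indep_gauss_sample
  refine indep_of_indep_of_le_left (indep_of_indep_of_le_right this ?_) ?_
  · refine iSup_le fun i => Measurable.comap_le ?_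
    exact (measurable_pi_apply i).comp
      (comap_measurable fun ω (i : ℕ × Fin M × ℕ) => ξ i.1 i.2.1 i.2.2 ω)
  · refine iSup_le fun i => Measurable.comap_le ?_
    exact (measurable_pi_apply i).comp
      (comap_measurable fun ω (i : ℕ × Fin M × ℕ) => s i.1 i.2.1 i.2.2 ω)

end Samples

/-! ### Measurability of the iterates -/

section Measurability

variable {d M : ℕ} {Ξ Ω : Type*} [MeasurableSpace Ξ] [MeasurableSpace Ω]
  {Vt : Vec d → Ξ → Vec d} {η γ δ : ℝ}

lemma measurable_oracle_comp (hVt : Measurable fun p : Vec d × Ξ => Vt p.1 p.2) {x : Ω → Vec d}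
    {y : Ω → Ξ} (hx : Measurable x) (hy : Measurable y) : Measurable fun ω => Vt (x ω) (y ω) :=
  hVt.comp (hx.prodMk hy)

lemma measurable_innerIter (hVt : Measurable fun p : Vec d × Ξ => Vt p.1 p.2) {z : Ω → Vec d}
    (hz : Measurable z) {s : ℕ → Ω → Vec d} {ξ : ℕ → Ω → Ξ} {ℓ : ℕ}
    (hs : ∀ k ≤ ℓ, Measurable (s k)) (hξ : ∀ k ≤ ℓ, Measurable (ξ k)) :
    Measurable fun ω => innerIter Vt η γ δ (z ω) (fun k => s k ω) (fun k => ξ k ω) ℓ := by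
  induction ℓ with
  | zero => exact hz
  | succ ℓ ih =>
    have ih := ih (fun k hk => hs k (by omega)) (fun k hk => hξ k (by omega))
    simp only [innerIter]
    have h1 := measurable_oracle_comp hVt (ih.add ((hs (ℓ + 1) le_rfl).const_smul δ))
      (hξ (ℓ + 1) le_rfl)
    exact ih.sub ((h1.add ((ih.sub hz).const_smul (1 / η))).const_smul γ)

lemma measurable_outerIter (hVt : Measurable fun p : Vec d × Ξ => Vt p.1 p.2) (K H : ℕ)
    {s : ℕ → Fin M → ℕ → Ω → Vec d} {ξ : ℕ → Fin M → ℕ → Ω → Ξ} {t : ℕ}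
    (hs : ∀ t' ≤ t, ∀ m ℓ, Measurable (s t' m ℓ)) (hξ : ∀ t' ≤ t, ∀ m ℓ, Measurable (ξ t' m ℓ))
    (m : Fin M) :
    Measurable fun ω => outerIter Vt η γ δ K H (fun t m ℓ => s t m ℓ ω)
      (fun t m ℓ => ξ t m ℓ ω) t m := by
  induction t generalizing m with
  | zero => exact measurable_const
  | succ t ih =>
    have ih := ih (fun k hk => hs k (by omega)) (fun k hk => hξ k (by omega))
    have hx : ∀ m, Measurable fun ω => innerIter Vt η γ δ
        (outerIter Vt η γ δ K H (fun t m ℓ => s t m ℓ ω) (fun t m ℓ => ξ t m ℓ ω) t m)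
        (fun ℓ => s (t + 1) m ℓ ω) (fun ℓ => ξ (t + 1) m ℓ ω) H := fun m =>
      measurable_innerIter hVt (ih m) (fun k _ => hs _ le_rfl m k) (fun k _ => hξ _ le_rfl m k)
    have hw := fun m => (ih m).sub
      ((measurable_oracle_comp hVt (hx m) (hξ _ le_rfl m (H + 1))).const_smul η)
    simp only [outerIter]
    split_ifs with hK
    · exact (Finset.measurable_fun_sum _ fun m _ => hw m).const_smul (1 / (M : ℝ))
    · exact hw m

end Measurability

/-! ### The inner loop from a fixed starting point -/

/-- The per-step decay rate `√(3/4)` of the root mean square error. -/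
noncomputable def decayRate : ℝ := √(3 / 4)

lemma decayRate_nonneg : 0 ≤ decayRate := Real.sqrt_nonneg _

lemma decayRate_sq : decayRate ^ 2 = 3 / 4 := Real.sq_sqrt (by norm_num)

lemma decayRate_ge : 43 / 50 ≤ decayRate := by
  refine Real.le_sqrt_of_sq_le ?_
  norm_num

/-- Bound for the root mean square distance of the inner iterate to the resolvent. -/
noncomputable def innerError (η σ G : ℝ) (ℓ : ℕ) : ℝ := decayRate ^ ℓ * (η * G) + 4 * (η * σ)

/-- Bound for the distance of the mean of the inner iterate to the resolvent. -/
noncomputable def meanError (η L σ G : ℝ) (ℓ : ℕ) : ℝ :=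
  3 * (decayRate ^ ℓ * (η * G)) + 5 * (η ^ 2 * L * σ)

/-- Independent samples for one run of the inner loop: each oracle sample is independent of all
the other samples. -/
structure InnerSamples {d : ℕ} {Ξ Ω : Type*} [MeasurableSpace Ξ] [mΩ : MeasurableSpace Ω]
    (P : Measure Ω) (ν : Measure Ξ) (s : ℕ → Ω → Vec d) (ξ : ℕ → Ω → Ξ) : Prop where
  measurable_gauss : ∀ ℓ, Measurable (s ℓ)
  measurable_sample : ∀ ℓ, Measurable (ξ ℓ)
  law_gauss : ∀ ℓ, P.map (s ℓ) = stdGaussian (Vec d)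
  law_sample : ∀ ℓ, P.map (ξ ℓ) = ν
  leave_one_out : ∀ ℓ, ∃ m : MeasurableSpace Ω, m ≤ mΩ ∧ (∀ k, Measurable[m] (s k)) ∧
    (∀ k, k ≠ ℓ → Measurable[m] (ξ k)) ∧ Indep m (MeasurableSpace.comap (ξ ℓ) inferInstance) P

section InnerLoop

variable {d : ℕ} {Ξ Ω : Type*} [MeasurableSpace Ξ] [mΩ : MeasurableSpace Ω] {P : Measure Ω}
  {ν : Measure Ξ} {s : ℕ → Ω → Vec d} {ξ : ℕ → Ω → Ξ}
  {Vt : Vec d → Ξ → Vec d} {V : Vec d → Vec d} {L σ G η γ δ : ℝ}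

lemma InnerSamples.memLp_gauss (hS : InnerSamples P ν s ξ) (ℓ : ℕ) : MemLp (s ℓ) 2 P := by
  have := memLp_stdGaussian (d := d)
  rw [← hS.law_gauss ℓ, memLp_map_measure_iff (by fun_prop)
    (hS.measurable_gauss ℓ).aemeasurable] at this
  exact this

lemma InnerSamples.rms_gauss (hS : InnerSamples P ν s ξ) (ℓ : ℕ) : rms P (s ℓ) = √(d : ℝ) := by
  rw [rms, ← integral_norm_sq_stdGaussian d, ← hS.law_gauss ℓ,
    integral_map (hS.measurable_gauss ℓ).aemeasurable (by fun_prop)]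

/-- The inner iterates as random vectors. -/
noncomputable def innerPath (Vt : Vec d → Ξ → Vec d) (η γ δ : ℝ) (z : Vec d)
    (s : ℕ → Ω → Vec d) (ξ : ℕ → Ω → Ξ) (ℓ : ℕ) (ω : Ω) : Vec d :=
  innerIter Vt η γ δ z (fun k => s k ω) (fun k => ξ k ω) ℓ

/-- The error of the oracle response in the inner step `ℓ + 1`. -/
noncomputable def innerNoise (Vt : Vec d → Ξ → Vec d) (V : Vec d → Vec d) (η γ δ : ℝ) (z : Vec d)
    (s : ℕ → Ω → Vec d) (ξ : ℕ → Ω → Ξ) (ℓ : ℕ) (ω : Ω) : Vec d :=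
  Vt (innerPath Vt η γ δ z s ξ ℓ ω + δ • s (ℓ + 1) ω) (ξ (ℓ + 1) ω) -
    V (innerPath Vt η γ δ z s ξ ℓ ω + δ • s (ℓ + 1) ω)

lemma measurable_innerPath (ho : UnbiasedOracle ν Vt V σ) (hS : InnerSamples P ν s ξ) (z : Vec d)
    (ℓ : ℕ) : Measurable (innerPath Vt η γ δ z s ξ ℓ) :=
  measurable_innerIter ho.measurable measurable_const (fun k _ => hS.measurable_gauss k)
    (fun k _ => hS.measurable_sample k)

/-- The Gaussian vector of step `ℓ + 1` is included on the left because the oracle is queried at the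
perturbed point, which must itself be independent of the fresh oracle sample. -/
lemma indepFun_innerPath_sample (ho : UnbiasedOracle ν Vt V σ) (hS : InnerSamples P ν s ξ)
    (z : Vec d) (ℓ : ℕ) :
    IndepFun (fun ω => (innerPath Vt η γ δ z s ξ ℓ ω, s (ℓ + 1) ω)) (ξ (ℓ + 1)) P := by
  obtain ⟨m, hm, hs, hξ, hi⟩ := hS.leave_one_out (ℓ + 1)
  refine indepFun_of_measurable hi ?_ (comap_measurable _)
  have hx : Measurable[m] (innerPath Vt η γ δ z s ξ ℓ) :=
    @measurable_innerIter _ _ _ _ m _ _ _ _ ho.measurable _ (@measurable_const _ _ _ m _) _ _ _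
      (fun k _ => hs k) (fun k hk => hξ k (by omega))
  exact hx.prodMk (hs (ℓ + 1))

variable [IsProbabilityMeasure P]

lemma memLp_innerNoise (hV : RegularOperator L G V) (h : StepSizes d L σ η γ δ)
    (ho : UnbiasedOracle ν Vt V σ) (hS : InnerSamples P ν s ξ) (z : Vec d) (ℓ : ℕ) :
    MemLp (innerNoise Vt V η γ δ z s ξ ℓ) 2 P ∧
      ∫ ω, ‖innerNoise Vt V η γ δ z s ξ ℓ ω‖ ^ 2 ∂P ≤ σ ^ 2 ∧
      ∫ ω, innerNoise Vt V η γ δ z s ξ ℓ ω ∂P = 0 := by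
  have hX := measurable_innerPath (η := η) (γ := γ) (δ := δ) ho hS z ℓ
  have hI := indepFun_innerPath_sample (η := η) (γ := γ) (δ := δ) ho hS z ℓ
  have hg : Measurable fun p : Vec d × Vec d => p.1 + δ • p.2 := by fun_prop
  have hI' := hI.comp hg measurable_id
  have hX' := hg.comp (hX.prodMk (hS.measurable_gauss (ℓ + 1)))
  have h1 := ho.memLp_noise (hV.measurable h.L_pos.le) hX' (hS.measurable_sample (ℓ + 1))
    (hS.law_sample _) hI'
  exact ⟨h1.1, h1.2, ho.integral_noise (hV.measurable h.L_pos.le) hX'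
    (hS.measurable_sample (ℓ + 1)) (hS.law_sample _) hI'⟩

lemma integral_inner_innerNoise (hV : RegularOperator L G V) (h : StepSizes d L σ η γ δ)
    (ho : UnbiasedOracle ν Vt V σ) (hS : InnerSamples P ν s ξ) (z : Vec d) (ℓ : ℕ)
    {f : Vec d × Vec d → Vec d} (hf : Measurable f)
    (hfm : MemLp (fun ω => f (innerPath Vt η γ δ z s ξ ℓ ω, s (ℓ + 1) ω)) 2 P) :
    ∫ ω, inner ℝ (f (innerPath Vt η γ δ z s ξ ℓ ω, s (ℓ + 1) ω))
      (innerNoise Vt V η γ δ z s ξ ℓ ω) ∂P = 0 := by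
  have hX := measurable_innerPath (η := η) (γ := γ) (δ := δ) ho hS z ℓ
  have hI := indepFun_innerPath_sample (η := η) (γ := γ) (δ := δ) ho hS z ℓ
  have hg : Measurable fun p : Vec d × Vec d => p.1 + δ • p.2 := by fun_prop
  have hI' := hI.comp (hf.prodMk hg) measurable_id
  have hXs := hX.prodMk (hS.measurable_gauss (ℓ + 1))
  exact ho.integral_inner_noise (hV.measurable h.L_pos.le) (hf.comp hXs) hfm (hg.comp hXs)
    (hS.measurable_sample (ℓ + 1)) (hS.law_sample _) hI'

/-- Closes the induction for the root mean square error: the smoothing and the oracle noise each add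
at most `γ σ`, while the previous error contracts by `√(1 - γ/η)`. -/
lemma innerError_step (h : StepSizes d L σ η γ δ) (hG : 0 ≤ G) (ℓ : ℕ) :
    (√(contractionFactor η γ) * innerError η σ G ℓ + γ * L * δ * √(d : ℝ)) ^ 2 + γ ^ 2 * σ ^ 2 ≤
      innerError η σ G (ℓ + 1) ^ 2 := by
  have hη := h.eta_pos
  have hσ := h.sigma_pos
  have hL := h.L_pos
  have hγ := h.gamma_pos
  have hγe := h.gamma_eq_mul
  have hr := decayRate_nonneg
  set p := √(contractionFactor η γ) with hp
  have hp0 : 0 ≤ p := Real.sqrt_nonneg _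
  have hpr : p ≤ decayRate := Real.sqrt_le_sqrt h.factor_le
  have hp2 : p ^ 2 = contractionFactor η γ := Real.sq_sqrt h.factor_nonneg
  rw [← hp2] at hγe
  have e1 : γ * L * δ * √(d : ℝ) ≤ γ * σ := by
    have := h.delta_mul_sqrt
    calc γ * L * δ * √(d : ℝ) = γ * σ * (η * L) := by rw [mul_assoc (γ * L), this]; ring
      _ ≤ γ * σ * 1 := by gcongr; exact h.eta_mul_le
      _ = _ := by ring
  have e2 : p * innerError η σ G ℓ + γ * L * δ * √(d : ℝ) + γ * σ ≤ innerError η σ G (ℓ + 1) := by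
    simp only [innerError, pow_succ]
    have a1 : p * (decayRate ^ ℓ * (η * G)) ≤ decayRate * (decayRate ^ ℓ * (η * G)) := by gcongr
    -- The constant `4` in `innerError` is admissible because `γ σ = η σ (1 - p²)` and `4 - 4p - 2(1
    -- - p²) = 2(1 - p)²`.
    have a2 : 0 ≤ η * σ * (p - 1) ^ 2 := by positivity
    have a3 : γ * σ = η * σ * (1 - p ^ 2) := by rw [hγe]; ring
    nlinarith
  have e3 : 0 ≤ p * innerError η σ G ℓ + γ * L * δ * √(d : ℝ) := by
    have := h.delta_nonneg
    simp only [innerError]; positivity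
  have e4 : 0 ≤ γ * σ := by positivity
  calc _ ≤ (p * innerError η σ G ℓ + γ * L * δ * √(d : ℝ) + γ * σ) ^ 2 := by nlinarith
    _ ≤ _ := by gcongr

lemma rms_innerPath_sub_le (hV : RegularOperator L G V) (h : StepSizes d L σ η γ δ)
    (ho : UnbiasedOracle ν Vt V σ) (hS : InnerSamples P ν s ξ) (z : Vec d) (ℓ : ℕ) :
    MemLp (innerPath Vt η γ δ z s ξ ℓ) 2 P ∧
      rms P (fun ω => innerPath Vt η γ δ z s ξ ℓ ω - resolvent V η z) ≤ innerError η σ G ℓ := by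
  have hη := h.eta_pos
  have hσ := h.sigma_pos
  have hL := h.L_pos
  have hγ := h.gamma_pos
  have hG := hV.bound_nonneg
  have hδ := h.delta_nonneg
  have hVm := hV.measurable hL.le
  induction ℓ with
  | zero =>
    refine ⟨memLp_const z, ?_⟩
    simp only [innerPath, innerIter, rms, integral_const, probReal_univ, one_smul, innerError,
      pow_zero, one_mul]
    rw [Real.sqrt_sq (norm_nonneg _)]
    have := norm_sub_resolvent_le hV h z
    nlinarith [mul_pos hη hσ]
  | succ ℓ ih =>
    obtain ⟨hm, hu⟩ := ih
    obtain ⟨hN, hNs, -⟩ := memLp_innerNoise hV h ho hS z ℓ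
    set x := innerPath Vt η γ δ z s ξ ℓ with hx
    set x₀ := resolvent V η z with hx₀
    set N := innerNoise Vt V η γ δ z s ξ ℓ with hNdef
    -- The noise-free part of the step. It is a function of the current iterate and the Gaussian
    -- vector, hence orthogonal in mean to the oracle noise, whose variance therefore adds without a
    -- cross term.
    let f : Vec d × Vec d → Vec d := fun p =>
      proxStep V η γ z p.1 - x₀ - γ • (V (p.1 + δ • p.2) - V p.1)
    have hf : Measurable f := by
      simp only [f, proxStep]
      fun_prop
    have hs := hS.memLp_gauss (ℓ + 1)
    have hmx : MemLp (fun ω => x ω - x₀) 2 P := hm.sub (memLp_const x₀)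
    have hfb : ∀ ω, ‖f (x ω, s (ℓ + 1) ω)‖ ≤
        √(contractionFactor η γ) * ‖x ω - x₀‖ + γ * L * δ * ‖s (ℓ + 1) ω‖ := fun ω => by
      have a1 := norm_proxStep_sub_le hV h z (x ω) x₀
      rw [hx₀, proxStep_resolvent hV h z, ← hx₀] at a1
      have a2 := hV.smooth (x ω + δ • s (ℓ + 1) ω) (x ω)
      rw [add_sub_cancel_left, norm_smul, Real.norm_of_nonneg hδ] at a2
      calc _ ≤ ‖proxStep V η γ z (x ω) - x₀‖ + ‖γ • (V (x ω + δ • s (ℓ + 1) ω) - V (x ω))‖ :=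
            norm_sub_le _ _
        _ ≤ √(contractionFactor η γ) * ‖x ω - x₀‖ + γ * (L * (δ * ‖s (ℓ + 1) ω‖)) := by
          rw [norm_smul, Real.norm_of_nonneg hγ.le]
          gcongr
        _ = _ := by ring
    have hfm : MemLp (fun ω => f (x ω, s (ℓ + 1) ω)) 2 P := by
      refine MemLp.mono' (g := fun ω => √(contractionFactor η γ) * ‖x ω - x₀‖ +
        γ * L * δ * ‖s (ℓ + 1) ω‖)
        ((hmx.norm.const_mul _).add (hs.norm.const_mul _)) ?_ (Filter.Eventually.of_forall hfb)
      exact (hf.comp ((measurable_innerPath ho hS z ℓ).prodMk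
        (hS.measurable_gauss _))).aestronglyMeasurable
    have hstep : ∀ ω, innerPath Vt η γ δ z s ξ (ℓ + 1) ω - x₀ =
        f (x ω, s (ℓ + 1) ω) + (-γ) • N ω := fun ω => by
      simp only [f, proxStep, hNdef, innerNoise, hx, innerPath, innerIter]
      module
    have hNγ : MemLp (fun ω => (-γ) • N ω) 2 P := hN.const_smul (-γ)
    have h0 := integral_inner_innerNoise hV h ho hS z ℓ hf hfm
    have hsum : MemLp (fun ω => f (x ω, s (ℓ + 1) ω) + (-γ) • N ω) 2 P := hfm.add hNγ
    constructor
    · have : innerPath Vt η γ δ z s ξ (ℓ + 1) =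
          fun ω => (f (x ω, s (ℓ + 1) ω) + (-γ) • N ω) + x₀ := by
        ext1 ω; rw [← hstep]; abel
      rw [this]
      exact hsum.add (memLp_const x₀)
    · have hE0 : 0 ≤ innerError η σ G (ℓ + 1) := by
        have := decayRate_nonneg
        simp only [innerError]; positivity
      refine rms_le_of_sq_le hE0 (le_trans ?_ (innerError_step h hG ℓ))
      simp_rw [hstep]
      rw [integral_norm_add_sq hfm hNγ]
      simp_rw [inner_smul_right, norm_smul, mul_pow]
      rw [integral_const_mul, h0, integral_const_mul, norm_neg, Real.norm_eq_abs, sq_abs]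
      have hA : ∫ ω, ‖f (x ω, s (ℓ + 1) ω)‖ ^ 2 ∂P ≤
          (√(contractionFactor η γ) * innerError η σ G ℓ + γ * L * δ * √(d : ℝ)) ^ 2 := by
        calc _ ≤ ∫ ω, (√(contractionFactor η γ) * ‖x ω - x₀‖ +
              γ * L * δ * ‖s (ℓ + 1) ω‖) ^ 2 ∂P := by
              refine integral_mono (memLp_integrable_norm_sq hfm) ?_ fun ω => ?_
              · exact ((hmx.norm.const_mul _).add (hs.norm.const_mul _)).integrable_sq
              · have := hfb ω
                simp only
                gcongr
          _ ≤ _ := integral_add_mul_norm_sq_le hmx hs (Real.sqrt_nonneg _) (by positivity)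
          _ ≤ _ := by
            rw [hS.rms_gauss]
            have := rms_nonneg (P := P) (fun ω => x ω - x₀)
            gcongr
      nlinarith [mul_le_mul_of_nonneg_left hNs (sq_nonneg γ)]

/-- In the mean the oracle noise vanishes. The linear part contracts by `q = 1 - γ/η`, and the
forcing is at most `γ L` times the root mean square size of `x - x₀` plus that of `δ s`. As `γ = η
(1 - q)`, this accumulates to `η L` times an error of order `η σ`, apart from the decaying term. -/
lemma norm_mean_innerPath_sub_le (hV : RegularOperator L G V) (h : StepSizes d L σ η γ δ)
    (ho : UnbiasedOracle ν Vt V σ) (hS : InnerSamples P ν s ξ) (z : Vec d) (ℓ : ℕ) :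
    ‖∫ ω, (innerPath Vt η γ δ z s ξ ℓ ω - resolvent V η z) ∂P‖ ≤ meanError η L σ G ℓ := by
  have hη := h.eta_pos
  have hσ := h.sigma_pos
  have hL := h.L_pos
  have hγ := h.gamma_pos
  have hG := hV.bound_nonneg
  have hδ := h.delta_nonneg
  have hr := decayRate_nonneg
  induction ℓ with
  | zero =>
    simp only [innerPath, innerIter, integral_const, probReal_univ, one_smul, meanError,
      pow_zero, one_mul]
    have := norm_sub_resolvent_le hV h z
    have : 0 ≤ η ^ 2 * L * σ := by positivity
    have : 0 ≤ η * G := by positivity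
    linarith
  | succ ℓ ih =>
    obtain ⟨hm, hu⟩ := rms_innerPath_sub_le hV h ho hS z ℓ
    obtain ⟨hN, -, hN0⟩ := memLp_innerNoise hV h ho hS z ℓ
    set x := innerPath Vt η γ δ z s ξ ℓ with hx
    set x₀ := resolvent V η z with hx₀
    set N := innerNoise Vt V η γ δ z s ξ ℓ with hNdef
    set q := contractionFactor η γ with hq
    have hs := hS.memLp_gauss (ℓ + 1)
    have hmx : MemLp (fun ω => x ω - x₀) 2 P := hm.sub (memLp_const x₀)
    have hres := resolvent_add hV h z
    rw [← hx₀] at hres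
    -- Writing `z = x₀ + η V x₀` turns the proximal term into a multiple of `x - x₀` and recentres
    -- `V` at `x₀`.
    have hstep : ∀ ω, innerPath Vt η γ δ z s ξ (ℓ + 1) ω - x₀ =
        q • (x ω - x₀) + (-γ) • (V (x ω + δ • s (ℓ + 1) ω) - V x₀) + (-γ) • N ω := fun ω => by
      have : innerPath Vt η γ δ z s ξ (ℓ + 1) ω = x ω - γ • (N ω + V (x ω + δ • s (ℓ + 1) ω) +
          (1 / η) • (x ω - (x₀ + η • V x₀))) := by
        rw [hres]
        simp only [hNdef, innerNoise, hx, innerPath, innerIter, sub_add_cancel]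
      rw [this, hq, contractionFactor]
      have e : (1 / η) • (x ω - (x₀ + η • V x₀)) = (1 / η) • (x ω - x₀) - V x₀ := by
        rw [← sub_sub, smul_sub, smul_smul, one_div_mul_cancel hη.ne', one_smul]
      rw [e, show γ / η = γ * (1 / η) by ring]
      module
    have hbd : ∀ ω, ‖V (x ω + δ • s (ℓ + 1) ω) - V x₀‖ ≤
        L * (‖x ω - x₀‖ + δ * ‖s (ℓ + 1) ω‖) := fun ω => by
      refine (hV.smooth _ _).trans ?_
      gcongr
      calc _ = ‖(x ω - x₀) + δ • s (ℓ + 1) ω‖ := by congr 1; abel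
        _ ≤ ‖x ω - x₀‖ + ‖δ • s (ℓ + 1) ω‖ := norm_add_le _ _
        _ = _ := by rw [norm_smul, Real.norm_of_nonneg hδ]
    have hbI : Integrable (fun ω => L * (‖x ω - x₀‖ + δ * ‖s (ℓ + 1) ω‖)) P :=
      ((hmx.integrable one_le_two).norm.add
        ((hs.integrable one_le_two).norm.const_mul δ)).const_mul L
    have hWI : Integrable (fun ω => V (x ω + δ • s (ℓ + 1) ω) - V x₀) P := by
      refine hbI.mono' ?_ (Filter.Eventually.of_forall hbd)
      have hVm := hV.measurable hL.le
      have hxm : Measurable x := measurable_innerPath ho hS z ℓ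
      have hsm := hS.measurable_gauss (ℓ + 1)
      exact (by fun_prop : Measurable fun ω => V (x ω + δ • s (ℓ + 1) ω) - V x₀).aestronglyMeasurable
    have hW : ‖∫ ω, (V (x ω + δ • s (ℓ + 1) ω) - V x₀) ∂P‖ ≤
        L * (innerError η σ G ℓ + η * σ) := by
      refine (norm_integral_le_of_norm_le hbI (Filter.Eventually.of_forall hbd)).trans ?_
      rw [integral_const_mul, integral_add (hmx.integrable one_le_two).norm
        ((hs.integrable one_le_two).norm.const_mul δ), integral_const_mul, ← h.delta_mul_sqrt,
        ← hS.rms_gauss (ℓ + 1)]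
      gcongr
      · exact (integral_norm_le_rms hmx).trans hu
      · exact integral_norm_le_rms hs
    have e : ∫ ω, (innerPath Vt η γ δ z s ξ (ℓ + 1) ω - x₀) ∂P =
        q • ∫ ω, (x ω - x₀) ∂P + (-γ) • ∫ ω, (V (x ω + δ • s (ℓ + 1) ω) - V x₀) ∂P := by
      simp_rw [hstep]
      have i1 : Integrable (fun ω => q • (x ω - x₀)) P := (hmx.integrable one_le_two).smul q
      have i2 : Integrable (fun ω => (-γ) • (V (x ω + δ • s (ℓ + 1) ω) - V x₀)) P := hWI.smul (-γ)
      have i3 : Integrable (fun ω => (-γ) • N ω) P := (hN.integrable one_le_two).smul (-γ)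
      have i12 : Integrable (fun ω => q • (x ω - x₀) +
        (-γ) • (V (x ω + δ • s (ℓ + 1) ω) - V x₀)) P := i1.add i2
      rw [integral_add i12 i3, integral_add i1 i2, integral_smul, integral_smul, integral_smul,
        hN0, smul_zero, add_zero]
    rw [e]
    have hq0 : 0 ≤ q := h.factor_nonneg
    have hq1 : q ≤ 3 / 4 := h.factor_le
    have hγe : γ = η * (1 - q) := h.gamma_eq_mul
    calc _ ≤ q * meanError η L σ G ℓ + γ * (L * (innerError η σ G ℓ + η * σ)) := by
          refine (norm_add_le _ _).trans ?_
          rw [norm_smul, norm_smul, norm_neg, Real.norm_of_nonneg hγ.le, Real.norm_of_nonneg hq0]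
          gcongr
      _ ≤ meanError η L σ G (ℓ + 1) := by
        simp only [meanError, innerError, pow_succ]
        -- The coefficient `3` needs `3q + (1 - q) ≤ 5/2 ≤ 3 · 43/50`, using `q ≤ 3/4`; the
        -- coefficient `5` is stationary because `5q + 5(1 - q) = 5`.
        have hg := decayRate_ge
        set g := decayRate ^ ℓ * (η * G)
        have hg0 : 0 ≤ g := by positivity
        have a1 : η * L * ((1 - q) * g) ≤ 1 * ((1 - q) * g) := by
          gcongr
          · exact mul_nonneg (by linarith) hg0
          · exact h.eta_mul_le
        have a2 : γ * (L * (g + 4 * (η * σ) + η * σ)) =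
            η * L * ((1 - q) * g) + 5 * (1 - q) * (η ^ 2 * L * σ) := by rw [hγe]; ring
        have a3 : decayRate ^ ℓ * decayRate * (η * G) = decayRate * g := by ring
        rw [a2, a3]
        have a4 : 43 / 50 * g ≤ decayRate * g := by gcongr
        have a5 : q * g ≤ 3 / 4 * g := by gcongr
        nlinarith

end InnerLoop

/-! ### The outer loop -/

/-- A run of the algorithm together with all standing assumptions. -/
structure Run {Ξ Ω : Type*} {_ : MeasurableSpace Ξ} {_ : MeasurableSpace Ω} (P : Measure Ω)
    (ν : Measure Ξ) (d M : ℕ) where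
  (K H : ℕ)
  (L σ G η γ δ : ℝ)
  V : Vec d → Vec d
  Vt : Vec d → Ξ → Vec d
  s : ℕ → Fin M → ℕ → Ω → Vec d
  ξ : ℕ → Fin M → ℕ → Ω → Ξ
  machines_pos : 1 ≤ M
  period_pos : 1 ≤ K
  regular : RegularOperator L G V
  steps : StepSizes d L σ η γ δ
  oracle : UnbiasedOracle ν Vt V σ
  samples : IndependentSamples P ν s ξ

namespace Run

variable {Ξ Ω : Type*} {mΞ : MeasurableSpace Ξ} {mΩ : MeasurableSpace Ω} {P : Measure Ω}
  {ν : Measure Ξ} {d M : ℕ} (A : Run P ν d M)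

/-- The iterate `z_t^m`. -/
noncomputable def z (t : ℕ) (m : Fin M) (ω : Ω) : Vec d :=
  outerIter A.Vt A.η A.γ A.δ A.K A.H (fun t m ℓ => A.s t m ℓ ω) (fun t m ℓ => A.ξ t m ℓ ω) t m

/-- The point `x_{t+1}^m`, computed by the inner loop from `z_t^m`. -/
noncomputable def x (t : ℕ) (m : Fin M) (ω : Ω) : Vec d :=
  innerIter A.Vt A.η A.γ A.δ (A.z t m ω) (fun ℓ => A.s (t + 1) m ℓ ω)
    (fun ℓ => A.ξ (t + 1) m ℓ ω) A.H

/-- The oracle error in the outer step. -/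
noncomputable def noise (t : ℕ) (m : Fin M) (ω : Ω) : Vec d :=
  A.Vt (A.x t m ω) (A.ξ (t + 1) m (A.H + 1) ω) - A.V (A.x t m ω)

/-- The local iterate before averaging. -/
noncomputable def w (t : ℕ) (m : Fin M) (ω : Ω) : Vec d :=
  A.z t m ω - A.η • (A.V (A.x t m ω) + A.noise t m ω)

/-- The resolvent at the local iterate. -/
noncomputable def J (t : ℕ) (m : Fin M) (ω : Ω) : Vec d := resolvent A.V A.η (A.z t m ω)

/-- The root mean square error of the inner loop. -/
noncomputable def err : ℝ := innerError A.η A.σ A.G A.H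

lemma err_pos : 0 < A.err := by
  have h1 := A.steps.eta_pos
  have h2 := A.steps.sigma_pos
  have h3 := A.regular.bound_nonneg
  have h4 := decayRate_nonneg
  unfold err innerError
  positivity

lemma four_mul_le_err : 4 * (A.η * A.σ) ≤ A.err := by
  have h1 := A.steps.eta_pos
  have h3 := A.regular.bound_nonneg
  have h4 := decayRate_nonneg
  unfold err innerError
  have : 0 ≤ decayRate ^ A.H * (A.η * A.G) := by positivity
  linarith

lemma z_zero (m : Fin M) (ω : Ω) : A.z 0 m ω = 0 := rfl

lemma z_succ (t : ℕ) (m : Fin M) (ω : Ω) :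
    A.z (t + 1) m ω =
      if (t + 1) % A.K = 0 then (1 / (M : ℝ)) • ∑ m', A.w t m' ω else A.w t m ω := by
  have hw : ∀ m', A.w t m' ω = A.z t m' ω - A.η • A.Vt (A.x t m' ω)
      (A.ξ (t + 1) m' (A.H + 1) ω) := fun m' => by simp [w, noise]
  simp only [hw]
  simp only [z, outerIter, x]
  split_ifs <;> rfl

lemma J_add (t : ℕ) (m : Fin M) (ω : Ω) : A.J t m ω + A.η • A.V (A.J t m ω) = A.z t m ω :=
  resolvent_add A.regular A.steps _

/-! #### Measurability and independence -/

lemma measurable_V : Measurable A.V := A.regular.measurable A.steps.L_pos.le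

lemma measurable_z' {m₀ : MeasurableSpace Ω} {t : ℕ}
    (hs : ∀ t' ≤ t, ∀ m ℓ, Measurable[m₀] (A.s t' m ℓ))
    (hξ : ∀ t' ≤ t, ∀ m ℓ, Measurable[m₀] (A.ξ t' m ℓ)) (m : Fin M) : Measurable[m₀] (A.z t m) :=
  measurable_outerIter A.oracle.measurable A.K A.H hs hξ m

lemma measurable_x' {m₀ : MeasurableSpace Ω} {t : ℕ} (hz : ∀ m, Measurable[m₀] (A.z t m))
    (m : Fin M) (hs : ∀ ℓ, Measurable[m₀] (A.s (t + 1) m ℓ))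
    (hξ : ∀ ℓ ≤ A.H, Measurable[m₀] (A.ξ (t + 1) m ℓ)) : Measurable[m₀] (A.x t m) :=
  measurable_innerIter A.oracle.measurable (hz m) (fun k _ => hs k) hξ

lemma measurable_noise' {m₀ : MeasurableSpace Ω} {t : ℕ} {m : Fin M}
    (hx : Measurable[m₀] (A.x t m)) (hξ : Measurable[m₀] (A.ξ (t + 1) m (A.H + 1))) :
    Measurable[m₀] (A.noise t m) :=
  (measurable_oracle_comp A.oracle.measurable hx hξ).sub (A.measurable_V.comp hx)

lemma measurable_z (t : ℕ) (m : Fin M) : Measurable (A.z t m) :=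
  A.measurable_z' (fun _ _ _ _ => A.samples.measurable_gauss _ _ _)
    (fun _ _ _ _ => A.samples.measurable_sample _ _ _) m

lemma measurable_x (t : ℕ) (m : Fin M) : Measurable (A.x t m) :=
  A.measurable_x' (A.measurable_z t) m (fun _ => A.samples.measurable_gauss _ _ _)
    (fun _ _ => A.samples.measurable_sample _ _ _)

lemma measurable_J (t : ℕ) (m : Fin M) : Measurable (A.J t m) :=
  (measurable_resolvent A.regular A.steps).comp (A.measurable_z t m)

/-- All samples except the one used by machine `m` in the outer step `t + 1`. -/
@[reducible] def others (t : ℕ) (m : Fin M) : MeasurableSpace Ω :=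
  history A.s A.ξ {Sum.inr (t + 1, m, A.H + 1)}ᶜ

lemma others_le (t : ℕ) (m : Fin M) : A.others t m ≤ mΩ := A.samples.history_le _

lemma measurable_gauss_others (t : ℕ) (m : Fin M) (t' : ℕ) (m' : Fin M) (ℓ : ℕ) :
    Measurable[A.others t m] (A.s t' m' ℓ) := measurable_gauss_history (by simp)

lemma measurable_sample_others (t : ℕ) (m : Fin M) {t' : ℕ} {m' : Fin M} {ℓ : ℕ}
    (h : (t', m', ℓ) ≠ (t + 1, m, A.H + 1)) :
    Measurable[A.others t m] (A.ξ t' m' ℓ) := measurable_sample_history (by simpa using h)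

lemma measurable_z_others (t : ℕ) (m : Fin M) {t' : ℕ} (ht : t' ≤ t) (m' : Fin M) :
    Measurable[A.others t m] (A.z t' m') :=
  A.measurable_z' (fun _ _ _ _ => A.measurable_gauss_others _ _ _ _ _)
    (fun _ _ _ _ => A.measurable_sample_others _ _ (by simp; omega)) m'

/-- The point `x t'` uses oracle samples of iteration `t' + 1` with number at most `H`, so it never
sees sample `H + 1` of iteration `t + 1`, even when `t' = t`. -/
lemma measurable_x_others (t : ℕ) (m : Fin M) {t' : ℕ} (ht : t' ≤ t) (m' : Fin M) :
    Measurable[A.others t m] (A.x t' m') :=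
  A.measurable_x' (A.measurable_z_others t m ht) m'
    (fun _ => A.measurable_gauss_others _ _ _ _ _)
    (fun _ _ => A.measurable_sample_others _ _ (by simp; omega))

lemma measurable_noise_others (t : ℕ) (m : Fin M) {t' : ℕ} {m' : Fin M}
    (h : t' < t ∨ (t' = t ∧ m' ≠ m)) : Measurable[A.others t m] (A.noise t' m') := by
  refine A.measurable_noise' (A.measurable_x_others t m (by omega) m')
    (A.measurable_sample_others _ _ ?_)
  rcases h with h | ⟨h, h'⟩
  · simp; omega
  · simp [h']

lemma indepFun_sample_of_others {β : Type*} [MeasurableSpace β] (t : ℕ) (m : Fin M) {X : Ω → β}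
    (hX : Measurable[A.others t m] X) : IndepFun X (A.ξ (t + 1) m (A.H + 1)) P :=
  indepFun_of_measurable (A.samples.indep_history
      (B := {Sum.inr (t + 1, m, A.H + 1)}) disjoint_compl_left) hX
    (measurable_sample_history (by simp))

lemma innerSamples (t : ℕ) (m : Fin M) : InnerSamples P ν (A.s t m) (A.ξ t m) where
  measurable_gauss _ := A.samples.measurable_gauss _ _ _
  measurable_sample _ := A.samples.measurable_sample _ _ _
  law_gauss _ := A.samples.law_gauss _ _ _
  law_sample _ := A.samples.law_sample _ _ _
  leave_one_out ℓ := by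
    refine ⟨history A.s A.ξ {Sum.inr (t, m, ℓ)}ᶜ, A.samples.history_le _,
      fun k => measurable_gauss_history (by simp),
      fun k hk => measurable_sample_history (by simpa using hk), ?_⟩
    refine indep_of_indep_of_le_right (A.samples.indep_history
      (B := {Sum.inr (t, m, ℓ)}) disjoint_compl_left) ?_
    exact (measurable_sample_history (by simp)).comap_le

/-- The samples used by the inner loop of machine `m` in iteration `t + 1`. -/
def block (t : ℕ) (m : Fin M) (ω : Ω) : (ℕ → Vec d) × (ℕ → Ξ) :=
  (fun ℓ => A.s (t + 1) m ℓ ω, fun ℓ => A.ξ (t + 1) m ℓ ω)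

lemma measurable_block (t : ℕ) (m : Fin M) : Measurable (A.block t m) :=
  (measurable_pi_lambda _ fun _ => A.samples.measurable_gauss _ _ _).prodMk
    (measurable_pi_lambda _ fun _ => A.samples.measurable_sample _ _ _)

lemma measurable_state (t : ℕ) : Measurable fun ω m => A.z t m ω :=
  measurable_pi_lambda _ (A.measurable_z t)

lemma indepFun_state_block (t : ℕ) (m : Fin M) :
    IndepFun (fun ω m => A.z t m ω) (A.block t m) P := by
  let past : Set ((ℕ × Fin M × ℕ) ⊕ (ℕ × Fin M × ℕ)) :=
    {i | Sum.elim (fun j => j.1 ≤ t) (fun j => j.1 ≤ t) i}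
  refine indepFun_of_measurable (A.samples.indep_history (A := past) (B := pastᶜ)
    disjoint_compl_right) ?_ ?_
  · refine @measurable_pi_lambda _ _ _ (history A.s A.ξ past) _ _ fun m => ?_
    exact A.measurable_z'
      (fun t' ht _ _ => measurable_gauss_history (by simpa [past] using ht))
      (fun t' ht _ _ => measurable_sample_history (by simpa [past] using ht)) m
  · refine @Measurable.prodMk _ (history A.s A.ξ pastᶜ) _ _ _ _ _ _ ?_ ?_
    · exact @measurable_pi_lambda _ _ _ (history A.s A.ξ pastᶜ) _ _
        fun ℓ => measurable_gauss_history (by simp [past])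
    · exact @measurable_pi_lambda _ _ _ (history A.s A.ξ pastᶜ) _ _
        fun ℓ => measurable_sample_history (by simp [past])

/-- The inner loop as a function of the states of all machines and the samples of one machine. -/
noncomputable def innerMap (m : Fin M) (p : (Fin M → Vec d) × ((ℕ → Vec d) × (ℕ → Ξ))) : Vec d :=
  innerIter A.Vt A.η A.γ A.δ (p.1 m) p.2.1 p.2.2 A.H

lemma measurable_innerMap (m : Fin M) : Measurable (A.innerMap m) := by
  have h1 : Measurable fun p : (Fin M → Vec d) × ((ℕ → Vec d) × (ℕ → Ξ)) => p.1 m :=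
    (measurable_pi_apply m).comp measurable_fst
  exact measurable_innerIter A.oracle.measurable h1
    (fun k _ => (measurable_pi_apply k).comp (measurable_fst.comp measurable_snd))
    (fun k _ => (measurable_pi_apply k).comp (measurable_snd.comp measurable_snd))

/-- Bound for the mean of the residual `z - x - η V x` of the inner loop. -/
noncomputable def resBias : ℝ := meanError A.η A.L A.σ A.G A.H + A.η * (A.L * A.err)

/-- The residual of the inner loop. -/
noncomputable def residual (t : ℕ) (m : Fin M) (ω : Ω) : Vec d :=
  A.z t m ω - A.x t m ω - A.η • A.V (A.x t m ω)

lemma residual_eq (t : ℕ) (m : Fin M) (ω : Ω) :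
    A.residual t m ω =
      -(A.x t m ω - A.J t m ω) - A.η • (A.V (A.x t m ω) - A.V (A.J t m ω)) := by
  rw [residual, ← A.J_add]; module

/-! #### Second moments -/

variable [IsProbabilityMeasure P]

lemma memLp_noise (t : ℕ) (m : Fin M) :
    MemLp (A.noise t m) 2 P ∧ ∫ ω, ‖A.noise t m ω‖ ^ 2 ∂P ≤ A.σ ^ 2 :=
  A.oracle.memLp_noise A.measurable_V (A.measurable_x t m) (A.samples.measurable_sample _ _ _)
    (A.samples.law_sample _ _ _)
    (A.indepFun_sample_of_others t m (A.measurable_x_others t m le_rfl m))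

lemma integral_inner_noise (t : ℕ) (m : Fin M) {φ : Ω → Vec d}
    (hφ : Measurable[A.others t m] φ) (hφm : MemLp φ 2 P) :
    ∫ ω, inner ℝ (φ ω) (A.noise t m ω) ∂P = 0 :=
  A.oracle.integral_inner_noise A.measurable_V (hφ.mono (A.others_le t m) le_rfl) hφm
    (A.measurable_x t m) (A.samples.measurable_sample _ _ _) (A.samples.law_sample _ _ _)
    (A.indepFun_sample_of_others t m (hφ.prodMk (A.measurable_x_others t m le_rfl m)))

/-- The samples of iteration `t + 1` are independent of the states at time `t`, so the inner-loop
estimate for a fixed starting point transfers to the random one. -/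
lemma memLp_x_sub_J (t : ℕ) (m : Fin M) :
    MemLp (fun ω => A.x t m ω - A.J t m ω) 2 P ∧
      ∫ ω, ‖A.x t m ω - A.J t m ω‖ ^ 2 ∂P ≤ A.err ^ 2 := by
  have hR := measurable_resolvent A.regular A.steps
  refine secondMoment_decouple (A.measurable_state t) (A.measurable_block t m)
    (A.indepFun_state_block t m)
    (h := fun p => A.innerMap m p - resolvent A.V A.η (p.1 m))
    ((A.measurable_innerMap m).sub (hR.comp (by fun_prop))) (sq_nonneg _)
    (fun x => ?_) (fun x => ?_)
  · exact (rms_innerPath_sub_le A.regular A.steps A.oracle (A.innerSamples (t + 1) m) (x m)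
      A.H).1.sub (memLp_const (resolvent A.V A.η (x m)))
  · have := (rms_innerPath_sub_le A.regular A.steps A.oracle (A.innerSamples (t + 1) m) (x m)
      A.H).2
    refine le_trans (rms_sq _).ge ?_
    have h0 := rms_nonneg (P := P) fun ω => innerPath A.Vt A.η A.γ A.δ (x m) (A.s (t + 1) m)
      (A.ξ (t + 1) m) A.H ω - resolvent A.V A.η (x m)
    exact pow_le_pow_left₀ h0 this 2

lemma memLp_V (t : ℕ) (m : Fin M) : MemLp (fun ω => A.V (A.x t m ω)) 2 P :=
  memLp_of_norm_le (A.measurable_V.comp (A.measurable_x t m)).aestronglyMeasurable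
    fun _ => A.regular.bound _

lemma memLp_VJ (t : ℕ) (m : Fin M) : MemLp (fun ω => A.V (A.J t m ω)) 2 P :=
  memLp_of_norm_le (A.measurable_V.comp (A.measurable_J t m)).aestronglyMeasurable
    fun _ => A.regular.bound _

lemma memLp_V_sub (t : ℕ) (m : Fin M) :
    MemLp (fun ω => A.V (A.x t m ω) - A.V (A.J t m ω)) 2 P :=
  (A.memLp_V t m).sub (A.memLp_VJ t m)

lemma memLp_z (t : ℕ) (m : Fin M) : MemLp (A.z t m) 2 P := by
  induction t generalizing m with
  | zero => exact memLp_const (0 : Vec d)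
  | succ t ih =>
    have hw : ∀ m, MemLp (A.w t m) 2 P := fun m =>
      (ih m).sub (((A.memLp_V t m).add (A.memLp_noise t m).1).const_smul A.η)
    by_cases hK : (t + 1) % A.K = 0
    · have : A.z (t + 1) m = fun ω => (1 / (M : ℝ)) • ∑ m', A.w t m' ω := by
        ext1 ω; rw [z_succ, if_pos hK]
      rw [this]
      exact (memLp_finsetSum _ fun m _ => hw m).const_smul (1 / (M : ℝ))
    · have : A.z (t + 1) m = A.w t m := by ext1 ω; rw [z_succ, if_neg hK]
      rw [this]
      exact hw m

lemma memLp_J (t : ℕ) (m : Fin M) : MemLp (A.J t m) 2 P := by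
  have : A.J t m = fun ω => A.z t m ω - A.η • A.V (A.J t m ω) := by
    ext1 ω; rw [eq_sub_iff_add_eq, J_add]
  rw [this]
  exact (A.memLp_z t m).sub ((A.memLp_VJ t m).const_smul A.η)

lemma memLp_x (t : ℕ) (m : Fin M) : MemLp (A.x t m) 2 P := by
  have : A.x t m = fun ω => (A.x t m ω - A.J t m ω) + A.J t m ω := by ext1 ω; abel
  rw [this]
  exact (A.memLp_x_sub_J t m).1.add (A.memLp_J t m)

/-! #### Conditional bias -/

/-- Here the bias is bounded through the root mean square error alone, since a merely Lipschitz `V`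
does not transmit cancellation in the mean of `x - J`. The test vector may depend on the states of
all machines, as the drift and averaging terms require. -/
lemma abs_integral_inner_V_sub_le (t : ℕ) (m : Fin M) {φ : (Fin M → Vec d) → Vec d}
    (hφ : Measurable φ) (hφm : MemLp (fun ω => φ fun m => A.z t m ω) 2 P) :
    |∫ ω, inner ℝ (φ fun m => A.z t m ω) (A.V (A.x t m ω) - A.V (A.J t m ω)) ∂P| ≤
      A.L * A.err * ∫ ω, ‖φ fun m => A.z t m ω‖ ∂P := by
  have hR := measurable_resolvent A.regular A.steps
  have hL := A.steps.L_pos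
  have hi := fun x : Fin M → Vec d => rms_innerPath_sub_le A.regular A.steps A.oracle
    (A.innerSamples (t + 1) m) (x m) A.H
  have hbd : ∀ (x : Fin M → Vec d) ω, ‖A.V (A.innerMap m (x, A.block t m ω)) -
      A.V (resolvent A.V A.η (x m))‖ ≤
      A.L * ‖innerPath A.Vt A.η A.γ A.δ (x m) (A.s (t + 1) m) (A.ξ (t + 1) m) A.H ω -
        resolvent A.V A.η (x m)‖ := fun x ω => A.regular.smooth _ _
  have hmem := fun x => ((hi x).1.sub (memLp_const (resolvent A.V A.η (x m))))
  have hI := fun x => ((hmem x).integrable one_le_two).norm.const_mul A.L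
  have hmeas : Measurable fun p : (Fin M → Vec d) × ((ℕ → Vec d) × (ℕ → Ξ)) =>
      A.V (A.innerMap m p) - A.V (resolvent A.V A.η (p.1 m)) :=
    (A.measurable_V.comp (A.measurable_innerMap m)).sub
      (A.measurable_V.comp (hR.comp (by fun_prop)))
  refine abs_integral_inner_decouple_le (A.measurable_state t) (A.measurable_block t m)
    (A.indepFun_state_block t m) hφ hmeas hφm ((A.memLp_V t m).sub (A.memLp_VJ t m))
    (fun x => ?_) (fun x => ?_)
  · refine (hI x).mono' ?_ (Filter.Eventually.of_forall (hbd x))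
    exact (hmeas.comp (measurable_prodMk_left.comp (A.measurable_block t m))).aestronglyMeasurable
  · refine (norm_integral_le_of_norm_le (hI x) (Filter.Eventually.of_forall (hbd x))).trans ?_
    rw [integral_const_mul]
    exact mul_le_mul_of_nonneg_left ((integral_norm_le_rms (hmem x)).trans (hi x).2) hL.le

/-- Here cancellation is available, so the smaller `meanError` replaces `err`. -/
lemma abs_integral_inner_x_sub_le (t : ℕ) (m : Fin M) {φ : (Fin M → Vec d) → Vec d}
    (hφ : Measurable φ) (hφm : MemLp (fun ω => φ fun m => A.z t m ω) 2 P) :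
    |∫ ω, inner ℝ (φ fun m => A.z t m ω) (A.x t m ω - A.J t m ω) ∂P| ≤
      meanError A.η A.L A.σ A.G A.H * ∫ ω, ‖φ fun m => A.z t m ω‖ ∂P := by
  have hR := measurable_resolvent A.regular A.steps
  refine abs_integral_inner_decouple_le (A.measurable_state t) (A.measurable_block t m)
    (A.indepFun_state_block t m) hφ
    (h := fun p => A.innerMap m p - resolvent A.V A.η (p.1 m))
    ((A.measurable_innerMap m).sub (hR.comp (by fun_prop))) hφm (A.memLp_x_sub_J t m).1
    (fun x => ?_) (fun x => ?_)
  · exact ((rms_innerPath_sub_le A.regular A.steps A.oracle (A.innerSamples (t + 1) m) (x m)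
      A.H).1.sub (memLp_const (resolvent A.V A.η (x m)))).integrable one_le_two
  · exact norm_mean_innerPath_sub_le A.regular A.steps A.oracle (A.innerSamples (t + 1) m) (x m)
      A.H

lemma abs_integral_inner_residual_le (t : ℕ) (m : Fin M) {φ : (Fin M → Vec d) → Vec d}
    (hφ : Measurable φ) (hφm : MemLp (fun ω => φ fun m => A.z t m ω) 2 P) :
    |∫ ω, inner ℝ (φ fun m => A.z t m ω) (A.residual t m ω) ∂P| ≤
      A.resBias * ∫ ω, ‖φ fun m => A.z t m ω‖ ∂P := by
  have h1 := A.abs_integral_inner_x_sub_le t m hφ hφm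
  have h2 := A.abs_integral_inner_V_sub_le t m hφ hφm
  have i1 := memLp_integrable_inner hφm (A.memLp_x_sub_J t m).1
  have i2 := memLp_integrable_inner hφm (A.memLp_V_sub t m)
  have e : ∫ ω, inner ℝ (φ fun m => A.z t m ω) (A.residual t m ω) ∂P =
      -(∫ ω, inner ℝ (φ fun m => A.z t m ω) (A.x t m ω - A.J t m ω) ∂P) -
      A.η * ∫ ω, inner ℝ (φ fun m => A.z t m ω) (A.V (A.x t m ω) - A.V (A.J t m ω)) ∂P := by
    have : ∀ ω, inner ℝ (φ fun m => A.z t m ω) (A.residual t m ω) =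
        -inner ℝ (φ fun m => A.z t m ω) (A.x t m ω - A.J t m ω) -
        A.η * inner ℝ (φ fun m => A.z t m ω) (A.V (A.x t m ω) - A.V (A.J t m ω)) := fun ω => by
      rw [residual_eq, inner_sub_right, inner_neg_right, inner_smul_right]
    simp_rw [this]
    have i1' : Integrable (fun ω => -inner ℝ (φ fun m => A.z t m ω) (A.x t m ω - A.J t m ω)) P :=
      i1.neg
    rw [integral_sub i1' (i2.const_mul _), integral_neg, integral_const_mul]
  rw [e, resBias, add_mul]
  refine (abs_sub _ _).trans ?_
  rw [abs_neg, abs_mul, abs_of_pos A.steps.eta_pos, mul_assoc A.η]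
  gcongr
  exact A.steps.eta_pos.le

end Run

/-! ### Drift between the machines -/

/-- A sequence that grows by at most `4 b √Δ + 4 v - η a` per step and is reset every `K` steps
stays bounded, and so do the averages of `a`. -/
lemma drift_recursion {K : ℕ} (hK : 1 ≤ K) {η b v U : ℝ} (hb : 0 ≤ b) (hv : 0 ≤ v) (hη : 0 < η)
    (hU : U = 16 * (K : ℝ) ^ 2 * b ^ 2 + 8 * K * v) {Δ a W : ℕ → ℝ} (ha : ∀ t, 0 ≤ a t)
    (hW : ∀ t, 0 ≤ W t) (h0 : Δ 0 = 0)
    (hstep : ∀ t, W t ≤ Δ t - η * a t + 4 * b * √(Δ t) + 4 * v)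
    (hsucc : ∀ t, (t + 1) % K ≠ 0 → Δ (t + 1) = W t)
    (hreset : ∀ t, (t + 1) % K = 0 → Δ (t + 1) = 0) :
    (∀ t, Δ t ≤ U) ∧ ∀ n : ℕ, ∑ t ∈ Finset.range n, a t ≤ n * (U / (K * η)) := by
  have hU0 : 0 ≤ U := by rw [hU]; positivity
  have hK0 : (0 : ℝ) < K := by exact_mod_cast hK
  set c := 4 * b * √U + 4 * v with hc
  have hc0 : 0 ≤ c := by positivity
  -- The form of `U` comes from here: `4 K b √U ≤ U/2 + 8 K² b²`, and `8 K² b² + 4 K v` is the other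
  -- half of `U`.
  have hKc : K * c ≤ U := by
    have h1 := sq_nonneg (√U - 4 * K * b)
    have h2 := Real.sq_sqrt hU0
    nlinarith
  have hmod : ∀ t, ((t % K : ℕ) : ℝ) * c ≤ U := fun t => by
    refine le_trans ?_ hKc
    gcongr
    exact (Nat.mod_lt _ hK).le
  -- The remainder modulo `K` counts the steps since the last reset, and each of them adds at most
  -- `c`.
  have hΔ : ∀ t, Δ t ≤ ((t % K : ℕ) : ℝ) * c := by
    intro t
    induction t with
    | zero => simp [h0]
    | succ t ih =>
      by_cases h : (t + 1) % K = 0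
      · rw [hreset t h, h]; simp
      · rw [hsucc t h]
        have e : (t + 1) % K = t % K + 1 := by
          have h1 := Nat.mod_lt t hK
          have h2 : (t + 1) % K = (t % K + 1) % K := by rw [Nat.mod_add_mod]
          rcases Nat.lt_or_ge (t % K + 1) K with h3 | h3
          · rw [h2, Nat.mod_eq_of_lt h3]
          · have h4 : t % K + 1 = K := by omega
            rw [h2, h4, Nat.mod_self] at h
            exact absurd rfl h
        rw [e]
        push_cast
        have h5 : √(Δ t) ≤ √U := Real.sqrt_le_sqrt (ih.trans (hmod t))
        have h6 : 4 * b * √(Δ t) ≤ 4 * b * √U := by gcongr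
        have h7 := mul_nonneg hη.le (ha t)
        linarith [hstep t]
  have hΔU : ∀ t, Δ t ≤ U := fun t => (hΔ t).trans (hmod t)
  refine ⟨hΔU, fun n => ?_⟩
  have hΔ0 : ∀ t, 0 ≤ Δ t := by
    intro t
    rcases t with _ | t
    · exact h0.ge
    · by_cases h : (t + 1) % K = 0
      · exact (hreset t h).ge
      · rw [hsucc t h]; exact hW t
  -- Telescoping runs through the resets, since replacing `W n ≥ 0` by zero only lowers the left
  -- side.
  have hsum : ∀ n : ℕ, ∑ t ∈ Finset.range n, η * a t + Δ n ≤ n * c := by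
    intro n
    induction n with
    | zero => simp [h0]
    | succ n ih =>
      rw [Finset.sum_range_succ]
      push_cast
      have h1 : Δ (n + 1) ≤ W n := by
        by_cases h : (n + 1) % K = 0
        · rw [hreset n h]; exact hW n
        · rw [hsucc n h]
      have h5 : √(Δ n) ≤ √U := Real.sqrt_le_sqrt (hΔU n)
      have h6 : 4 * b * √(Δ n) ≤ 4 * b * √U := by gcongr
      linarith [hstep n]
  have h1 := hsum n
  rw [← Finset.mul_sum] at h1
  have h2 : η * ∑ t ∈ Finset.range n, a t ≤ n * c := by linarith [hΔ0 n]
  have h3 : (n : ℝ) * (U / (K * η)) = n * (U / K) / η := by field_simp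
  rw [h3, le_div_iff₀ hη]
  have h4 : c ≤ U / K := by rw [le_div_iff₀ hK0]; linarith
  nlinarith [mul_le_mul_of_nonneg_left h4 (Nat.cast_nonneg (α := ℝ) n)]

namespace Run

variable {Ξ Ω : Type*} {mΞ : MeasurableSpace Ξ} {mΩ : MeasurableSpace Ω} {P : Measure Ω}
  {ν : Measure Ξ} {d M : ℕ} (A : Run P ν d M)

/-- The deviation of the local step from the exact proximal step. -/
noncomputable def localError (t : ℕ) (m : Fin M) (ω : Ω) : Vec d :=
  (-A.η) • ((A.V (A.x t m ω) - A.V (A.J t m ω)) + A.noise t m ω)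

lemma w_eq (t : ℕ) (m : Fin M) (ω : Ω) : A.w t m ω = A.J t m ω + A.localError t m ω := by
  rw [w, localError, ← A.J_add]; module

/-- The mean square distance of the iterates of two machines. -/
noncomputable def drift (t : ℕ) (m m' : Fin M) : ℝ := ∫ ω, ‖A.z t m ω - A.z t m' ω‖ ^ 2 ∂P

/-- The mean Yosida pairing of the iterates of two machines. -/
noncomputable def pairing (t : ℕ) (m m' : Fin M) : ℝ :=
  ∫ ω, yosidaPairing A.V A.η (A.z t m ω) (A.z t m' ω) ∂P

/-- Uniform bound for the drift. -/
noncomputable def driftBound : ℝ :=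
  16 * (A.K : ℝ) ^ 2 * (A.η * A.L * A.err) ^ 2 + 8 * A.K * (3 * A.err ^ 2)

lemma measurable_state_others (t : ℕ) (m : Fin M) {φ : (Fin M → Vec d) → Vec d}
    (hφ : Measurable φ) : Measurable[A.others t m] fun ω => φ fun m => A.z t m ω :=
  hφ.comp (@measurable_pi_lambda _ _ _ (A.others t m) _ _
    fun m' => A.measurable_z_others t m le_rfl m')

lemma pairing_nonneg (t : ℕ) (m m' : Fin M) : 0 ≤ A.pairing t m m' :=
  integral_nonneg fun _ => yosidaPairing_nonneg A.regular A.steps _ _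

variable [IsProbabilityMeasure P]

lemma integral_norm_V_sub_sq_le (t : ℕ) (m : Fin M) :
    ∫ ω, ‖A.V (A.x t m ω) - A.V (A.J t m ω)‖ ^ 2 ∂P ≤ A.L ^ 2 * A.err ^ 2 := by
  calc _ ≤ ∫ ω, A.L ^ 2 * ‖A.x t m ω - A.J t m ω‖ ^ 2 ∂P := by
        refine integral_mono (memLp_integrable_norm_sq (A.memLp_V_sub t m))
          ((memLp_integrable_norm_sq (A.memLp_x_sub_J t m).1).const_mul _) fun ω => ?_
        simp only
        rw [← mul_pow]
        gcongr
        exact A.regular.smooth _ _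
    _ ≤ _ := by
      rw [integral_const_mul]
      exact mul_le_mul_of_nonneg_left (A.memLp_x_sub_J t m).2 (sq_nonneg _)

lemma memLp_localError (t : ℕ) (m : Fin M) : MemLp (A.localError t m) 2 P :=
  ((A.memLp_V_sub t m).add (A.memLp_noise t m).1).const_smul (-A.η)

lemma integral_norm_localError_sq_le (t : ℕ) (m : Fin M) :
    ∫ ω, ‖A.localError t m ω‖ ^ 2 ∂P ≤ 3 * A.err ^ 2 := by
  have hη := A.steps.eta_pos
  have hL := A.steps.L_pos
  have hσ := A.steps.sigma_pos
  have he := A.err_pos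
  have i1 := memLp_integrable_norm_sq (A.memLp_V_sub t m)
  have i2 := memLp_integrable_norm_sq (A.memLp_noise t m).1
  calc _ ≤ ∫ ω, (2 * A.η ^ 2 * ‖A.V (A.x t m ω) - A.V (A.J t m ω)‖ ^ 2 +
          2 * A.η ^ 2 * ‖A.noise t m ω‖ ^ 2) ∂P := by
        refine integral_mono (memLp_integrable_norm_sq (A.memLp_localError t m))
          ((i1.const_mul _).add (i2.const_mul _)) fun ω => ?_
        simp only [localError]
        rw [norm_smul, mul_pow, norm_neg, Real.norm_eq_abs, sq_abs]
        have h1 := norm_add_le (A.V (A.x t m ω) - A.V (A.J t m ω)) (A.noise t m ω)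
        have h2 : ‖A.V (A.x t m ω) - A.V (A.J t m ω) + A.noise t m ω‖ ^ 2 ≤
            2 * ‖A.V (A.x t m ω) - A.V (A.J t m ω)‖ ^ 2 + 2 * ‖A.noise t m ω‖ ^ 2 := by
          have h3 := pow_le_pow_left₀ (norm_nonneg _) h1 2
          nlinarith [sq_nonneg (‖A.V (A.x t m ω) - A.V (A.J t m ω)‖ - ‖A.noise t m ω‖)]
        nlinarith [mul_le_mul_of_nonneg_left h2 (sq_nonneg A.η)]
    _ ≤ 2 * A.η ^ 2 * (A.L ^ 2 * A.err ^ 2) + 2 * A.η ^ 2 * A.σ ^ 2 := by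
      rw [integral_add (i1.const_mul _) (i2.const_mul _), integral_const_mul, integral_const_mul]
      gcongr
      · exact A.integral_norm_V_sub_sq_le t m
      · exact (A.memLp_noise t m).2
    _ ≤ _ := by
      -- The two summands are at most `2 err²` and `err² / 8`, the latter because `4 η σ ≤ err`.
      have h1 : (A.η * A.L) ^ 2 ≤ 1 := pow_le_one₀ (by positivity) A.steps.eta_mul_le
      have h2 : (4 * (A.η * A.σ)) ^ 2 ≤ A.err ^ 2 :=
        pow_le_pow_left₀ (by positivity) A.four_mul_le_err 2
      nlinarith [mul_le_mul_of_nonneg_right h1 (sq_nonneg A.err)]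

lemma abs_integral_inner_localError_le (t : ℕ) (m : Fin M) {φ : (Fin M → Vec d) → Vec d}
    (hφ : Measurable φ) (hφm : MemLp (fun ω => φ fun m => A.z t m ω) 2 P) :
    |∫ ω, inner ℝ (φ fun m => A.z t m ω) (A.localError t m ω) ∂P| ≤
      A.η * A.L * A.err * ∫ ω, ‖φ fun m => A.z t m ω‖ ∂P := by
  have h1 := A.abs_integral_inner_V_sub_le t m hφ hφm
  have h2 := A.integral_inner_noise t m (A.measurable_state_others t m hφ) hφm
  have i1 := memLp_integrable_inner hφm (A.memLp_V_sub t m)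
  have i2 := memLp_integrable_inner hφm (A.memLp_noise t m).1
  simp_rw [localError, inner_smul_right, inner_add_right]
  rw [integral_const_mul, integral_add i1 i2, h2, add_zero, abs_mul, abs_neg,
    abs_of_pos A.steps.eta_pos, mul_assoc, mul_assoc, ← mul_assoc A.L]
  exact mul_le_mul_of_nonneg_left h1 A.steps.eta_pos.le

lemma integrable_yosidaPairing (t : ℕ) (m m' : Fin M) :
    Integrable (fun ω => yosidaPairing A.V A.η (A.z t m ω) (A.z t m' ω)) P :=
  memLp_integrable_inner ((A.memLp_VJ t m).sub (A.memLp_VJ t m'))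
    ((A.memLp_z t m).sub (A.memLp_z t m'))

/-- The alternative to the telescoped bound on the pairings; the Lipschitz property is all it uses.
-/
lemma pairing_le (t : ℕ) (m m' : Fin M) : A.pairing t m m' ≤ A.L * A.drift t m m' := by
  rw [drift, ← integral_const_mul]
  exact integral_mono (A.integrable_yosidaPairing t m m')
    ((memLp_integrable_norm_sq ((A.memLp_z t m).sub (A.memLp_z t m'))).const_mul _)
    fun _ => yosidaPairing_le A.regular A.steps _ _

/-- The exact resolvent steps contract the distance. The local errors enter the cross term through
their conditional bias `η L err` only, and their full second moments enter through the last term. -/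
lemma spread_le (t : ℕ) (m m' : Fin M) :
    ∫ ω, ‖A.w t m ω - A.w t m' ω‖ ^ 2 ∂P ≤ A.drift t m m' - A.η * A.pairing t m m' +
      4 * (A.η * A.L * A.err) * √(A.drift t m m') + 4 * (3 * A.err ^ 2) := by
  have hη := A.steps.eta_pos
  have hL := A.steps.L_pos
  have he := A.err_pos
  have hR := measurable_resolvent A.regular A.steps
  let φ : (Fin M → Vec d) → Vec d := fun z => resolvent A.V A.η (z m) - resolvent A.V A.η (z m')
  have hφ : Measurable φ := (hR.comp (measurable_pi_apply m)).sub (hR.comp (measurable_pi_apply m'))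
  have hφm : MemLp (fun ω => φ fun m => A.z t m ω) 2 P := (A.memLp_J t m).sub (A.memLp_J t m')
  have hz : MemLp (fun ω => A.z t m ω - A.z t m' ω) 2 P := (A.memLp_z t m).sub (A.memLp_z t m')
  have hn : MemLp (fun ω => A.localError t m ω - A.localError t m' ω) 2 P :=
    (A.memLp_localError t m).sub (A.memLp_localError t m')
  have e : ∀ ω, A.w t m ω - A.w t m' ω = (φ fun m => A.z t m ω) +
      (A.localError t m ω - A.localError t m' ω) := fun ω => by
    simp only [w_eq, φ, J]; abel
  simp_rw [e]
  rw [integral_norm_add_sq hφm hn]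
  have h1 : ∫ ω, ‖φ fun m => A.z t m ω‖ ^ 2 ∂P ≤ A.drift t m m' - A.η * A.pairing t m m' := by
    rw [drift, pairing, ← integral_const_mul, ← integral_sub (memLp_integrable_norm_sq hz)
      ((A.integrable_yosidaPairing t m m').const_mul _)]
    exact integral_mono (memLp_integrable_norm_sq hφm) ((memLp_integrable_norm_sq hz).sub
      ((A.integrable_yosidaPairing t m m').const_mul _))
      fun ω => norm_resolvent_sub_sq_le A.regular A.steps _ _
  have h2 : ∫ ω, ‖φ fun m => A.z t m ω‖ ∂P ≤ √(A.drift t m m') := by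
    refine le_trans ?_ (integral_norm_le_rms hz)
    exact integral_mono (hφm.integrable one_le_two).norm (hz.integrable one_le_two).norm
      fun ω => norm_resolvent_sub_le A.regular A.steps _ _
  have h3 : ∫ ω, inner ℝ (φ fun m => A.z t m ω) (A.localError t m ω - A.localError t m' ω) ∂P ≤
      2 * ((A.η * A.L * A.err) * √(A.drift t m m')) := by
    simp_rw [inner_sub_right]
    rw [integral_sub (memLp_integrable_inner hφm (A.memLp_localError t m))
      (memLp_integrable_inner hφm (A.memLp_localError t m'))]
    have a1 := (abs_le.mp (A.abs_integral_inner_localError_le t m hφ hφm)).2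
    have a2 := (abs_le.mp (A.abs_integral_inner_localError_le t m' hφ hφm)).1
    have a3 : A.η * A.L * A.err * ∫ ω, ‖φ fun m => A.z t m ω‖ ∂P ≤
        A.η * A.L * A.err * √(A.drift t m m') := by gcongr
    linarith
  have h4 : ∫ ω, ‖A.localError t m ω - A.localError t m' ω‖ ^ 2 ∂P ≤ 4 * (3 * A.err ^ 2) := by
    have i1 := memLp_integrable_norm_sq (A.memLp_localError t m)
    have i2 := memLp_integrable_norm_sq (A.memLp_localError t m')
    calc _ ≤ ∫ ω, (2 * ‖A.localError t m ω‖ ^ 2 + 2 * ‖A.localError t m' ω‖ ^ 2) ∂P := by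
          refine integral_mono (memLp_integrable_norm_sq hn)
            ((i1.const_mul _).add (i2.const_mul _)) fun ω => ?_
          have h3 := pow_le_pow_left₀ (norm_nonneg _)
            (norm_sub_le (A.localError t m ω) (A.localError t m' ω)) 2
          simp only
          nlinarith [sq_nonneg (‖A.localError t m ω‖ - ‖A.localError t m' ω‖)]
      _ ≤ _ := by
        rw [integral_add (i1.const_mul _) (i2.const_mul _), integral_const_mul,
          integral_const_mul]
        linarith [A.integral_norm_localError_sq_le t m, A.integral_norm_localError_sq_le t m']
  linarith

lemma drift_bounds (m m' : Fin M) :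
    (∀ t, A.drift t m m' ≤ A.driftBound) ∧
      ∀ n : ℕ, ∑ t ∈ Finset.range n, A.pairing t m m' ≤ n * (A.driftBound / (A.K * A.η)) := by
  have hη := A.steps.eta_pos
  have hL := A.steps.L_pos
  have he := A.err_pos
  refine drift_recursion A.period_pos (b := A.η * A.L * A.err) (v := 3 * A.err ^ 2)
    (by positivity) (by positivity) hη rfl (fun t => A.pairing_nonneg t m m')
    (W := fun t => ∫ ω, ‖A.w t m ω - A.w t m' ω‖ ^ 2 ∂P)
    (fun t => integral_nonneg fun _ => sq_nonneg _) ?_ (fun t => A.spread_le t m m') ?_ ?_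
  · simp [drift, z_zero]
  · intro t ht
    simp only [drift, z_succ, if_neg ht]
  · intro t ht
    simp only [drift, z_succ, if_pos ht]
    simp

end Run

/-! ### The restricted gap function -/

section Gap

variable {d : ℕ} {L G D : ℝ} {V : Vec d → Vec d}

lemma bddAbove_gap (hV : RegularOperator L G V) (D : ℝ) (x : Vec d) :
    BddAbove ((fun z : Vec d => inner ℝ (V z) (x - z)) '' {z | ‖z‖ ≤ D}) := by
  have hG := hV.bound_nonneg
  refine ⟨G * (‖x‖ + D), ?_⟩
  rintro _ ⟨z, hz, rfl⟩
  calc inner ℝ (V z) (x - z) ≤ ‖V z‖ * ‖x - z‖ := real_inner_le_norm _ _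
    _ ≤ G * (‖x‖ + D) := by
      gcongr
      · exact hV.bound z
      · exact (norm_sub_le _ _).trans (by gcongr; exact hz)

lemma gap_le (hD : 0 ≤ D) {x : Vec d} {c : ℝ}
    (h : ∀ z, ‖z‖ ≤ D → inner ℝ (V z) (x - z) ≤ c) : gap V D x ≤ c := by
  refine csSup_le ⟨_, Set.mem_image_of_mem _ (by simpa using hD : (0 : Vec d) ∈ {z | ‖z‖ ≤ D})⟩ ?_
  rintro _ ⟨z, hz, rfl⟩
  exact h z hz

/-- The gap is a supremum of affine functions with slopes `V z` bounded by `G`. Continuity makes it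
measurable along the random output, and linear growth makes it integrable. -/
lemma lipschitzWith_gap (hV : RegularOperator L G V) (hD : 0 ≤ D) :
    LipschitzWith G.toNNReal (gap V D) := by
  have hG := hV.bound_nonneg
  refine LipschitzWith.of_le_add_mul _ fun x y => gap_le hD fun z hz => ?_
  rw [Real.coe_toNNReal _ hG, dist_eq_norm]
  have h1 : inner ℝ (V z) (x - z) = inner ℝ (V z) (y - z) + inner ℝ (V z) (x - y) := by
    rw [← inner_add_right]; congr 1; abel
  rw [h1]
  gcongr
  · exact le_csSup (bddAbove_gap hV D y) ⟨z, hz, rfl⟩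
  · exact (real_inner_le_norm _ _).trans (by gcongr; exact hV.bound z)

lemma integrable_gap {Ω : Type*} [MeasurableSpace Ω] {P : Measure Ω} [IsProbabilityMeasure P]
    (hV : RegularOperator L G V) (hD : 0 ≤ D) {x : Ω → Vec d} (hx : Integrable x P) :
    Integrable (fun ω => gap V D (x ω)) P := by
  have hl := lipschitzWith_gap hV hD
  refine ((hx.norm.const_mul G).add (integrable_const |gap V D 0|)).mono'
    (hl.continuous.comp_aestronglyMeasurable hx.aestronglyMeasurable)
    (Filter.Eventually.of_forall fun ω => ?_)
  have h1 := hl.dist_le_mul (x ω) 0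
  rw [Real.coe_toNNReal _ hV.bound_nonneg, Real.dist_eq, dist_zero_right] at h1
  rw [Real.norm_eq_abs]
  calc |gap V D (x ω)| = |(gap V D (x ω) - gap V D 0) + gap V D 0| := by ring_nf
    _ ≤ |gap V D (x ω) - gap V D 0| + |gap V D 0| := abs_add_le _ _
    _ ≤ _ := by simpa using h1

end Gap

/-! ### Averages over the machines -/

/-- Symmetrization over pairs: it converts deviations from the mean into the pairwise differences
for which the drift bounds hold. -/
lemma sum_inner_sub_mean {E : Type*} [NormedAddCommGroup E] [InnerProductSpace ℝ E] {M : ℕ}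
    (hM : 1 ≤ M) (a b : Fin M → E) :
    ∑ m, inner ℝ (a m) (b m - (1 / (M : ℝ)) • ∑ m', b m') =
      1 / (2 * M) * ∑ m, ∑ m', inner ℝ (a m - a m') (b m - b m') := by
  have hM0 : (M : ℝ) ≠ 0 := by positivity
  simp only [inner_sub_left, inner_sub_right, inner_smul_right, Finset.sum_sub_distrib,
    Finset.sum_const, Finset.card_univ, Fintype.card_fin, nsmul_eq_mul, ← inner_sum, ← sum_inner,
    ← Finset.mul_sum]
  field_simp
  ring

lemma norm_mean_sq_le {E : Type*} [NormedAddCommGroup E] [InnerProductSpace ℝ E] {M : ℕ}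
    (hM : 1 ≤ M) (a : Fin M → E) :
    ‖(1 / (M : ℝ)) • ∑ m, a m‖ ^ 2 ≤ 1 / (M : ℝ) * ∑ m, ‖a m‖ ^ 2 := by
  have hM0 : (0 : ℝ) < M := by positivity
  have h1 : ‖∑ m, a m‖ ^ 2 ≤ M * ∑ m, ‖a m‖ ^ 2 := by
    refine (pow_le_pow_left₀ (norm_nonneg _) (norm_sum_le _ _) 2).trans ?_
    simpa using sq_sum_le_card_mul_sum_sq (s := (Finset.univ : Finset (Fin M)))
      (f := fun m => ‖a m‖)
  rw [norm_smul, mul_pow, Real.norm_of_nonneg (by positivity)]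
  calc (1 / (M : ℝ)) ^ 2 * ‖∑ m, a m‖ ^ 2 ≤ (1 / (M : ℝ)) ^ 2 * (M * ∑ m, ‖a m‖ ^ 2) := by gcongr
    _ = _ := by field_simp

/-! ### Regret of the averaged iterate and the expected gap -/

namespace Run

variable {Ξ Ω : Type*} {mΞ : MeasurableSpace Ξ} {mΩ : MeasurableSpace Ω} {P : Measure Ω}
  {ν : Measure Ξ} {d M : ℕ} (A : Run P ν d M)

/-- The average of the iterates over the machines. -/
noncomputable def zbar (t : ℕ) (ω : Ω) : Vec d := (1 / (M : ℝ)) • ∑ m, A.z t m ω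

/-- The average of the operator values over the machines. -/
noncomputable def vbar (t : ℕ) (ω : Ω) : Vec d := (1 / (M : ℝ)) • ∑ m, A.V (A.x t m ω)

/-- The average of the oracle errors over the machines. -/
noncomputable def nbar (t : ℕ) (ω : Ω) : Vec d := (1 / (M : ℝ)) • ∑ m, A.noise t m ω

/-- Averaging over the machines preserves their mean, so `zbar` follows the same recursion at
synchronization steps and at local steps. -/
lemma zbar_succ (t : ℕ) (ω : Ω) :
    A.zbar (t + 1) ω = A.zbar t ω - A.η • (A.vbar t ω + A.nbar t ω) := by
  have hM := A.machines_pos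
  have hM0 : (M : ℝ) ≠ 0 := by positivity
  have h1 : A.zbar (t + 1) ω = (1 / (M : ℝ)) • ∑ m, A.w t m ω := by
    simp only [zbar, z_succ]
    split_ifs with h
    · rw [Finset.sum_const, Finset.card_univ, Fintype.card_fin, ← Nat.cast_smul_eq_nsmul ℝ,
        smul_smul, smul_smul]
      congr 1
      field_simp
    · rfl
  rw [h1]
  simp only [w, zbar, vbar, nbar, Finset.sum_sub_distrib, ← Finset.smul_sum,
    Finset.sum_add_distrib]
  module

/-- The part of the one-step error that does not depend on the comparison point. -/
noncomputable def stepError (t : ℕ) (ω : Ω) : ℝ :=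
  A.η / 2 * ‖A.vbar t ω + A.nbar t ω‖ ^ 2 - inner ℝ (A.zbar t ω) (A.nbar t ω) -
    1 / (M : ℝ) * ∑ m, inner ℝ (A.V (A.x t m ω)) (A.z t m ω - A.x t m ω) +
    1 / (M : ℝ) * ∑ m, inner ℝ (A.V (A.x t m ω)) (A.z t m ω - A.zbar t ω)

/-- Monotonicity moves the operator from `u` to `x`; then `x - u` is split as `(zbar - u) - (z - x)
+ (z - zbar)`, and expanding `‖zbar (t + 1) - u‖²` handles the first part. -/
lemma step_inequality (t : ℕ) (ω : Ω) (u : Vec d) :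
    1 / (M : ℝ) * ∑ m, inner ℝ (A.V u) (A.x t m ω - u) ≤
      1 / (2 * A.η) * (‖A.zbar t ω - u‖ ^ 2 - ‖A.zbar (t + 1) ω - u‖ ^ 2) + A.stepError t ω +
        inner ℝ (A.nbar t ω) u := by
  have hη := A.steps.eta_pos
  have hM := A.machines_pos
  have hM0 : (0 : ℝ) < M := by positivity
  have h1 : 1 / (M : ℝ) * ∑ m, inner ℝ (A.V u) (A.x t m ω - u) ≤
      1 / (M : ℝ) * ∑ m, inner ℝ (A.V (A.x t m ω)) (A.x t m ω - u) := by
    gcongr with m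
    have := A.regular.mono (A.x t m ω) u
    rw [inner_sub_left] at this
    linarith
  have h2 : 1 / (M : ℝ) * ∑ m, inner ℝ (A.V (A.x t m ω)) (A.x t m ω - u) =
      inner ℝ (A.vbar t ω) (A.zbar t ω - u) -
      1 / (M : ℝ) * ∑ m, inner ℝ (A.V (A.x t m ω)) (A.z t m ω - A.x t m ω) +
      1 / (M : ℝ) * ∑ m, inner ℝ (A.V (A.x t m ω)) (A.z t m ω - A.zbar t ω) := by
    rw [vbar, inner_smul_left, sum_inner]
    simp only [conj_trivial]
    rw [← mul_sub, ← mul_add, ← Finset.sum_sub_distrib, ← Finset.sum_add_distrib]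
    congr 1
    refine Finset.sum_congr rfl fun m _ => ?_
    rw [← inner_sub_right, ← inner_add_right]
    congr 1
    abel
  have h3 : ‖A.zbar (t + 1) ω - u‖ ^ 2 = ‖A.zbar t ω - u‖ ^ 2 -
      2 * A.η * (inner ℝ (A.vbar t ω) (A.zbar t ω - u) + inner ℝ (A.zbar t ω) (A.nbar t ω) -
        inner ℝ (A.nbar t ω) u) + A.η ^ 2 * ‖A.vbar t ω + A.nbar t ω‖ ^ 2 := by
    have e : A.zbar (t + 1) ω - u = (A.zbar t ω - u) - A.η • (A.vbar t ω + A.nbar t ω) := by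
      rw [zbar_succ]; abel
    rw [e, norm_sub_sq_real, inner_smul_right, norm_smul, mul_pow, Real.norm_eq_abs, sq_abs,
      inner_add_right, real_inner_comm (A.vbar t ω), inner_sub_left _ _ (A.nbar t ω),
      real_inner_comm u (A.nbar t ω)]
    ring
  rw [h2] at h1
  refine h1.trans (le_of_eq ?_)
  rw [h3, stepError]
  field_simp
  ring

/-- The average of the first `T` points of all machines. -/
noncomputable def mean (T : ℕ) (ω : Ω) : Vec d :=
  (1 / ((M : ℝ) * T)) • ∑ m, ∑ t ∈ Finset.range T, A.x t m ω

/-- The maximizing `u` depends on the randomness, so the supremum is taken pathwise. After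
telescoping, the only noise term involving `u` is `⟨∑ nbar, u⟩`, which is at most `D ‖∑ nbar‖`. -/
lemma gap_mean_le {D : ℝ} (hD : 0 < D) {T : ℕ} (hT : 1 ≤ T) (ω : Ω) :
    gap A.V D (A.mean T ω) ≤ 1 / T * (D ^ 2 / (2 * A.η) + ∑ t ∈ Finset.range T, A.stepError t ω +
      D * ‖∑ t ∈ Finset.range T, A.nbar t ω‖) := by
  have hη := A.steps.eta_pos
  have hM := A.machines_pos
  have hM0 : (0 : ℝ) < M := by positivity
  have hT0 : (0 : ℝ) < T := by positivity
  refine gap_le hD.le fun u hu => ?_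
  have e : inner ℝ (A.V u) (A.mean T ω - u) =
      1 / T * ∑ t ∈ Finset.range T, 1 / (M : ℝ) * ∑ m, inner ℝ (A.V u) (A.x t m ω - u) := by
    simp only [mean, inner_sub_right, inner_smul_right, inner_sum, Finset.sum_sub_distrib,
      Finset.sum_const, Finset.card_univ, Fintype.card_fin, nsmul_eq_mul, Finset.card_range,
      ← Finset.mul_sum]
    rw [Finset.sum_comm]
    field_simp
  rw [e]
  gcongr
  refine (Finset.sum_le_sum fun t _ => A.step_inequality t ω u).trans ?_
  rw [Finset.sum_add_distrib, Finset.sum_add_distrib, ← Finset.mul_sum,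
    Finset.sum_range_sub' (fun t => ‖A.zbar t ω - u‖ ^ 2), ← sum_inner]
  have h0 : ‖A.zbar 0 ω - u‖ ^ 2 ≤ D ^ 2 := by
    simp only [zbar, z_zero, Finset.sum_const_zero, smul_zero, zero_sub, norm_neg]
    gcongr
  have h1 : inner ℝ (∑ t ∈ Finset.range T, A.nbar t ω) u ≤
      D * ‖∑ t ∈ Finset.range T, A.nbar t ω‖ := by
    refine (real_inner_le_norm _ _).trans ?_
    rw [mul_comm]
    gcongr
  have h2 : 1 / (2 * A.η) * (‖A.zbar 0 ω - u‖ ^ 2 - ‖A.zbar T ω - u‖ ^ 2) ≤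
      D ^ 2 / (2 * A.η) := by
    rw [one_div_mul_eq_div]
    gcongr
    linarith [sq_nonneg ‖A.zbar T ω - u‖]
  linarith

lemma resBias_nonneg : 0 ≤ A.resBias := by
  have h1 := A.steps.eta_pos
  have h2 := A.steps.sigma_pos
  have h3 := A.steps.L_pos
  have h4 := A.regular.bound_nonneg
  have h5 := A.err_pos
  have h6 := decayRate_nonneg
  unfold resBias meanError
  positivity

/-! #### Expectations -/

variable [IsProbabilityMeasure P]

lemma integral_inner_noise_noise {t t' : ℕ} {m m' : Fin M} (h : (t, m) ≠ (t', m')) :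
    ∫ ω, inner ℝ (A.noise t m ω) (A.noise t' m' ω) ∂P = 0 := by
  by_cases hlt : t < t' ∨ (t = t' ∧ m ≠ m')
  · exact A.integral_inner_noise t' m' (A.measurable_noise_others t' m' hlt) (A.memLp_noise t m).1
  · have h' : t' < t := by
      have : t ≠ t' ∨ m ≠ m' := by
        by_contra hc
        push Not at hc
        exact h (Prod.ext hc.1 hc.2)
      by_contra hge
      rcases this with h1 | h1
      · exact hlt (Or.inl (by omega))
      · by_cases h2 : t = t'
        · exact hlt (Or.inr ⟨h2, h1⟩)
        · exact hlt (Or.inl (by omega))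
    -- The later of the two noises must be the one averaged first; here that is the left factor.
    simp_rw [real_inner_comm (A.noise t' m' _)]
    exact A.integral_inner_noise t m (A.measurable_noise_others t m (Or.inl h'))
      (A.memLp_noise t' m').1

lemma integral_norm_sum_noise_sq_le (S : Finset (ℕ × Fin M)) :
    ∫ ω, ‖∑ i ∈ S, A.noise i.1 i.2 ω‖ ^ 2 ∂P ≤ S.card * A.σ ^ 2 := by
  classical
  induction S using Finset.induction_on with
  | empty => simp
  | insert a S ha ih =>
    have hS : MemLp (fun ω => ∑ i ∈ S, A.noise i.1 i.2 ω) 2 P :=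
      memLp_finsetSum _ fun i _ => (A.memLp_noise i.1 i.2).1
    simp_rw [Finset.sum_insert ha]
    rw [integral_norm_add_sq (A.memLp_noise a.1 a.2).1 hS, Finset.card_insert_of_notMem ha]
    simp_rw [inner_sum]
    rw [integral_finsetSum _ fun i _ =>
      memLp_integrable_inner (A.memLp_noise a.1 a.2).1 (A.memLp_noise i.1 i.2).1,
      Finset.sum_eq_zero fun i hi => A.integral_inner_noise_noise fun h => ha (by
        have : a = i := h
        rwa [this])]
    push_cast
    linarith [(A.memLp_noise a.1 a.2).2]

lemma memLp_nbar (t : ℕ) : MemLp (A.nbar t) 2 P :=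
  (memLp_finsetSum _ fun m _ => (A.memLp_noise t m).1).const_smul (1 / (M : ℝ))

lemma memLp_vbar (t : ℕ) : MemLp (A.vbar t) 2 P :=
  (memLp_finsetSum _ fun m _ => A.memLp_V t m).const_smul (1 / (M : ℝ))

lemma memLp_zbar (t : ℕ) : MemLp (A.zbar t) 2 P :=
  (memLp_finsetSum _ fun m _ => A.memLp_z t m).const_smul (1 / (M : ℝ))

lemma memLp_mean (T : ℕ) : MemLp (A.mean T) 2 P :=
  (memLp_finsetSum _ fun m _ => memLp_finsetSum _ fun t _ => A.memLp_x t m).const_smul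
    (1 / ((M : ℝ) * T))

lemma integral_norm_sum_nbar_sq_le (T : Finset ℕ) :
    ∫ ω, ‖∑ t ∈ T, A.nbar t ω‖ ^ 2 ∂P ≤ T.card * A.σ ^ 2 / M := by
  have hM := A.machines_pos
  have hM0 : (0 : ℝ) < M := by positivity
  have e : ∀ ω, ‖∑ t ∈ T, A.nbar t ω‖ ^ 2 = (1 / (M : ℝ)) ^ 2 *
      ‖∑ i ∈ T ×ˢ (Finset.univ : Finset (Fin M)), A.noise i.1 i.2 ω‖ ^ 2 := fun ω => by
    simp only [nbar]
    rw [← Finset.smul_sum, ← Finset.sum_product', norm_smul, mul_pow,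
      Real.norm_of_nonneg (by positivity)]
  simp_rw [e]
  rw [integral_const_mul]
  have h := A.integral_norm_sum_noise_sq_le (T ×ˢ (Finset.univ : Finset (Fin M)))
  rw [Finset.card_product, Finset.card_univ, Fintype.card_fin, Nat.cast_mul] at h
  calc _ ≤ (1 / (M : ℝ)) ^ 2 * (T.card * M * A.σ ^ 2) := by gcongr
    _ = _ := by field_simp

lemma integral_inner_nbar (t : ℕ) {φ : Ω → Vec d} (hφ : ∀ m, Measurable[A.others t m] φ)
    (hφm : MemLp φ 2 P) : ∫ ω, inner ℝ (φ ω) (A.nbar t ω) ∂P = 0 := by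
  simp_rw [nbar, inner_smul_right, inner_sum]
  rw [integral_const_mul, integral_finsetSum _ fun m _ =>
    memLp_integrable_inner hφm (A.memLp_noise t m).1,
    Finset.sum_eq_zero fun m _ => A.integral_inner_noise t m (hφ m) hφm, mul_zero]

lemma integral_norm_vbar_add_nbar_sq_le (t : ℕ) :
    ∫ ω, ‖A.vbar t ω + A.nbar t ω‖ ^ 2 ∂P ≤
      1 / (M : ℝ) * ∑ m, ∫ ω, ‖A.V (A.x t m ω)‖ ^ 2 ∂P + A.σ ^ 2 / M := by
  have hv : ∀ m, Measurable[A.others t m] (A.vbar t) := fun m =>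
    (@Finset.measurable_fun_sum _ _ _ _ _ _ (A.others t m) _ _ fun m' _ =>
      A.measurable_V.comp (A.measurable_x_others t m le_rfl m')).const_smul (1 / (M : ℝ))
  rw [integral_norm_add_sq (A.memLp_vbar t) (A.memLp_nbar t),
    A.integral_inner_nbar t hv (A.memLp_vbar t), mul_zero, add_zero]
  have h1 : ∫ ω, ‖A.nbar t ω‖ ^ 2 ∂P ≤ A.σ ^ 2 / M := by
    simpa using A.integral_norm_sum_nbar_sq_le {t}
  have i1 := fun m => memLp_integrable_norm_sq (A.memLp_V t m)
  have h2 : ∫ ω, ‖A.vbar t ω‖ ^ 2 ∂P ≤ 1 / (M : ℝ) * ∑ m, ∫ ω, ‖A.V (A.x t m ω)‖ ^ 2 ∂P := by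
    rw [← integral_finsetSum _ fun m _ => i1 m, ← integral_const_mul]
    exact integral_mono (memLp_integrable_norm_sq (A.memLp_vbar t))
      ((integrable_finsetSum _ fun m _ => i1 m).const_mul _)
      fun ω => norm_mean_sq_le A.machines_pos _
  linarith

lemma integral_inner_zbar_nbar (t : ℕ) :
    ∫ ω, inner ℝ (A.zbar t ω) (A.nbar t ω) ∂P = 0 := by
  refine A.integral_inner_nbar t (fun m => ?_) (A.memLp_zbar t)
  exact (@Finset.measurable_fun_sum _ _ _ _ _ _ (A.others t m) _ _ fun m' _ =>
      A.measurable_z_others t m le_rfl m').const_smul (1 / (M : ℝ))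

/-- Since `z - x = residual + η V x`, the left side is `-(η/2) E‖V x‖²` minus a pairing with the
residual. Exchanging `V x` for `V J` in that pairing costs at most `2 L ‖x - J‖²`, after which only
the conditional bias of the residual matters. -/
lemma prox_residual_le (t : ℕ) (m : Fin M) :
    A.η / 2 * ∫ ω, ‖A.V (A.x t m ω)‖ ^ 2 ∂P -
      ∫ ω, inner ℝ (A.V (A.x t m ω)) (A.z t m ω - A.x t m ω) ∂P ≤
      A.resBias ^ 2 / A.η + 5 / 2 * A.L * A.err ^ 2 := by
  have hη := A.steps.eta_pos
  have hL := A.steps.L_pos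
  have hηL := A.steps.eta_mul_le
  have he := A.err_pos
  have hV := A.memLp_V t m
  have hVJ := A.memLp_VJ t m
  have hx := A.memLp_x_sub_J t m
  have hR := measurable_resolvent A.regular A.steps
  have hres : MemLp (A.residual t m) 2 P :=
    ((A.memLp_z t m).sub (A.memLp_x t m)).sub (hV.const_smul A.η)
  have iV := memLp_integrable_norm_sq hV
  have iVJ := memLp_integrable_norm_sq hVJ
  have ix := memLp_integrable_norm_sq hx.1
  have iJr := memLp_integrable_inner hVJ hres
  have hpt : ∀ ω, -inner ℝ (A.V (A.x t m ω)) (A.z t m ω - A.x t m ω) ≤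
      -A.η * ‖A.V (A.x t m ω)‖ ^ 2 + -1 * inner ℝ (A.V (A.J t m ω)) (A.residual t m ω) +
        2 * A.L * ‖A.x t m ω - A.J t m ω‖ ^ 2 := fun ω => by
    set v := A.V (A.x t m ω)
    set vJ := A.V (A.J t m ω)
    have e1 : A.z t m ω - A.x t m ω = A.residual t m ω + A.η • v := by
      simp only [residual, v]; abel
    have e2 : inner ℝ v (A.residual t m ω) = inner ℝ vJ (A.residual t m ω) +
        inner ℝ (v - vJ) (A.residual t m ω) := by rw [← inner_add_left]; congr 1; abel
    have e3 : inner ℝ (v - vJ) (A.residual t m ω) =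
        -inner ℝ (v - vJ) (A.x t m ω - A.J t m ω) - A.η * ‖v - vJ‖ ^ 2 := by
      rw [residual_eq, inner_sub_right, inner_neg_right, inner_smul_right,
        real_inner_self_eq_norm_sq]
    have hs : ‖v - vJ‖ ≤ A.L * ‖A.x t m ω - A.J t m ω‖ := A.regular.smooth _ _
    have h1 : inner ℝ (v - vJ) (A.x t m ω - A.J t m ω) ≤ A.L * ‖A.x t m ω - A.J t m ω‖ ^ 2 := by
      calc _ ≤ ‖v - vJ‖ * ‖A.x t m ω - A.J t m ω‖ := real_inner_le_norm _ _
        _ ≤ A.L * ‖A.x t m ω - A.J t m ω‖ * ‖A.x t m ω - A.J t m ω‖ := by gcongr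
        _ = _ := by ring
    have h2 : A.η * ‖v - vJ‖ ^ 2 ≤ A.L * ‖A.x t m ω - A.J t m ω‖ ^ 2 := by
      calc _ ≤ A.η * (A.L * ‖A.x t m ω - A.J t m ω‖) ^ 2 := by gcongr
        _ = (A.η * A.L) * (A.L * ‖A.x t m ω - A.J t m ω‖ ^ 2) := by ring
        _ ≤ 1 * (A.L * ‖A.x t m ω - A.J t m ω‖ ^ 2) := by gcongr
        _ = _ := one_mul _
    rw [e1, inner_add_right, inner_smul_right, real_inner_self_eq_norm_sq, e2, e3]
    linarith
  have h1 : -∫ ω, inner ℝ (A.V (A.x t m ω)) (A.z t m ω - A.x t m ω) ∂P ≤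
      -A.η * ∫ ω, ‖A.V (A.x t m ω)‖ ^ 2 ∂P +
        -1 * ∫ ω, inner ℝ (A.V (A.J t m ω)) (A.residual t m ω) ∂P +
        2 * A.L * ∫ ω, ‖A.x t m ω - A.J t m ω‖ ^ 2 ∂P := by
    rw [← integral_neg, ← integral_const_mul, ← integral_const_mul, ← integral_const_mul,
      ← integral_add_add (iV.const_mul _) (iJr.const_mul _) (ix.const_mul _)]
    exact integral_mono (memLp_integrable_inner hV ((A.memLp_z t m).sub (A.memLp_x t m))).neg
      (((iV.const_mul _).add (iJr.const_mul _)).add (ix.const_mul _)) hpt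
  have h2 := (abs_le.mp (A.abs_integral_inner_residual_le t m
    (φ := fun z => A.V (resolvent A.V A.η (z m)))
    (A.measurable_V.comp (hR.comp (measurable_pi_apply m))) hVJ)).1
  have h3 : ∫ ω, ‖A.V (A.J t m ω)‖ ∂P ≤ rms P fun ω => A.V (A.J t m ω) :=
    integral_norm_le_rms hVJ
  have h4 := rms_sq (P := P) fun ω => A.V (A.J t m ω)
  have h5 : ∫ ω, ‖A.V (A.J t m ω)‖ ^ 2 ∂P ≤
      2 * ∫ ω, ‖A.V (A.x t m ω)‖ ^ 2 ∂P + 2 * (A.L ^ 2 * A.err ^ 2) := by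
    have i2 := memLp_integrable_norm_sq (A.memLp_V_sub t m)
    refine le_trans ?_ (add_le_add_right (mul_le_mul_of_nonneg_left
      (A.integral_norm_V_sub_sq_le t m) two_pos.le) _)
    rw [← integral_const_mul, ← integral_const_mul, ← integral_add (iV.const_mul _)
      (i2.const_mul _)]
    refine integral_mono iVJ ((iV.const_mul _).add (i2.const_mul _)) fun ω => ?_
    have h6 : ‖A.V (A.J t m ω)‖ ≤ ‖A.V (A.x t m ω)‖ + ‖A.V (A.x t m ω) - A.V (A.J t m ω)‖ := by
      rw [norm_sub_rev]
      refine le_trans (le_of_eq ?_) (norm_add_le _ _)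
      congr 1; abel
    have h7 := pow_le_pow_left₀ (norm_nonneg _) h6 2
    simp only
    nlinarith [sq_nonneg (‖A.V (A.x t m ω)‖ - ‖A.V (A.x t m ω) - A.V (A.J t m ω)‖)]
  set r := rms P fun ω => A.V (A.J t m ω)
  -- The weight `η / 4` is chosen so that, after `‖V J‖² ≤ 2 ‖V x‖² + 2 ‖V x - V J‖²`, the term in
  -- `‖V x‖²` cancels the available `-η / 2`.
  have h6 : A.resBias * r ≤ A.resBias ^ 2 / A.η + A.η / 4 * r ^ 2 := by
    have h7 := sq_nonneg (A.resBias - A.η / 2 * r)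
    rw [div_add' _ _ _ hη.ne', le_div_iff₀ hη]
    nlinarith
  have h7 : A.resBias * ∫ ω, ‖A.V (A.J t m ω)‖ ∂P ≤ A.resBias * r :=
    mul_le_mul_of_nonneg_left h3 A.resBias_nonneg
  have h8 : A.η / 4 * (2 * (A.L ^ 2 * A.err ^ 2)) ≤ 1 / 2 * A.L * A.err ^ 2 := by
    calc _ = (A.η * A.L) * (1 / 2 * A.L * A.err ^ 2) := by ring
      _ ≤ 1 * (1 / 2 * A.L * A.err ^ 2) := by gcongr
      _ = _ := one_mul _
  have h9 : A.η / 4 * r ^ 2 ≤ A.η / 4 * (2 * ∫ ω, ‖A.V (A.x t m ω)‖ ^ 2 ∂P +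
      2 * (A.L ^ 2 * A.err ^ 2)) := by rw [h4]; gcongr
  have h10 := mul_le_mul_of_nonneg_left hx.2 (by positivity : 0 ≤ 2 * A.L)
  change -(A.resBias * ∫ ω, ‖A.V (A.J t m ω)‖ ∂P) ≤
    ∫ ω, inner ℝ (A.V (A.J t m ω)) (A.residual t m ω) ∂P at h2
  linarith

lemma integral_norm_sub_zbar_le (t : ℕ) (m : Fin M) :
    ∫ ω, ‖A.z t m ω - A.zbar t ω‖ ∂P ≤ √A.driftBound := by
  have hM := A.machines_pos
  have hM0 : (0 : ℝ) < M := by positivity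
  have hz : ∀ m', MemLp (fun ω => A.z t m ω - A.z t m' ω) 2 P := fun m' =>
    (A.memLp_z t m).sub (A.memLp_z t m')
  have h1 : ∀ ω, ‖A.z t m ω - A.zbar t ω‖ ≤
      1 / (M : ℝ) * ∑ m', ‖A.z t m ω - A.z t m' ω‖ := fun ω => by
    have e : A.z t m ω - A.zbar t ω = (1 / (M : ℝ)) • ∑ m', (A.z t m ω - A.z t m' ω) := by
      rw [zbar, Finset.sum_sub_distrib, smul_sub, Finset.sum_const, Finset.card_univ,
        Fintype.card_fin, ← Nat.cast_smul_eq_nsmul ℝ, smul_smul, one_div_mul_cancel hM0.ne',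
        one_smul]
    rw [e, norm_smul, Real.norm_of_nonneg (by positivity)]
    gcongr
    exact norm_sum_le _ _
  have i1 := fun m' => ((hz m').integrable one_le_two).norm
  calc _ ≤ ∫ ω, 1 / (M : ℝ) * ∑ m', ‖A.z t m ω - A.z t m' ω‖ ∂P :=
        integral_mono (((A.memLp_z t m).sub (A.memLp_zbar t)).integrable one_le_two).norm
          ((integrable_finsetSum _ fun m' _ => i1 m').const_mul _) h1
    _ = 1 / (M : ℝ) * ∑ m', ∫ ω, ‖A.z t m ω - A.z t m' ω‖ ∂P := by
      rw [integral_const_mul, integral_finsetSum _ fun m' _ => i1 m']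
    _ ≤ 1 / (M : ℝ) * ∑ _m' : Fin M, √A.driftBound := by
      gcongr with m'
      exact (integral_norm_le_rms (hz m')).trans
        (Real.sqrt_le_sqrt ((A.drift_bounds m m').1 t))
    _ = _ := by
      rw [Finset.sum_const, Finset.card_univ, Fintype.card_fin, nsmul_eq_mul]
      field_simp

/-- Replacing `V x` by `V J` costs the bias `L err` times the mean deviation from the average. What
is left is a sum of Yosida pairings, the quantity that the contraction of the resolvent makes
summable. -/
lemma integral_drift_term_le (t : ℕ) :
    1 / (M : ℝ) * ∑ m, ∫ ω, inner ℝ (A.V (A.x t m ω)) (A.z t m ω - A.zbar t ω) ∂P ≤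
      1 / (2 * (M : ℝ) ^ 2) * ∑ m, ∑ m', A.pairing t m m' + A.L * A.err * √A.driftBound := by
  have hM := A.machines_pos
  have hM0 : (0 : ℝ) < M := by positivity
  have hL := A.steps.L_pos
  have he := A.err_pos
  have hzb : ∀ m, MemLp (fun ω => A.z t m ω - A.zbar t ω) 2 P := fun m =>
    (A.memLp_z t m).sub (A.memLp_zbar t)
  have iJ : ∀ m, Integrable (fun ω => inner ℝ (A.V (A.J t m ω)) (A.z t m ω - A.zbar t ω)) P :=
    fun m => memLp_integrable_inner (A.memLp_VJ t m) (hzb m)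
  have h1 : ∀ m, ∫ ω, inner ℝ (A.V (A.x t m ω)) (A.z t m ω - A.zbar t ω) ∂P ≤
      ∫ ω, inner ℝ (A.V (A.J t m ω)) (A.z t m ω - A.zbar t ω) ∂P +
        A.L * A.err * √A.driftBound := fun m => by
    let φ : (Fin M → Vec d) → Vec d := fun z => z m - (1 / (M : ℝ)) • ∑ m', z m'
    have hφ : Measurable φ := by fun_prop
    have h2 := (abs_le.mp (A.abs_integral_inner_V_sub_le t m hφ (hzb m))).2
    have h3 := A.integral_norm_sub_zbar_le t m
    have e : ∀ ω, inner ℝ (A.V (A.x t m ω)) (A.z t m ω - A.zbar t ω) =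
        inner ℝ (A.V (A.J t m ω)) (A.z t m ω - A.zbar t ω) +
        inner ℝ (φ fun m => A.z t m ω) (A.V (A.x t m ω) - A.V (A.J t m ω)) := fun ω => by
      rw [real_inner_comm (A.V (A.x t m ω) - A.V (A.J t m ω))]
      change _ = _ + inner ℝ _ (A.z t m ω - A.zbar t ω)
      rw [← inner_add_left]
      congr 1; abel
    have iφ : Integrable (fun ω => inner ℝ (φ fun m => A.z t m ω)
        (A.V (A.x t m ω) - A.V (A.J t m ω))) P :=
      memLp_integrable_inner (hzb m) (A.memLp_V_sub t m)
    simp_rw [e]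
    rw [integral_add (iJ m) iφ]
    have h4 : A.L * A.err * ∫ ω, ‖φ fun m => A.z t m ω‖ ∂P ≤ A.L * A.err * √A.driftBound := by
      gcongr
      exact h3
    linarith
  have h2 : ∑ m, ∫ ω, inner ℝ (A.V (A.J t m ω)) (A.z t m ω - A.zbar t ω) ∂P =
      1 / (2 * (M : ℝ)) * ∑ m, ∑ m', A.pairing t m m' := by
    rw [← integral_finsetSum _ fun m _ => iJ m]
    simp_rw [zbar, sum_inner_sub_mean hM]
    change ∫ ω, 1 / (2 * (M : ℝ)) * ∑ m, ∑ m',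
      yosidaPairing A.V A.η (A.z t m ω) (A.z t m' ω) ∂P = _
    rw [integral_const_mul, integral_finsetSum _ fun m _ => integrable_finsetSum _ fun m' _ =>
      A.integrable_yosidaPairing t m m']
    congr 1
    refine Finset.sum_congr rfl fun m _ => ?_
    rw [integral_finsetSum _ fun m' _ => A.integrable_yosidaPairing t m m']
    rfl
  calc _ ≤ 1 / (M : ℝ) * ∑ m, (∫ ω, inner ℝ (A.V (A.J t m ω)) (A.z t m ω - A.zbar t ω) ∂P +
        A.L * A.err * √A.driftBound) := by
        gcongr with m
        exact h1 m
    _ = _ := by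
      rw [Finset.sum_add_distrib, h2, Finset.sum_const, Finset.card_univ, Fintype.card_fin,
        nsmul_eq_mul]
      field_simp

lemma integral_stepError_le (t : ℕ) :
    Integrable (A.stepError t) P ∧
    ∫ ω, A.stepError t ω ∂P ≤ A.η * A.σ ^ 2 / (2 * M) +
      (A.resBias ^ 2 / A.η + 5 / 2 * A.L * A.err ^ 2) +
      (1 / (2 * (M : ℝ) ^ 2) * ∑ m, ∑ m', A.pairing t m m' + A.L * A.err * √A.driftBound) := by
  have hM := A.machines_pos
  have hM0 : (0 : ℝ) < M := by positivity
  have hη := A.steps.eta_pos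
  have i1 := (memLp_integrable_norm_sq ((A.memLp_vbar t).add (A.memLp_nbar t))).const_mul (A.η / 2)
  have i2 := memLp_integrable_inner (A.memLp_zbar t) (A.memLp_nbar t)
  have i3' := fun m => memLp_integrable_inner (A.memLp_V t m)
    ((A.memLp_z t m).sub (A.memLp_x t m))
  have i3 := (integrable_finsetSum Finset.univ fun m _ => i3' m).const_mul (1 / (M : ℝ))
  have i4' := fun m => memLp_integrable_inner (A.memLp_V t m)
    ((A.memLp_z t m).sub (A.memLp_zbar t))
  have i4 := (integrable_finsetSum Finset.univ fun m _ => i4' m).const_mul (1 / (M : ℝ))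
  refine ⟨((i1.sub i2).sub i3).add i4, ?_⟩
  have e : ∫ ω, A.stepError t ω ∂P = A.η / 2 * ∫ ω, ‖A.vbar t ω + A.nbar t ω‖ ^ 2 ∂P - 0 -
      1 / (M : ℝ) * ∑ m, ∫ ω, inner ℝ (A.V (A.x t m ω)) (A.z t m ω - A.x t m ω) ∂P +
      1 / (M : ℝ) * ∑ m, ∫ ω, inner ℝ (A.V (A.x t m ω)) (A.z t m ω - A.zbar t ω) ∂P := by
    rw [← A.integral_inner_zbar_nbar t]
    refine (integral_add ((i1.sub i2).sub i3) i4).trans ?_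
    congr 1
    · refine (integral_sub (i1.sub i2) i3).trans ?_
      congr 1
      · refine (integral_sub i1 i2).trans ?_
        rw [integral_const_mul]
        rfl
      · rw [integral_const_mul, integral_finsetSum _ fun m _ => i3' m]
        rfl
    · rw [integral_const_mul, integral_finsetSum _ fun m _ => i4' m]
      rfl
  rw [e]
  have h1 := mul_le_mul_of_nonneg_left (A.integral_norm_vbar_add_nbar_sq_le t)
    (by positivity : 0 ≤ A.η / 2)
  have h2 := A.integral_drift_term_le t
  have h3 : 1 / (M : ℝ) * ∑ m, (A.η / 2 * ∫ ω, ‖A.V (A.x t m ω)‖ ^ 2 ∂P -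
      ∫ ω, inner ℝ (A.V (A.x t m ω)) (A.z t m ω - A.x t m ω) ∂P) ≤
      A.resBias ^ 2 / A.η + 5 / 2 * A.L * A.err ^ 2 := by
    calc _ ≤ 1 / (M : ℝ) * ∑ _m : Fin M, (A.resBias ^ 2 / A.η + 5 / 2 * A.L * A.err ^ 2) := by
          gcongr with m
          exact A.prox_residual_le t m
      _ = _ := by
        rw [Finset.sum_const, Finset.card_univ, Fintype.card_fin, nsmul_eq_mul]
        field_simp
  rw [Finset.sum_sub_distrib, ← Finset.mul_sum, mul_sub] at h3
  have e2 : A.η / 2 * (1 / (M : ℝ) * ∑ m, ∫ ω, ‖A.V (A.x t m ω)‖ ^ 2 ∂P + A.σ ^ 2 / M) =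
      1 / (M : ℝ) * (A.η / 2 * ∑ m, ∫ ω, ‖A.V (A.x t m ω)‖ ^ 2 ∂P) + A.η * A.σ ^ 2 / (2 * M) := by
    field_simp
  linarith

lemma integral_norm_sum_nbar_le (T : ℕ) :
    ∫ ω, ‖∑ t ∈ Finset.range T, A.nbar t ω‖ ∂P ≤ A.σ * √(T / M) := by
  have hσ := A.steps.sigma_pos
  have hm : MemLp (fun ω => ∑ t ∈ Finset.range T, A.nbar t ω) 2 P :=
    memLp_finsetSum _ fun t _ => A.memLp_nbar t
  refine (integral_norm_le_rms hm).trans (rms_le_of_sq_le (by positivity) ?_)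
  refine (A.integral_norm_sum_nbar_sq_le (Finset.range T)).trans (le_of_eq ?_)
  rw [mul_pow, Real.sq_sqrt (by positivity), Finset.card_range]
  ring

/-- The gap bound before the choice of the step size; `X` is any bound for the time averages of the
Yosida pairings. -/
theorem integral_gap_le {D : ℝ} (hD : 0 < D) {T : ℕ} (hT : 1 ≤ T) {X : ℝ}
    (hX : ∀ m m', ∑ t ∈ Finset.range T, A.pairing t m m' ≤ T * X) :
    Integrable (fun ω => gap A.V D (A.mean T ω)) P ∧
    ∫ ω, gap A.V D (A.mean T ω) ∂P ≤ D ^ 2 / (2 * A.η * T) + D * A.σ / √(M * T) +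
      A.η * A.σ ^ 2 / (2 * M) + A.resBias ^ 2 / A.η + 5 / 2 * A.L * A.err ^ 2 +
      (X / 2 + A.L * A.err * √A.driftBound) := by
  have hM := A.machines_pos
  have hM0 : (0 : ℝ) < M := by positivity
  have hT0 : (0 : ℝ) < T := by positivity
  have hη := A.steps.eta_pos
  have hg : Integrable (fun ω => gap A.V D (A.mean T ω)) P :=
    integrable_gap A.regular hD.le ((A.memLp_mean T).integrable one_le_two)
  refine ⟨hg, ?_⟩
  have i1 := integrable_finsetSum (Finset.range T) fun t _ => (A.integral_stepError_le t).1
  have hm : MemLp (fun ω => ∑ t ∈ Finset.range T, A.nbar t ω) 2 P :=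
    memLp_finsetSum _ fun t _ => A.memLp_nbar t
  have i2 := (hm.integrable one_le_two).norm.const_mul D
  have i0 : Integrable (fun _ : Ω => D ^ 2 / (2 * A.η)) P := integrable_const _
  have h1 : ∫ ω, gap A.V D (A.mean T ω) ∂P ≤ 1 / T * (D ^ 2 / (2 * A.η) +
      ∑ t ∈ Finset.range T, ∫ ω, A.stepError t ω ∂P +
      D * ∫ ω, ‖∑ t ∈ Finset.range T, A.nbar t ω‖ ∂P) := by
    refine (integral_mono hg (((i0.add i1).add i2).const_mul (1 / (T : ℝ)))
      fun ω => A.gap_mean_le hD hT ω).trans (le_of_eq ?_)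
    refine (integral_const_mul _ _).trans ?_
    congr 1
    refine (integral_add_add i0 i1 i2).trans ?_
    rw [integral_const_mul, integral_finsetSum _ fun t _ => (A.integral_stepError_le t).1]
    simp
  refine h1.trans ?_
  have h2 := Finset.sum_le_sum fun t (_ : t ∈ Finset.range T) => (A.integral_stepError_le t).2
  simp only [Finset.sum_add_distrib, Finset.sum_const, Finset.card_range, nsmul_eq_mul,
    ← Finset.mul_sum] at h2
  have h3 : ∑ t ∈ Finset.range T, ∑ m, ∑ m', A.pairing t m m' ≤ (M : ℝ) ^ 2 * (T * X) := by
    rw [Finset.sum_comm]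
    calc _ ≤ ∑ _m : Fin M, ∑ _m' : Fin M, (T : ℝ) * X := by
          refine Finset.sum_le_sum fun m _ => ?_
          rw [Finset.sum_comm]
          exact Finset.sum_le_sum fun m' _ => hX m m'
      _ = _ := by simp; ring
  have h4 := mul_le_mul_of_nonneg_left h3 (by positivity : 0 ≤ 1 / (2 * (M : ℝ) ^ 2))
  have h5 : 1 / (2 * (M : ℝ) ^ 2) * ((M : ℝ) ^ 2 * (T * X)) = T * (X / 2) := by field_simp
  have h6 := mul_le_mul_of_nonneg_left (A.integral_norm_sum_nbar_le T) hD.le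
  have h7 : D * A.σ / √(M * T) = 1 / T * (D * (A.σ * √(T / M))) := by
    rw [Real.sqrt_mul hM0.le, Real.sqrt_div hT0.le]
    have e1 : √(T : ℝ) * √(T : ℝ) = T := Real.mul_self_sqrt hT0.le
    have e2 : √(T : ℝ) ≠ 0 := by positivity
    have e3 : √(M : ℝ) ≠ 0 := by positivity
    field_simp
    linear_combination -A.σ * e1
  rw [h7]
  have h8 : D ^ 2 / (2 * A.η * T) = 1 / T * (D ^ 2 / (2 * A.η)) := by field_simp
  rw [h8]
  set q1 := A.η * A.σ ^ 2 / (2 * M)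
  set q2 := A.resBias ^ 2 / A.η
  set q3 := 5 / 2 * A.L * A.err ^ 2
  set q4 := A.L * A.err * √A.driftBound
  calc _ ≤ 1 / T * (D ^ 2 / (2 * A.η) + (T * q1 + T * (q2 + q3) + (T * (X / 2) + T * q4)) +
        D * (A.σ * √(T / M))) := by
        gcongr
        linarith
    _ = _ := by field_simp; ring

end Run

/-! ### The choice of the step size -/

/-- Substituting `x = y ^ n` with `n` a common denominator turns the fractional powers into natural
ones, so that `ring` and `field_simp` apply. -/
lemma exists_pos_root {x : ℝ} (hx : 0 < x) (n : ℕ) (hn : n ≠ 0) :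
    ∃ y : ℝ, 0 < y ∧ x = y ^ n ∧ ∀ (k : ℕ) (q : ℝ), q * n = k → x ^ q = y ^ k := by
  have hn0 : (n : ℝ) ≠ 0 := by exact_mod_cast hn
  refine ⟨x ^ (1 / (n : ℝ)), by positivity, ?_, fun k q hq => ?_⟩
  · rw [← Real.rpow_natCast, ← Real.rpow_mul hx.le, one_div_mul_cancel hn0, Real.rpow_one]
  · rw [← Real.rpow_natCast, ← Real.rpow_mul hx.le, ← hq]
    congr 1
    field_simp

section StepSizeTerms

variable {D K R L σ e : ℝ}

lemma smoothing_term_eq (hD : 0 < D) (hK : 0 < K) (hR : 0 < R) (hL : 0 < L) (hσ : 0 < σ)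
    (he : 0 < e) :
    D ^ 2 / (D ^ (1 / 2 : ℝ) / (K ^ (1 / 4 : ℝ) * R ^ (1 / 4 : ℝ) * L ^ (1 / 2 : ℝ) *
        σ ^ (1 / 2 : ℝ) * e ^ (1 / 8 : ℝ)) * (K * R)) =
      D ^ (3 / 2 : ℝ) * L ^ (1 / 2 : ℝ) * σ ^ (1 / 2 : ℝ) * e ^ (1 / 8 : ℝ) /
        (K ^ (3 / 4 : ℝ) * R ^ (3 / 4 : ℝ)) := by
  obtain ⟨D', hD', rfl, hDp⟩ := exists_pos_root hD 2 (by norm_num)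
  obtain ⟨K', hK', rfl, hKp⟩ := exists_pos_root hK 4 (by norm_num)
  obtain ⟨R', hR', rfl, hRp⟩ := exists_pos_root hR 4 (by norm_num)
  rw [hDp 1 (1 / 2) (by norm_num), hDp 3 (3 / 2) (by norm_num), hKp 1 (1 / 4) (by norm_num),
    hKp 3 (3 / 4) (by norm_num), hRp 1 (1 / 4) (by norm_num), hRp 3 (3 / 4) (by norm_num)]
  field_simp

/-- The fourth power of the step size restriction, after dropping the dimension factor, which is at
least one. The next two estimates arise likewise from fifth and third powers. -/
lemma smoothing_term_le (hD : 0 < D) (hK : 0 < K) (hR : 0 < R) (hL : 0 < L) (hσ : 0 < σ)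
    (he : 1 ≤ e) {η : ℝ} (hη : 0 < η)
    (h : η ≤ D ^ (1 / 2 : ℝ) / (K ^ (1 / 4 : ℝ) * R ^ (1 / 4 : ℝ) * L ^ (1 / 2 : ℝ) *
        σ ^ (1 / 2 : ℝ) * e ^ (1 / 8 : ℝ))) :
    η ^ 3 * L ^ 2 * σ ^ 2 ≤ D ^ 2 / (η * (K * R)) := by
  have he1 : 1 ≤ e ^ (1 / 8 : ℝ) := Real.one_le_rpow he (by norm_num)
  obtain ⟨D', hD', rfl, hDp⟩ := exists_pos_root hD 2 (by norm_num)
  obtain ⟨K', hK', rfl, hKp⟩ := exists_pos_root hK 4 (by norm_num)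
  obtain ⟨R', hR', rfl, hRp⟩ := exists_pos_root hR 4 (by norm_num)
  obtain ⟨L', hL', rfl, hLp⟩ := exists_pos_root hL 2 (by norm_num)
  obtain ⟨σ', hσ', rfl, hσp⟩ := exists_pos_root hσ 2 (by norm_num)
  rw [hDp 1 (1 / 2) (by norm_num), hKp 1 (1 / 4) (by norm_num), hRp 1 (1 / 4) (by norm_num),
    hLp 1 (1 / 2) (by norm_num), hσp 1 (1 / 2) (by norm_num), le_div_iff₀ (by positivity)] at h
  rw [le_div_iff₀ (by positivity)]
  have h1 : η * (K' * R' * L' * σ') ≤ D' := by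
    calc η * (K' * R' * L' * σ') = η * (K' ^ 1 * R' ^ 1 * L' ^ 1 * σ' ^ 1 * 1) := by ring
      _ ≤ η * (K' ^ 1 * R' ^ 1 * L' ^ 1 * σ' ^ 1 * e ^ (1 / 8 : ℝ)) := by gcongr
      _ ≤ D' ^ 1 := h
      _ = D' := pow_one _
  calc _ = (η * (K' * R' * L' * σ')) ^ 4 := by ring
    _ ≤ D' ^ 4 := by gcongr
    _ = _ := by ring

lemma bias_drift_term_eq (hD : 0 < D) (hK : 0 < K) (hR : 0 < R) (hL : 0 < L) (hσ : 0 < σ)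
    (he : 0 < e) :
    D ^ 2 / (D ^ (2 / 5 : ℝ) / (σ ^ (2 / 5 : ℝ) * L ^ (2 / 5 : ℝ) * e ^ (1 / 10 : ℝ) *
        K ^ (3 / 5 : ℝ) * R ^ (1 / 5 : ℝ)) * (K * R)) =
      D ^ (8 / 5 : ℝ) * σ ^ (2 / 5 : ℝ) * L ^ (2 / 5 : ℝ) * e ^ (1 / 10 : ℝ) /
        (R ^ (4 / 5 : ℝ) * K ^ (2 / 5 : ℝ)) := by
  obtain ⟨D', hD', rfl, hDp⟩ := exists_pos_root hD 5 (by norm_num)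
  obtain ⟨K', hK', rfl, hKp⟩ := exists_pos_root hK 5 (by norm_num)
  obtain ⟨R', hR', rfl, hRp⟩ := exists_pos_root hR 5 (by norm_num)
  rw [hDp 2 (2 / 5) (by norm_num), hDp 8 (8 / 5) (by norm_num), hKp 3 (3 / 5) (by norm_num),
    hKp 2 (2 / 5) (by norm_num), hRp 1 (1 / 5) (by norm_num), hRp 4 (4 / 5) (by norm_num)]
  field_simp

lemma bias_drift_term_le (hD : 0 < D) (hK : 0 < K) (hR : 0 < R) (hL : 0 < L) (hσ : 0 < σ)
    (he : 1 ≤ e) {η : ℝ} (hη : 0 < η)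
    (h : η ≤ D ^ (2 / 5 : ℝ) / (σ ^ (2 / 5 : ℝ) * L ^ (2 / 5 : ℝ) * e ^ (1 / 10 : ℝ) *
        K ^ (3 / 5 : ℝ) * R ^ (1 / 5 : ℝ))) :
    η ^ 4 * K ^ 2 * L ^ 2 * σ ^ 2 ≤ D ^ 2 / (η * (K * R)) := by
  have he1 : 1 ≤ e ^ (1 / 10 : ℝ) := Real.one_le_rpow he (by norm_num)
  obtain ⟨D', hD', rfl, hDp⟩ := exists_pos_root hD 5 (by norm_num)
  obtain ⟨K', hK', rfl, hKp⟩ := exists_pos_root hK 5 (by norm_num)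
  obtain ⟨R', hR', rfl, hRp⟩ := exists_pos_root hR 5 (by norm_num)
  obtain ⟨L', hL', rfl, hLp⟩ := exists_pos_root hL 5 (by norm_num)
  obtain ⟨σ', hσ', rfl, hσp⟩ := exists_pos_root hσ 5 (by norm_num)
  rw [hDp 2 (2 / 5) (by norm_num), hKp 3 (3 / 5) (by norm_num), hRp 1 (1 / 5) (by norm_num),
    hLp 2 (2 / 5) (by norm_num), hσp 2 (2 / 5) (by norm_num), le_div_iff₀ (by positivity)] at h
  rw [le_div_iff₀ (by positivity)]
  have h1 : η * (σ' ^ 2 * L' ^ 2 * 1 * K' ^ 3 * R' ^ 1) ≤ D' ^ 2 := by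
    refine le_trans ?_ h
    gcongr
  calc _ = (η * (σ' ^ 2 * L' ^ 2 * 1 * K' ^ 3 * R' ^ 1)) ^ 5 := by ring
    _ ≤ (D' ^ 2) ^ 5 := by gcongr
    _ = _ := by ring

lemma drift_term_eq (hD : 0 < D) (hK : 0 < K) (hR : 0 < R) (hL : 0 < L) (hσ : 0 < σ) :
    D ^ 2 / (D ^ (2 / 3 : ℝ) / (K ^ (2 / 3 : ℝ) * R ^ (1 / 3 : ℝ) * σ ^ (2 / 3 : ℝ) *
        L ^ (2 / 3 : ℝ)) * (K * R)) =
      D ^ (4 / 3 : ℝ) * σ ^ (2 / 3 : ℝ) * L ^ (2 / 3 : ℝ) /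
        (K ^ (1 / 3 : ℝ) * R ^ (2 / 3 : ℝ)) := by
  obtain ⟨D', hD', rfl, hDp⟩ := exists_pos_root hD 3 (by norm_num)
  obtain ⟨K', hK', rfl, hKp⟩ := exists_pos_root hK 3 (by norm_num)
  obtain ⟨R', hR', rfl, hRp⟩ := exists_pos_root hR 3 (by norm_num)
  rw [hDp 2 (2 / 3) (by norm_num), hDp 4 (4 / 3) (by norm_num), hKp 1 (1 / 3) (by norm_num),
    hKp 2 (2 / 3) (by norm_num), hRp 1 (1 / 3) (by norm_num), hRp 2 (2 / 3) (by norm_num)]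
  field_simp

lemma drift_term_le (hD : 0 < D) (hK : 0 < K) (hR : 0 < R) (hL : 0 < L) (hσ : 0 < σ)
    {η : ℝ} (hη : 0 < η)
    (h : η ≤ D ^ (2 / 3 : ℝ) / (K ^ (2 / 3 : ℝ) * R ^ (1 / 3 : ℝ) * σ ^ (2 / 3 : ℝ) *
        L ^ (2 / 3 : ℝ))) :
    η ^ 2 * K * L ^ 2 * σ ^ 2 ≤ D ^ 2 / (η * (K * R)) := by
  obtain ⟨D', hD', rfl, hDp⟩ := exists_pos_root hD 3 (by norm_num)
  obtain ⟨K', hK', rfl, hKp⟩ := exists_pos_root hK 3 (by norm_num)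
  obtain ⟨R', hR', rfl, hRp⟩ := exists_pos_root hR 3 (by norm_num)
  obtain ⟨L', hL', rfl, hLp⟩ := exists_pos_root hL 3 (by norm_num)
  obtain ⟨σ', hσ', rfl, hσp⟩ := exists_pos_root hσ 3 (by norm_num)
  rw [hDp 2 (2 / 3) (by norm_num), hKp 2 (2 / 3) (by norm_num), hRp 1 (1 / 3) (by norm_num),
    hLp 2 (2 / 3) (by norm_num), hσp 2 (2 / 3) (by norm_num), le_div_iff₀ (by positivity)] at h
  rw [le_div_iff₀ (by positivity)]
  calc _ = (η * (K' ^ 2 * R' ^ 1 * σ' ^ 2 * L' ^ 2)) ^ 3 := by ring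
    _ ≤ (D' ^ 2) ^ 3 := by gcongr
    _ = _ := by ring

lemma variance_term_eq {M : ℝ} (hD : 0 < D) (hM : 0 < M) (hK : 0 < K) (hR : 0 < R) (hσ : 0 < σ) :
    D ^ 2 / (D * √M / (σ * √(K * R)) * (K * R)) = D * σ / √(M * K * R) := by
  rw [mul_assoc M, Real.sqrt_mul hM.le]
  have h1 : √(K * R) * √(K * R) = K * R := Real.mul_self_sqrt (by positivity)
  nth_rewrite 2 [← h1]
  have h2 : 0 < √(K * R) := by positivity
  have h3 : 0 < √M := by positivity
  field_simp

lemma variance_term_le {M : ℝ} (hM : 0 < M) (hK : 0 < K) (hR : 0 < R) (hσ : 0 < σ)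
    {η : ℝ} (h : η ≤ D * √M / (σ * √(K * R))) :
    η * σ ^ 2 / M ≤ D * σ / √(M * K * R) := by
  rw [mul_assoc M, Real.sqrt_mul hM.le]
  have h1 : √M * √M = M := Real.mul_self_sqrt hM.le
  have h2 : 0 < √(K * R) := by positivity
  have h3 : 0 < √M := by positivity
  calc η * σ ^ 2 / M ≤ D * √M / (σ * √(K * R)) * σ ^ 2 / M := by gcongr
    _ = D * √M / (σ * √(K * R)) * σ ^ 2 / (√M * √M) := by rw [h1]
    _ = _ := by field_simp

end StepSizeTerms

/-- The sum of the polynomial terms in the final bound. -/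
noncomputable def rate (d M K R : ℕ) (L σ D : ℝ) : ℝ :=
  (D ^ 2 * L / ((K : ℝ) * (R : ℝ))
      + D * σ / √((M : ℝ) * (K : ℝ) * (R : ℝ))
      + D ^ (4 / 3 : ℝ) * σ ^ (2 / 3 : ℝ) * L ^ (2 / 3 : ℝ) /
          ((K : ℝ) ^ (1 / 3 : ℝ) * (R : ℝ) ^ (2 / 3 : ℝ)))
    + (D ^ (3 / 2 : ℝ) * L ^ (1 / 2 : ℝ) * σ ^ (1 / 2 : ℝ) * (d : ℝ) ^ (1 / 8 : ℝ) /
          ((K : ℝ) ^ (3 / 4 : ℝ) * (R : ℝ) ^ (3 / 4 : ℝ))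
      + D ^ (8 / 5 : ℝ) * σ ^ (2 / 5 : ℝ) * L ^ (2 / 5 : ℝ) * (d : ℝ) ^ (1 / 10 : ℝ) /
          ((R : ℝ) ^ (4 / 5 : ℝ) * (K : ℝ) ^ (2 / 5 : ℝ)))

section StepSize

variable {d M K R : ℕ} {L σ D : ℝ}

lemma stepSize_pos (hd : 1 ≤ d) (hM : 1 ≤ M) (hK : 1 ≤ K) (hR : 1 ≤ R) (hL : 0 < L) (hσ : 0 < σ)
    (hD : 0 < D) : 0 < stepSize d M K R L σ D := by
  unfold stepSize
  refine lt_min (by positivity) (lt_min (by positivity) (lt_min (by positivity)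
    (lt_min (by positivity) (by positivity))))

/-- The minimum is attained by one of the five candidates, and inserting a candidate into `D² / (η K
R)` yields exactly one of the five positive summands of the rate. -/
lemma div_stepSize_le_rate (hd : 1 ≤ d) (hM : 1 ≤ M) (hK : 1 ≤ K) (hR : 1 ≤ R) (hL : 0 < L)
    (hσ : 0 < σ) (hD : 0 < D) :
    D ^ 2 / (stepSize d M K R L σ D * ((K : ℝ) * R)) ≤ rate d M K R L σ D := by
  have hd0 : (0 : ℝ) < d := by positivity
  have hM0 : (0 : ℝ) < M := by positivity
  have hK0 : (0 : ℝ) < K := by positivity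
  have hR0 : (0 : ℝ) < R := by positivity
  have e1 := smoothing_term_eq hD hK0 hR0 hL hσ hd0
  have e2 := bias_drift_term_eq hD hK0 hR0 hL hσ hd0
  have e3 := drift_term_eq hD hK0 hR0 hL hσ
  have e4 := variance_term_eq hD hM0 hK0 hR0 hσ
  have e5 : D ^ 2 / (1 / L * ((K : ℝ) * R)) = D ^ 2 * L / ((K : ℝ) * R) := by field_simp
  unfold stepSize rate
  rw [← e1, ← e2, ← e3, ← e4, ← e5]
  set a1 := D ^ (1 / 2 : ℝ) / ((K : ℝ) ^ (1 / 4 : ℝ) * (R : ℝ) ^ (1 / 4 : ℝ) * L ^ (1 / 2 : ℝ) *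
    σ ^ (1 / 2 : ℝ) * (d : ℝ) ^ (1 / 8 : ℝ))
  set a2 := D ^ (2 / 5 : ℝ) / (σ ^ (2 / 5 : ℝ) * L ^ (2 / 5 : ℝ) * (d : ℝ) ^ (1 / 10 : ℝ) *
    (K : ℝ) ^ (3 / 5 : ℝ) * (R : ℝ) ^ (1 / 5 : ℝ))
  set a3 := D ^ (2 / 3 : ℝ) / ((K : ℝ) ^ (2 / 3 : ℝ) * (R : ℝ) ^ (1 / 3 : ℝ) * σ ^ (2 / 3 : ℝ) *
    L ^ (2 / 3 : ℝ))
  set a4 := D * √(M : ℝ) / (σ * √((K : ℝ) * (R : ℝ)))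
  have p1 : 0 < D ^ 2 / (a1 * ((K : ℝ) * R)) := by positivity
  have p2 : 0 < D ^ 2 / (a2 * ((K : ℝ) * R)) := by positivity
  have p3 : 0 < D ^ 2 / (a3 * ((K : ℝ) * R)) := by positivity
  have p4 : 0 < D ^ 2 / (a4 * ((K : ℝ) * R)) := by positivity
  have p5 : 0 < D ^ 2 / (1 / L * ((K : ℝ) * R)) := by positivity
  rcases min_choice a1 (min a2 (min a3 (min a4 (1 / L)))) with h | h <;> rw [h]
  · linarith
  rcases min_choice a2 (min a3 (min a4 (1 / L))) with h | h <;> rw [h]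
  · linarith
  rcases min_choice a3 (min a4 (1 / L)) with h | h <;> rw [h]
  · linarith
  rcases min_choice a4 (1 / L) with h | h <;> rw [h] <;> linarith

lemma stepSize_bounds (hd : 1 ≤ d) (hM : 1 ≤ M) (hK : 1 ≤ K) (hR : 1 ≤ R) (hL : 0 < L)
    (hσ : 0 < σ) (hD : 0 < D) {η : ℝ} (hη : η = stepSize d M K R L σ D) :
    η * L ≤ 1 ∧ η ^ 3 * L ^ 2 * σ ^ 2 ≤ D ^ 2 / (η * ((K : ℝ) * R)) ∧
      η ^ 4 * (K : ℝ) ^ 2 * L ^ 2 * σ ^ 2 ≤ D ^ 2 / (η * ((K : ℝ) * R)) ∧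
      η ^ 2 * K * L ^ 2 * σ ^ 2 ≤ D ^ 2 / (η * ((K : ℝ) * R)) ∧
      η * σ ^ 2 / M ≤ D * σ / √((M : ℝ) * K * R) := by
  have hM0 : (0 : ℝ) < M := by positivity
  have hK0 : (0 : ℝ) < K := by positivity
  have hR0 : (0 : ℝ) < R := by positivity
  have hd1 : (1 : ℝ) ≤ d := by exact_mod_cast hd
  have hη0 : 0 < η := hη ▸ stepSize_pos hd hM hK hR hL hσ hD
  have h := hη.le
  unfold stepSize at h
  rw [le_min_iff, le_min_iff, le_min_iff, le_min_iff] at h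
  obtain ⟨h1, h2, h3, h4, h5⟩ := h
  refine ⟨?_, smoothing_term_le hD hK0 hR0 hL hσ hd1 hη0 h1,
    bias_drift_term_le hD hK0 hR0 hL hσ hd1 hη0 h2, drift_term_le hD hK0 hR0 hL hσ hη0 h3,
    variance_term_le hM0 hK0 hR0 hσ h4⟩
  rwa [le_div_iff₀ hL] at h5

end StepSize

/-! ### Estimates of the error terms -/

namespace Run

variable {Ξ Ω : Type*} {mΞ : MeasurableSpace Ξ} {mΩ : MeasurableSpace Ω} {P : Measure Ω}
  {ν : Measure Ξ} {d M : ℕ} (A : Run P ν d M)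

lemma decayRate_pow_sq (H : ℕ) : (decayRate ^ H) ^ 2 = (3 / 4 : ℝ) ^ H := by
  rw [← pow_mul, mul_comm, pow_mul, decayRate_sq]

lemma err_sq_le :
    A.err ^ 2 ≤ 2 * A.η ^ 2 * ((3 / 4) ^ A.H * A.G ^ 2) + 32 * A.η ^ 2 * A.σ ^ 2 := by
  have h := decayRate_pow_sq A.H
  unfold err innerError
  rw [← h]
  nlinarith [sq_nonneg (decayRate ^ A.H * (A.η * A.G) - 4 * (A.η * A.σ))]

lemma resBias_sq_div_le :
    A.resBias ^ 2 / A.η ≤ 32 * A.η * ((3 / 4) ^ A.H * A.G ^ 2) +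
      162 * (A.η ^ 3 * A.L ^ 2 * A.σ ^ 2) := by
  have hη := A.steps.eta_pos
  have h := decayRate_pow_sq A.H
  have h0 := A.resBias_nonneg
  have hr := decayRate_nonneg
  have hG := A.regular.bound_nonneg
  have h1 : A.resBias ≤ 4 * (decayRate ^ A.H * (A.η * A.G)) + 9 * (A.η ^ 2 * A.L * A.σ) := by
    have : A.η * A.L * (decayRate ^ A.H * (A.η * A.G)) ≤ 1 * (decayRate ^ A.H * (A.η * A.G)) := by
      gcongr
      exact A.steps.eta_mul_le
    unfold resBias meanError err innerError
    nlinarith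
  have h2 := pow_le_pow_left₀ h0 h1 2
  rw [div_le_iff₀ hη, ← h]
  nlinarith [sq_nonneg (4 * (decayRate ^ A.H * (A.η * A.G)) - 9 * (A.η ^ 2 * A.L * A.σ))]

lemma driftBound_nonneg : 0 ≤ A.driftBound := by
  unfold driftBound; positivity

/-- Each of the two summands of `driftBound` bounds its square root from below. Hence this remainder
is at most a quarter of `X`, whichever bound `X` for the averaged pairings is used. -/
lemma err_mul_sqrt_driftBound_le :
    A.L * A.err * √A.driftBound ≤ A.L * A.driftBound / 4 ∧
      A.L * A.err * √A.driftBound ≤ A.driftBound / (A.K * A.η) / 4 := by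
  have hη := A.steps.eta_pos
  have hL := A.steps.L_pos
  have he := A.err_pos
  have hK := A.period_pos
  have hK1 : (1 : ℝ) ≤ A.K := by exact_mod_cast hK
  have hU := A.driftBound_nonneg
  have hs := Real.sq_sqrt hU
  have hs0 := Real.sqrt_nonneg A.driftBound
  have hUe : A.driftBound = 16 * (A.K : ℝ) ^ 2 * (A.η * A.L * A.err) ^ 2 +
    8 * A.K * (3 * A.err ^ 2) := rfl
  set u := √A.driftBound
  constructor
  · have h1 : 4 * A.err ≤ u := by
      refine le_of_sq_le_sq ?_ hs0
      rw [hs, hUe]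
      nlinarith [mul_le_mul_of_nonneg_right hK1 (sq_nonneg A.err),
        (by positivity : 0 ≤ 16 * (A.K : ℝ) ^ 2 * (A.η * A.L * A.err) ^ 2)]
    rw [← hs]
    nlinarith [mul_le_mul_of_nonneg_left (mul_le_mul_of_nonneg_right h1 hs0) hL.le]
  · have h1 : 4 * (A.K * A.η * A.L * A.err) ≤ u := by
      refine le_of_sq_le_sq ?_ hs0
      rw [hs, hUe]
      nlinarith [(by positivity : 0 ≤ 8 * A.K * (3 * A.err ^ 2))]
    rw [div_div, le_div_iff₀ (by positivity), ← hs]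
    nlinarith [mul_le_mul_of_nonneg_right h1 hs0]

/-- The smaller of the two bounds for the contribution of the drift. -/
lemma min_driftBound_le :
    A.L * A.driftBound ≤ 40 * A.L * A.K * A.err ^ 2 ∨
      A.driftBound / (A.K * A.η) ≤ 40 * A.K * A.η * A.L ^ 2 * A.err ^ 2 := by
  have hη := A.steps.eta_pos
  have hL := A.steps.L_pos
  have he := A.err_pos
  have hK := A.period_pos
  have hK0 : (0 : ℝ) < A.K := by exact_mod_cast hK
  have hUe : A.driftBound = 8 * A.K * A.err ^ 2 * (2 * (A.K * A.η ^ 2 * A.L ^ 2) + 3) := by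
    unfold driftBound; ring
  rw [hUe]
  -- The threshold `K η² L² = 1` is where the variance part and the bias part of the drift are of
  -- the same order.
  rcases le_total (A.K * A.η ^ 2 * A.L ^ 2) 1 with h | h
  · left
    calc _ ≤ A.L * (8 * A.K * A.err ^ 2 * (2 * 1 + 3)) := by gcongr
      _ = _ := by ring
  · right
    rw [div_le_iff₀ (by positivity)]
    calc _ ≤ 8 * A.K * A.err ^ 2 *
          (2 * (A.K * A.η ^ 2 * A.L ^ 2) + 3 * (A.K * A.η ^ 2 * A.L ^ 2)) := by
          gcongr
          linarith
      _ = _ := by ring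

/-- Bookkeeping with `i = 1/L₀` and `j = 1/L₀³`. The largest coefficients are `1/2 + 162 + 960` for
`Q` and `80 + 960` for `i Q`, whence `1200`. -/
lemma combine_errors {Q S g g' i j a b v r e x : ℝ} (hQ : 0 ≤ Q) (hS : 0 ≤ S) (hg : 0 ≤ g)
    (hg' : 0 ≤ g') (hi : 0 ≤ i) (hj : 0 ≤ j) (hv : v ≤ S / 2) (hr : r ≤ 32 * a + 162 * Q)
    (he : e ≤ 2 * a + 32 * (i * Q)) (hx : x ≤ 60 * b + 960 * (i * Q) + 960 * Q)
    (ha : a ≤ i * g) (hb : b ≤ j * g') :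
    Q / 2 + S + v + r + 5 / 2 * e + x ≤ 1200 * (1 + i + j) * (Q + S + (g + g')) := by
  have h1 : 0 ≤ i * (S + g') := by positivity
  have h2 : 0 ≤ j * (Q + S + g) := by positivity
  have h3 : 0 ≤ i * Q := by positivity
  have h4 : 0 ≤ i * g := by positivity
  have h5 : 0 ≤ j * g' := by positivity
  have e1 : 1200 * (1 + i + j) * (Q + S + (g + g')) = 1200 * (Q + S + g + g') + 1200 * (i * Q) +
      1200 * (i * g) + 1200 * (i * (S + g')) + 1200 * (j * (Q + S + g)) + 1200 * (j * g') := by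
    ring
  rw [e1]
  linarith

/-- The expected gap in terms of `Q = D² / (η T)`, the statistical error `S` and the contribution
of the finite number of inner steps. -/
theorem integral_gap_le_of_bounds [IsProbabilityMeasure P] {D : ℝ} (hD : 0 < D) {T : ℕ}
    (hT : 1 ≤ T) {L₀ Q S : ℝ} (hL₀ : 0 < L₀) (hL : L₀ ≤ A.L) (hQ : D ^ 2 / (A.η * T) = Q)
    (hS : D * A.σ / √(M * T) = S) (h1 : A.η ^ 3 * A.L ^ 2 * A.σ ^ 2 ≤ Q)
    (h2 : A.η ^ 4 * (A.K : ℝ) ^ 2 * A.L ^ 2 * A.σ ^ 2 ≤ Q)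
    (h3 : A.η ^ 2 * A.K * A.L ^ 2 * A.σ ^ 2 ≤ Q) (h4 : A.η * A.σ ^ 2 / M ≤ S) :
    Integrable (fun ω => gap A.V D (A.mean T ω)) P ∧
    ∫ ω, gap A.V D (A.mean T ω) ∂P ≤ 1200 * (1 + 1 / L₀ + 1 / L₀ ^ 3) *
      (Q + S + (3 / 4) ^ A.H * (A.G ^ 2 + (A.K : ℝ) ^ 2 * A.L ^ 2 * A.G ^ 2)) := by
  have hη := A.steps.eta_pos
  have hLp := A.steps.L_pos
  have hσ := A.steps.sigma_pos
  have hηL := A.steps.eta_mul_le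
  have hK1 : (1 : ℝ) ≤ A.K := by exact_mod_cast A.period_pos
  have hK0 : (0 : ℝ) < A.K := by positivity
  have hM := A.machines_pos
  have hM0 : (0 : ℝ) < M := by positivity
  have hT0 : (0 : ℝ) < T := by positivity
  set g := (3 / 4 : ℝ) ^ A.H * A.G ^ 2 with hg
  have hg0 : 0 ≤ g := by positivity
  have hQ0 : 0 ≤ Q := by rw [← hQ]; positivity
  have hS0 : 0 ≤ S := by rw [← hS]; positivity
  have he := A.err_sq_le
  have hb := A.resBias_sq_div_le
  rw [← hg] at he hb
  have hηle : A.η ≤ 1 / A.L := by rwa [le_div_iff₀ hLp]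
  have hinv : 1 / A.L ≤ 1 / L₀ := one_div_le_one_div_of_le hL₀ hL
  have hLη : A.L * A.η ^ 2 ≤ 1 / A.L := by
    calc A.L * A.η ^ 2 = (A.η * A.L) * A.η := by ring
      _ ≤ 1 * (1 / A.L) := by gcongr
      _ = _ := one_mul _
  have hLη3 : A.η ^ 3 * A.L ^ 2 ≤ 1 / A.L := by
    calc A.η ^ 3 * A.L ^ 2 = (A.η * A.L) * (A.L * A.η ^ 2) := by ring
      _ ≤ 1 * (1 / A.L) := by gcongr
      _ = _ := one_mul _
  -- The step size controls `K L² η² σ²`, one factor `L` more than occurs here; the lower bound `L₀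
  -- ≤ L` removes it.
  have hdrift : A.K * (A.L * A.η ^ 2 * A.σ ^ 2) ≤ Q / L₀ := by
    rw [le_div_iff₀ hL₀]
    calc _ ≤ A.K * (A.L * A.η ^ 2 * A.σ ^ 2) * A.L := by gcongr
      _ = A.η ^ 2 * A.K * A.L ^ 2 * A.σ ^ 2 := by ring
      _ ≤ Q := h3
  have hvar : A.L * A.η ^ 2 * A.σ ^ 2 ≤ Q / L₀ :=
    (le_mul_of_one_le_left (by positivity) hK1).trans hdrift
  have hbias : A.K * A.η ^ 3 * A.L ^ 2 * A.σ ^ 2 ≤ Q := by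
    -- The arithmetic–geometric mean inequality interpolates between the two drift restrictions on
    -- the step size.
    have a1 : 2 * (A.K * A.η ^ 3) ≤ A.η ^ 4 * (A.K : ℝ) ^ 2 + A.η ^ 2 * A.K := by
      nlinarith [sq_nonneg (A.η ^ 2 * A.K - A.η), mul_le_mul_of_nonneg_left hK1 (sq_nonneg A.η)]
    have a2 := mul_le_mul_of_nonneg_right a1 (by positivity : 0 ≤ A.L ^ 2 * A.σ ^ 2)
    linarith
  have hgL : g / A.L ≤ 1 / L₀ * g := by
    rw [div_eq_mul_one_div, mul_comm]
    gcongr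
  have hKg : A.K * (g / A.L) ≤ 1 / L₀ ^ 3 * ((A.K : ℝ) ^ 2 * A.L ^ 2 * g) := by
    -- Brings the remainder `K G² / L` to the form `K² L² G²` of the claimed bound; this is the
    -- origin of `1 / L₀³` in the constant.
    have b1 : 1 / A.L ≤ 1 / L₀ ^ 3 * A.L ^ 2 := by
      rw [one_div_mul_eq_div, div_le_div_iff₀ hLp (by positivity)]
      calc 1 * L₀ ^ 3 ≤ 1 * A.L ^ 3 := by gcongr
        _ = _ := by ring
    calc A.K * (g / A.L) = A.K * (1 / A.L) * g := by ring
      _ ≤ (A.K : ℝ) ^ 2 * (1 / L₀ ^ 3 * A.L ^ 2) * g := by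
        gcongr
        exact le_self_pow₀ hK1 two_ne_zero
      _ = _ := by ring
  have hd1 : D ^ 2 / (2 * A.η * T) = Q / 2 := by rw [← hQ]; field_simp
  have hd2 : A.η * A.σ ^ 2 / (2 * M) ≤ S / 2 := by
    have : A.η * A.σ ^ 2 / (2 * M) = A.η * A.σ ^ 2 / M / 2 := by field_simp
    rw [this]; linarith
  have hηg : A.η * g ≤ g / A.L := by
    calc A.η * g ≤ 1 / A.L * g := by gcongr
      _ = _ := by ring
  have hLg : A.L * A.η ^ 2 * g ≤ g / A.L := by
    calc _ ≤ 1 / A.L * g := by gcongr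
      _ = _ := by ring
  have hLe : A.L * A.err ^ 2 ≤ 2 * (g / A.L) + 32 * (Q / L₀) := by
    calc A.L * A.err ^ 2 ≤ A.L * (2 * A.η ^ 2 * g + 32 * A.η ^ 2 * A.σ ^ 2) := by gcongr
      _ = 2 * (A.L * A.η ^ 2 * g) + 32 * (A.L * A.η ^ 2 * A.σ ^ 2) := by ring
      _ ≤ _ := by gcongr
  -- The two drift regimes differ only in the bound `X` for the averaged pairings. In both, `X/2`
  -- plus the remainder is at most `3X/4`, so the factor `40` becomes `30` below.
  have key : ∀ X : ℝ, (∀ m m', ∑ t ∈ Finset.range T, A.pairing t m m' ≤ T * X) →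
      X / 2 + A.L * A.err * √A.driftBound ≤ 60 * (A.K * (g / A.L)) + 960 * (Q / L₀) + 960 * Q →
      ∫ ω, gap A.V D (A.mean T ω) ∂P ≤ 1200 * (1 + 1 / L₀ + 1 / L₀ ^ 3) *
      (Q + S + (3 / 4) ^ A.H * (A.G ^ 2 + (A.K : ℝ) ^ 2 * A.L ^ 2 * A.G ^ 2)) := by
    intro X hX hXb
    refine (A.integral_gap_le hD hT hX).2.trans ?_
    rw [hd1, hS]
    have hfin : (3 / 4) ^ A.H * (A.G ^ 2 + (A.K : ℝ) ^ 2 * A.L ^ 2 * A.G ^ 2) =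
        g + (A.K : ℝ) ^ 2 * A.L ^ 2 * g := by rw [hg]; ring
    rw [hfin]
    set G2 := (A.K : ℝ) ^ 2 * A.L ^ 2 * g
    have hG2 : 0 ≤ G2 := by positivity
    have hi : 0 < 1 / L₀ := by positivity
    have hi3 : 0 < 1 / L₀ ^ 3 := by positivity
    have hQL : Q / L₀ = 1 / L₀ * Q := by ring
    rw [hQL] at hXb hLe
    rw [mul_assoc (5 / 2 : ℝ)]
    exact combine_errors hQ0 hS0 hg0 hG2 hi.le hi3.le hd2 (hb.trans (by linarith)) hLe hXb hgL hKg
  obtain ⟨hr1, hr2⟩ := A.err_mul_sqrt_driftBound_le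
  refine ⟨(A.integral_gap_le hD hT (X := A.driftBound / (A.K * A.η))
    fun m m' => (A.drift_bounds m m').2 T).1, ?_⟩
  rcases A.min_driftBound_le with hmin | hmin
  · refine key (A.L * A.driftBound) (fun m m' => ?_) ?_
    · calc _ ≤ ∑ _t ∈ Finset.range T, A.L * A.driftBound := by
            refine Finset.sum_le_sum fun t _ => (A.pairing_le t m m').trans ?_
            gcongr
            exact (A.drift_bounds m m').1 t
        _ = _ := by simp
    · have c1 : 30 * A.L * A.K * A.err ^ 2 ≤ 60 * (A.K * (g / A.L)) + 960 * (Q / L₀) := by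
        calc 30 * A.L * A.K * A.err ^ 2
            ≤ 30 * A.L * A.K * (2 * A.η ^ 2 * g + 32 * A.η ^ 2 * A.σ ^ 2) := by gcongr
          _ = 60 * (A.K * (A.L * A.η ^ 2 * g)) + 960 * (A.K * (A.L * A.η ^ 2 * A.σ ^ 2)) := by ring
          _ ≤ _ := by gcongr
      linarith
  · refine key (A.driftBound / (A.K * A.η)) (fun m m' => (A.drift_bounds m m').2 T) ?_
    have c1 : 30 * A.K * A.η * A.L ^ 2 * A.err ^ 2 ≤ 60 * (A.K * (g / A.L)) + 960 * Q := by
      have c4 : A.η ^ 3 * A.L ^ 2 * g ≤ g / A.L := by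
        calc _ ≤ 1 / A.L * g := by gcongr
          _ = _ := by ring
      calc 30 * A.K * A.η * A.L ^ 2 * A.err ^ 2
          ≤ 30 * A.K * A.η * A.L ^ 2 * (2 * A.η ^ 2 * g + 32 * A.η ^ 2 * A.σ ^ 2) := by gcongr
        _ = 60 * (A.K * (A.η ^ 3 * A.L ^ 2 * g)) + 960 * (A.K * A.η ^ 3 * A.L ^ 2 * A.σ ^ 2) := by
          ring
        _ ≤ _ := by gcongr
    have c5 : 0 ≤ Q / L₀ := by positivity
    linarith

end Run

end Slippax

/-! ### Assembly of the theorem -/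

theorem mainTheorem7 (L₀ : ℝ) (hL₀ : 0 < L₀) :
    ∃ C : ℝ, 0 < C ∧
      ∀ (d M K R H : ℕ) (_ : 1 ≤ d) (_ : 1 ≤ M) (_ : 1 ≤ K) (_ : 1 ≤ R) (_ : 1 ≤ H)
        (L σ D G : ℝ) (_ : L₀ ≤ L) (_ : 0 < σ) (_ : 0 < D)
        (V : Slippax.Vec d → Slippax.Vec d)
        (_ : Slippax.SmoothOperator L V) (_ : Slippax.MonotoneOperator V) (_ : ∀ x, ‖V x‖ ≤ G)
        (Ξ : Type*) [MeasurableSpace Ξ] (ν : MeasureTheory.Measure Ξ)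
        [MeasureTheory.IsProbabilityMeasure ν]
        (Vt : Slippax.Vec d → Ξ → Slippax.Vec d) (_ : Slippax.UnbiasedOracle ν Vt V σ)
        (Ω : Type*) [MeasurableSpace Ω] (P : MeasureTheory.Measure Ω)
        [MeasureTheory.IsProbabilityMeasure P]
        (s : ℕ → Fin M → ℕ → Ω → Slippax.Vec d) (ξ : ℕ → Fin M → ℕ → Ω → Ξ)
        (_ : Slippax.IndependentSamples P ν s ξ)
        (η γ δ : ℝ) (_ : η = Slippax.stepSize d M K R L σ D)
        (_ : γ = Slippax.innerStepSize η L) (_ : δ = Slippax.smoothingRadius d η σ)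
        (xo : Ω → Slippax.Vec d)
        (_ : ∀ ω, xo ω = Slippax.output Vt η γ δ K H (K * R)
          (fun t m ℓ => s t m ℓ ω) (fun t m ℓ => ξ t m ℓ ω)),
        MeasureTheory.Integrable (fun ω => Slippax.gap V D (xo ω)) P ∧
        ∫ ω, Slippax.gap V D (xo ω) ∂P ≤
          C * ((D ^ 2 * L / ((K : ℝ) * (R : ℝ))
                + D * σ / √((M : ℝ) * (K : ℝ) * (R : ℝ))
                + D ^ (4 / 3 : ℝ) * σ ^ (2 / 3 : ℝ) * L ^ (2 / 3 : ℝ) /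
                    ((K : ℝ) ^ (1 / 3 : ℝ) * (R : ℝ) ^ (2 / 3 : ℝ)))
              + (D ^ (3 / 2 : ℝ) * L ^ (1 / 2 : ℝ) * σ ^ (1 / 2 : ℝ) * (d : ℝ) ^ (1 / 8 : ℝ) /
                    ((K : ℝ) ^ (3 / 4 : ℝ) * (R : ℝ) ^ (3 / 4 : ℝ))
                + D ^ (8 / 5 : ℝ) * σ ^ (2 / 5 : ℝ) * L ^ (2 / 5 : ℝ) * (d : ℝ) ^ (1 / 10 : ℝ) /
                    ((R : ℝ) ^ (4 / 5 : ℝ) * (K : ℝ) ^ (2 / 5 : ℝ)))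
              + (3 / 4 : ℝ) ^ H *
                  (G ^ 2 + (K : ℝ) ^ 2 * L ^ 2 * G ^ 2
                    + (H : ℝ) ^ 2 * L ^ 2 * (d : ℝ) ^ (1 / 2 : ℝ) * G ^ 4 / σ ^ 2)) := by
  -- The factor `2` arises because `Q` and the statistical term are each bounded by the whole rate.
  refine ⟨2 * (1200 * (1 + 1 / L₀ + 1 / L₀ ^ 3)), by positivity, ?_⟩
  intro d M K R H hd hM hK hR _ L σ D G hL hσ hD V hVs hVm hVb Ξ _ ν _ Vt ho Ω _ P _ s ξ hS
    η γ δ hη hγ hδ xo hxo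
  have hL0 : 0 < L := hL₀.trans_le hL
  obtain ⟨b1, b2, b3, b4, b5⟩ := Slippax.stepSize_bounds hd hM hK hR hL0 hσ hD hη
  have hη0 : 0 < η := hη ▸ Slippax.stepSize_pos hd hM hK hR hL0 hσ hD
  let A : Slippax.Run P ν d M :=
    { K := K, H := H, L := L, σ := σ, G := G, η := η, γ := γ, δ := δ, V := V, Vt := Vt
      s := s, ξ := ξ, machines_pos := hM, period_pos := hK
      regular := ⟨hVs, hVm, hVb⟩
      steps := ⟨hd, hL0, hσ, hη0, b1, hγ, hδ⟩
      oracle := ho, samples := hS }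
  have hxA : xo = A.mean (K * R) := by
    ext1 ω
    rw [hxo ω, Slippax.output, Slippax.Run.mean]
    congr 1
    refine Finset.sum_congr rfl fun m _ => ?_
    -- Index shift: `Run.x t` is the point of iteration `t + 1`.
    have hIcc : Finset.Icc 1 (K * R) = Finset.Ico (0 + 1) (K * R + 1) := by
      ext t
      simp only [Finset.mem_Icc, Finset.mem_Ico]
      omega
    rw [Finset.range_eq_Ico, hIcc, ← Finset.sum_Ico_add']
    rfl
  have hT : 1 ≤ K * R := Nat.one_le_iff_ne_zero.mpr (by positivity)
  have hmain := A.integral_gap_le_of_bounds hD hT hL₀ hL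
    (Q := D ^ 2 / (η * ((K : ℝ) * R))) (S := D * σ / √((M : ℝ) * K * R))
    (by push_cast; rfl) (by push_cast; rw [← mul_assoc]) b2 b3 b4 b5
  rw [hxA]
  refine ⟨hmain.1, hmain.2.trans ?_⟩
  have hrate := Slippax.div_stepSize_le_rate hd hM hK hR hL0 hσ hD
  rw [← hη] at hrate
  have hSr : D * σ / √((M : ℝ) * K * R) ≤ Slippax.rate d M K R L σ D := by
    unfold Slippax.rate
    have q1 : 0 ≤ D ^ 2 * L / ((K : ℝ) * (R : ℝ)) := by positivity
    have q2 : 0 ≤ D ^ (4 / 3 : ℝ) * σ ^ (2 / 3 : ℝ) * L ^ (2 / 3 : ℝ) /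
      ((K : ℝ) ^ (1 / 3 : ℝ) * (R : ℝ) ^ (2 / 3 : ℝ)) := by positivity
    have q3 : 0 ≤ D ^ (3 / 2 : ℝ) * L ^ (1 / 2 : ℝ) * σ ^ (1 / 2 : ℝ) * (d : ℝ) ^ (1 / 8 : ℝ) /
      ((K : ℝ) ^ (3 / 4 : ℝ) * (R : ℝ) ^ (3 / 4 : ℝ)) := by positivity
    have q4 : 0 ≤ D ^ (8 / 5 : ℝ) * σ ^ (2 / 5 : ℝ) * L ^ (2 / 5 : ℝ) * (d : ℝ) ^ (1 / 10 : ℝ) /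
      ((R : ℝ) ^ (4 / 5 : ℝ) * (K : ℝ) ^ (2 / 5 : ℝ)) := by positivity
    linarith
  -- The estimate already holds without this summand, which is added on the right as a nonnegative
  -- quantity.
  have hlast : 0 ≤ (H : ℝ) ^ 2 * L ^ 2 * (d : ℝ) ^ (1 / 2 : ℝ) * G ^ 4 / σ ^ 2 := by positivity
  change _ ≤ 2 * (1200 * (1 + 1 / L₀ + 1 / L₀ ^ 3)) * (Slippax.rate d M K R L σ D + (3 / 4 : ℝ) ^ H *
    (G ^ 2 + (K : ℝ) ^ 2 * L ^ 2 * G ^ 2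
      + (H : ℝ) ^ 2 * L ^ 2 * (d : ℝ) ^ (1 / 2 : ℝ) * G ^ 4 / σ ^ 2))
  rw [mul_comm 2, mul_assoc _ (2 : ℝ)]
  refine mul_le_mul_of_nonneg_left ?_ (by positivity)
  have hpow : (0 : ℝ) < (3 / 4) ^ H := by positivity
  have h5 : (3 / 4 : ℝ) ^ H * (G ^ 2 + (K : ℝ) ^ 2 * L ^ 2 * G ^ 2) ≤ (3 / 4 : ℝ) ^ H *
      (G ^ 2 + (K : ℝ) ^ 2 * L ^ 2 * G ^ 2 +
        (H : ℝ) ^ 2 * L ^ 2 * (d : ℝ) ^ (1 / 2 : ℝ) * G ^ 4 / σ ^ 2) := by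
    exact mul_le_mul_of_nonneg_left (by linarith) hpow.le
  have h6 : 0 ≤ (3 / 4 : ℝ) ^ H * (G ^ 2 + (K : ℝ) ^ 2 * L ^ 2 * G ^ 2) := by positivity
  change D ^ 2 / (η * ((K : ℝ) * R)) + D * σ / √((M : ℝ) * K * R) +
    (3 / 4 : ℝ) ^ H * (G ^ 2 + (K : ℝ) ^ 2 * L ^ 2 * G ^ 2) ≤ _
  linarith
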